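/- Let $m\ge 1$, let $e_1,\dots,e_m$ generate the complexified Clifford algebra $\mathbb C\otimes\mathbb R_{0,m}$, $e_ie_j+e_je_i=-2\delta_{ij}$, and let $\underline\partial=\sum_j e_j\partial_{x_j}$ be the Dirac operator in $\mathbb R^m$ and $\Delta_m$ the Laplace operator. Write $r=|\underline x|$, $\underline\omega=\sum_j e_j x_j/r$, $\sigma_m=2\pi^{m/2}/\Gamma(m/2)$, and for $\lambda\in\mathbb C$ let $T_\lambda=\mathrm{Fp}\,r^\lambda$ and $U_\lambda=\mathrm{Fp}\,r^\lambda\underline\omega$, that is, for $\varphi\in\mathcal S(\mathbb R^m)$, $$\langle T_\lambda,\varphi\rangle=\sigma_m\Big\langle \mathrm{Fp}\,r_+^{\lambda+m-1},\ \tfrac1{\sigma_m}\int_{S^{m-1}}\varphi(r\underline\omega)\,dS\Big\rangle,\qquad \langle U_\lambda,\varphi\rangle=\sigma_m\Big\langle \mathrm{Fp}\,r_+^{\lambda+m-1},\ \tfrac1{\sigma_m}\int_{S^{m-1}}\underline\omega\,\varphi(r\underline\omega)\,dS\Big\rangle,$$ where $\mathrm{Fp}\,r_+^{s}$ is the Hadamard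 finite part distribution on the half-line. Put $$T^*_\lambda=\pi^{\frac{\lambda+m}2}\frac{T_\lambda}{\Gamma(\frac{\lambda+m}2)}\ \ (\lambda\ne-m-2l),\qquad T^*_{-m-2l}=\frac{\pi^{\frac m2-l}}{2^{2l}\Gamma(\frac m2+l)}(-\Delta_m)^l\delta,$$ $$U^*_\lambda=\pi^{\frac{\lambda+m+1}2}\frac{U_\lambda}{\Gamma(\frac{\lambda+m+1}2)}\ \ (\lambda\ne-m-2l-1),\qquad U^*_{-m-2l-1}=-\frac{\pi^{\frac m2-l}}{2^{2l+1}\Gamma(\frac m2+l+1)}\,\underline\partial^{2l+1}\delta,$$ with $l=0,1,2,\dots$. For $\mu\in\mathbb C$, with $\mu\notin\{-m,-m-1,-m-2,\dots\}$ if $m$ is even, define $$\underline\partial^\mu\delta=\frac{1+e^{i\pi\mu}}2\,\frac{2^\mu\Gamma(\frac{m+\mu}2)}{\pi^{\frac{m-\mu}2}}\,T^*_{-m-\mu}-\frac{1-e^{i\pi\mu}}2\,\frac{2^\mu\Gamma(\frac{m+\mu+1}2)}{\pi^{\frac{m-\mu+1}2}}\,U^*_{-m-\mu},$$ where for an even (respectively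 odd) integer $\mu$ the second (respectively first) term, whose factor $(1\mp e^{i\pi\mu})/2$ vanishes, is absent. Let $\underline\partial^\mu[f]=\underline\partial^\mu\delta*f$ whenever this convolution exists, and let $E_\mu=\underline\partial^{-\mu}\delta$. Here the convolution of scalar tempered distributions $S,T$ exists and equals $R$ if for every $\varphi\in\mathcal S(\mathbb R^m)$, with $g(y)=\langle S_x,\varphi(x+y)\rangle$, one has $\langle T,\eta_kg\rangle\to\langle R,\varphi\rangle$ for every sequence of real-valued test functions $\eta_k$ that are eventually $1$ on each compact set and have every derivative bounded uniformly in $k$; and $(\sum_i s_ia_i)*(\sum_j t_jb_j)=\sum_{i,j}(s_i*t_j)\,a_ib_j$ for scalar tempered distributions $s_i,t_j$ and Clifford numbers $a_i,b_j$. **Corollary 4.1.** Let $\mu\in\mathbb C$ if $m$ is odd, and $\mu\in\mathbb C\setminus\{\pm m,\pm(m+1),\pm(m+2),\dots\}$ if $m$ is even. Then the convolution $\underline\partial^\mu\delta*\underline\partial^{-\mu}\delta$ exists and $$\underline\partial^\mu\delta*\underline\partial^{-\mu}\delta=\delta .$$ Hence the tempered distribution $E_\mu=\underline\partial^{-\mu}\delta$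 is a fundamental solution of the operator $\underline\partial^\mu$: $\ \underline\partial^\mu E_\mu=\delta$. -/

import Mathlib

open scoped SchwartzMap LineDeriv Laplacian ContDiff
open MeasureTheory Filter Topology

noncomputable section

namespace CliffordPowers

/-- Euclidean space `ℝᵐ`. -/
abbrev E (m : ℕ) := EuclideanSpace ℝ (Fin m)

/-! ### The Clifford algebra -/

/-- The quadratic form `-(z₁² + ⋯ + z_m²)` on `ℂᵐ`. -/
abbrev quadForm (m : ℕ) : QuadraticForm ℂ (Fin m → ℂ) :=
  QuadraticMap.weightedSumSquares ℂ (fun _ : Fin m => (-1 : ℂ))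

/-- The complexification `ℂ ⊗ ℝ_{0,m}` of the universal Clifford algebra of signature `(0,m)`. -/
abbrev Cl (m : ℕ) := CliffordAlgebra (quadForm m)

/-- The generators `e_j`, with `e_i e_j + e_j e_i = -2 δ_{ij}`. -/
def e {m : ℕ} (j : Fin m) : Cl m := CliffordAlgebra.ι (quadForm m) (Pi.single j 1)

/-! ### Clifford-valued functionals on the Schwartz space -/

/-- Clifford-algebra-valued functionals on scalar Schwartz functions. That a functional is a
tempered distribution (a finite sum `∑ S_A e_A` of scalar tempered distributions `S_A`) is
`IsTempered` below. -/
abbrev Functional (m : ℕ) := 𝓢(E m, ℂ) → Cl m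

/-- `S = ∑ᵢ sᵢ aᵢ` with scalar tempered distributions `sᵢ` and `aᵢ` in the Clifford algebra. -/
def Represents {m p : ℕ} (s : Fin p → 𝓢'(E m, ℂ)) (a : Fin p → Cl m) (S : Functional m) : Prop :=
  ∀ φ, S φ = ∑ i, s i φ • a i

/-- `S` is a Clifford-algebra-valued tempered distribution. -/
def IsTempered {m : ℕ} (S : Functional m) : Prop :=
  ∃ (p : ℕ) (s : Fin p → 𝓢'(E m, ℂ)) (a : Fin p → Cl m), Represents s a S

/-- The delta distribution. -/
def delta (m : ℕ) : Functional m := fun φ => algebraMap ℂ (Cl m) (φ 0)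

/-- The Dirac operator `∑ e_j ∂_{x_j}` acting from the left in the distributional sense,
`⟨∂_{x_j} S, φ⟩ = -⟨S, ∂_{x_j} φ⟩`. -/
def dirac {m : ℕ} (S : Functional m) : Functional m := fun φ =>
  -∑ j : Fin m, e j * S (∂_{(EuclideanSpace.single j (1 : ℝ) : E m)} φ)

/-- Minus the Laplace operator in the distributional sense, `⟨-Δ S, φ⟩ = ⟨S, -Δ φ⟩`. -/
def negLaplace {m : ℕ} (S : Functional m) : Functional m := fun φ => S (-(Δ φ))

/-! ### Finite parts and spherical means -/

/-- The pairing `⟨Fp r₊^s, ψ⟩` of the Hadamard finite part distribution `Fp r₊^s` on the real line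
with `ψ`: the Taylor polynomial of `ψ` of order `< N`, where `Re s + N > -1`, is subtracted on
`(0,1]` and the finite parts `Fp ∫₀¹ r^(s+j) dr = 1/(s+j+1)`, respectively `0` if `s+j+1 = 0`,
are added back. -/
def finitePart (s : ℂ) (ψ : ℝ → ℂ) : ℂ :=
  (∫ r in Set.Ioc (0 : ℝ) 1, (r : ℂ) ^ s *
      (ψ r - ∑ j ∈ Finset.range ⌈-s.re⌉₊, iteratedDeriv j ψ 0 / (j.factorial : ℂ) * (r : ℂ) ^ j))
    + (∫ r in Set.Ioi (1 : ℝ), (r : ℂ) ^ s * ψ r)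
    + ∑ j ∈ Finset.range ⌈-s.re⌉₊,
        if s + j + 1 = 0 then 0 else iteratedDeriv j ψ 0 / (j.factorial : ℂ) * (1 / (s + j + 1))

/-- The area `σ_m` of the unit sphere in `ℝᵐ`. -/
def sphereArea (m : ℕ) : ℝ := 2 * Real.pi ^ ((m : ℝ) / 2) / Real.Gamma ((m : ℝ) / 2)

/-- The spherical mean `Σ⁽⁰⁾[φ](r)`. -/
def mean0 {m : ℕ} (φ : 𝓢(E m, ℂ)) (r : ℝ) : ℂ :=
  (1 / (sphereArea m : ℂ)) *
    ∫ w : Metric.sphere (0 : E m) 1, φ (r • (w : E m)) ∂(volume : Measure (E m)).toSphere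

/-- The `j`-th coordinate of the vector-valued spherical mean
`Σ⁽¹⁾[φ](r) = (1/σ_m) ∫ ω φ(r ω) dS(ω)`. -/
def mean1 {m : ℕ} (φ : 𝓢(E m, ℂ)) (j : Fin m) (r : ℝ) : ℂ :=
  (1 / (sphereArea m : ℂ)) *
    ∫ w : Metric.sphere (0 : E m) 1, (((w : E m) j : ℝ) : ℂ) * φ (r • (w : E m))
      ∂(volume : Measure (E m)).toSphere

/-! ### The families `T_λ`, `U_λ` and their normalizations -/

/-- `T_λ = Fp r^λ`. -/
def T (m : ℕ) (l : ℂ) : Functional m := fun φ =>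
  algebraMap ℂ (Cl m) ((sphereArea m : ℂ) * finitePart (l + m - 1) (mean0 φ))

/-- `U_λ = Fp r^λ ω`. -/
def U (m : ℕ) (l : ℂ) : Functional m := fun φ =>
  ∑ j : Fin m, ((sphereArea m : ℂ) * finitePart (l + m - 1) (mean1 φ j)) • e j

open Classical in
/-- The normalized distribution `T*_λ`. -/
def Tstar (m : ℕ) (l : ℂ) : Functional m :=
  if h : ∃ n : ℕ, l = -(m : ℂ) - 2 * n then
    ((Real.pi : ℂ) ^ ((m : ℂ) / 2 - h.choose)
        / (2 ^ (2 * h.choose) * Complex.Gamma ((m : ℂ) / 2 + h.choose))) •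
      negLaplace^[h.choose] (delta m)
  else
    ((Real.pi : ℂ) ^ ((l + m) / 2) / Complex.Gamma ((l + m) / 2)) • T m l

open Classical in
/-- The normalized distribution `U*_λ`. -/
def Ustar (m : ℕ) (l : ℂ) : Functional m :=
  if h : ∃ n : ℕ, l = -(m : ℂ) - 2 * n - 1 then
    (-((Real.pi : ℂ) ^ ((m : ℂ) / 2 - h.choose)
        / (2 ^ (2 * h.choose + 1) * Complex.Gamma ((m : ℂ) / 2 + h.choose + 1)))) •
      dirac^[2 * h.choose + 1] (delta m)
  else
    ((Real.pi : ℂ) ^ ((l + m + 1) / 2) / Complex.Gamma ((l + m + 1) / 2)) • U m l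

/-! ### Complex powers of the Dirac operator -/

/-- `2^μ Γ((m+μ)/2) / π^((m-μ)/2) T*_{-m-μ}`. -/
def scalarPart (m : ℕ) (μ : ℂ) : Functional m :=
  ((2 : ℂ) ^ μ * Complex.Gamma ((m + μ) / 2) / (Real.pi : ℂ) ^ ((m - μ) / 2)) • Tstar m (-m - μ)

/-- `2^μ Γ((m+μ+1)/2) / π^((m-μ+1)/2) U*_{-m-μ}`. -/
def vectorPart (m : ℕ) (μ : ℂ) : Functional m :=
  ((2 : ℂ) ^ μ * Complex.Gamma ((m + μ + 1) / 2) / (Real.pi : ℂ) ^ ((m - μ + 1) / 2)) •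
    Ustar m (-m - μ)

open Classical in
/-- The convolution kernel `∂^μ δ` of the complex power `∂^μ` of the Dirac operator. For an integer
`μ` the coefficient `(1 ± e^{iπμ})/2` of one of the two parts vanishes and that part is absent. -/
def diracKernel (m : ℕ) (μ : ℂ) : Functional m :=
  if ∃ k : ℤ, μ = 2 * k then scalarPart m μ
  else if ∃ k : ℤ, μ = 2 * k + 1 then -vectorPart m μ
  else ((1 + Complex.exp (Complex.I * Real.pi * μ)) / 2) • scalarPart m μ
    - ((1 - Complex.exp (Complex.I * Real.pi * μ)) / 2) • vectorPart m μ

/-! ### Convolution -/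

/-- A sequence of test functions converging to `1`: eventually equal to `1` on every compact set,
with every derivative bounded uniformly in the sequence. -/
structure IsApproxUnit {m : ℕ} (η : ℕ → E m → ℝ) : Prop where
  smooth : ∀ k, ContDiff ℝ ∞ (η k)
  compact_support : ∀ k, HasCompactSupport (η k)
  eventually_one : ∀ K : Set (E m), IsCompact K → ∀ᶠ k in atTop, ∀ x ∈ K, η k x = 1
  bounded : ∀ n : ℕ, ∃ C : ℝ, ∀ k x, ‖iteratedFDeriv ℝ n (η k) x‖ ≤ C

/-- `R = S ∗ T` for scalar tempered distributions. For every Schwartz function `φ`, with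
`g(y) = ⟨S_x, φ(x + y)⟩`, the distribution `g T` is integrable and `⟨R, φ⟩ = ⟨g T, 1⟩`; that is,
`⟨T, η_k g⟩ → ⟨R, φ⟩` for every sequence of test functions `η_k` converging to `1`. The function
`ψ k` is `η_k g`. -/
def IsScalarConv {m : ℕ} (S T R : 𝓢'(E m, ℂ)) : Prop :=
  ∀ (φ : 𝓢(E m, ℂ)) (η : ℕ → E m → ℝ), IsApproxUnit η →
    ∃ ψ : ℕ → 𝓢(E m, ℂ),
      (∀ k y, ψ k y = (η k y : ℂ) * S (φ.compSubConstCLM ℂ (-y))) ∧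
      Tendsto (fun k => T (ψ k)) atTop (𝓝 (R φ))

/-- `R = S ∗ T` for Clifford-valued tempered distributions: if `S = ∑ sᵢ aᵢ` and `T = ∑ tⱼ bⱼ`
with scalar `sᵢ`, `tⱼ`, then `S ∗ T = ∑ (sᵢ ∗ tⱼ) aᵢ bⱼ`. -/
def IsConv {m : ℕ} (S T R : Functional m) : Prop :=
  ∃ (p q : ℕ) (s : Fin p → 𝓢'(E m, ℂ)) (a : Fin p → Cl m)
    (t : Fin q → 𝓢'(E m, ℂ)) (b : Fin q → Cl m) (r : Fin p → Fin q → 𝓢'(E m, ℂ)),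
    Represents s a S ∧ Represents t b T ∧ (∀ i j, IsScalarConv (s i) (t j) (r i j)) ∧
    ∀ φ, R φ = ∑ i, ∑ j, r i j φ • (a i * b j)

/-- The operator `∂^μ = ∂^μ δ ∗ [·]`, as the relation `∂^μ f = g`. -/
def DiracPow (m : ℕ) (μ : ℂ) (f g : Functional m) : Prop := IsConv (diracKernel m μ) f g

/-- `F` is a fundamental solution of the (possibly only partially defined) operator `P`, given as
the relation `P f = g`: `F` is a tempered distribution and `P F = δ`. -/
def IsFundamentalSolution {m : ℕ} (P : Functional m → Functional m → Prop) (F : Functional m) :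
    Prop := IsTempered F ∧ P F (delta m)

/-- `E_μ = ∂^{-μ} δ`. -/
def fundSol (m : ℕ) (μ : ℂ) : Functional m := diracKernel m (-μ)

end CliffordPowers

end

/-! Say that a homogeneous distribution `s` of degree `-m-μ` has symbol `σ` if `⟨s,φ⟩ = ∫ σ φ̂`
whenever `φ̂` vanishes on the unit ball. The kernel of `∂^μ` has a scalar part and vector components
of this kind, and together their symbols form `|2πξ|^μ ((1+q)/2 - iω(1-q)/2)`, where `q = e^{iπμ}`
and `ω = ξ/|ξ|`. Since `ω² = -1`, we have `(iω)² = 1`, so this equals `|2πξ|^μ ((1-iω)/2 +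
q(1+iω)/2)`, where the two halves are complementary idempotents. Replacing `μ` by `-μ` inverts it,
and the product of the two symbols is `1`, the symbol of `δ`.

Existence of the convolution is a matter of decay. If `s` is `O(|x|^a)` at infinity, so is `y ↦
⟨s_x, φ(x+y)⟩` (`exists_bound_smear`). The degrees `-m-μ` and `-m+μ` have real parts summing to `-2m
≤ -(m+1)`, so the truncated pairings converge to a limit independent of the truncation
(`tendsto_truncation`).

To identify the limit, note that it equals `∫ στ φ̂` when `φ̂` vanishes on the unit ball, because
then `s` and `t` act as Fourier multipliers (`convPairing_eq_of_fourier_eq_zero`). Both sides are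
continuous and invariant under dilations. The low-frequency part of `φ(·/ε)` is `O(ε^m)` in every
Schwartz seminorm, so the two sides agree for all `φ` (`convPairing_eq_multiplier`). Dilation
invariance thus rules out any additional term supported at frequency zero.

The symbols come from the classical Fourier transform of `|x|^(l-κ) h(x)` with `h = 1` or `h = x_j`.
It is found in a strip by taking the Mellin transform of the Gaussian identity
(`integral_homKernel_mul_eq`), then continued analytically to all exponents off the poles of the
finite part (`fpDist_eq_fourier`). At those poles the kernel is a derivative of `δ`, and its symbol
is computed directly. -/

open scoped FourierTransform

noncomputable section

namespace CliffordPowers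

variable {m : ℕ}

/-! ### Schwartz seminorms and the bounds they give -/

section Seminorms

variable {V : Type} [NormedAddCommGroup V] [NormedSpace ℝ V]

/-- The supremum of the Schwartz seminorms of order at most `(M, M)`. -/
def schwartzSup (M : ℕ) : Seminorm ℂ 𝓢(V, ℂ) :=
  (Finset.Iic (M, M)).sup (schwartzSeminormFamily ℂ V ℂ)

lemma schwartzSup_nonneg (M : ℕ) (φ : 𝓢(V, ℂ)) : 0 ≤ schwartzSup M φ := apply_nonneg _ _

lemma schwartzSup_mono {M N : ℕ} (h : M ≤ N) (φ : 𝓢(V, ℂ)) : schwartzSup M φ ≤ schwartzSup N φ := by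
  have : schwartzSup (V := V) M ≤ schwartzSup N :=
    Finset.sup_mono (Finset.Iic_subset_Iic.2 (Prod.mk_le_mk.2 ⟨h, h⟩))
  exact this φ

lemma pow_mul_norm_iteratedFDeriv_le_schwartzSup {M k n : ℕ} (hk : k ≤ M) (hn : n ≤ M)
    (φ : 𝓢(V, ℂ)) (x : V) :
    (1 + ‖x‖) ^ k * ‖iteratedFDeriv ℝ n φ x‖ ≤ 2 ^ M * schwartzSup M φ :=
  SchwartzMap.one_add_le_sup_seminorm_apply (𝕜 := ℂ) (m := (M, M)) hk hn φ x

lemma norm_iteratedFDeriv_le_schwartzSup {M n : ℕ} (hn : n ≤ M) (φ : 𝓢(V, ℂ)) (x : V) :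
    ‖iteratedFDeriv ℝ n φ x‖ ≤ 2 ^ M * schwartzSup M φ := by
  simpa using pow_mul_norm_iteratedFDeriv_le_schwartzSup (Nat.zero_le M) hn φ x

lemma pow_mul_norm_le_schwartzSup (M : ℕ) (φ : 𝓢(V, ℂ)) (x : V) :
    (1 + ‖x‖) ^ M * ‖φ x‖ ≤ 2 ^ M * schwartzSup M φ := by
  simpa using pow_mul_norm_iteratedFDeriv_le_schwartzSup le_rfl (Nat.zero_le M) φ x

lemma schwartzSup_le {M : ℕ} {φ : 𝓢(V, ℂ)} {B : ℝ} (hB : 0 ≤ B)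
    (h : ∀ k ≤ M, ∀ n ≤ M, ∀ x, ‖x‖ ^ k * ‖iteratedFDeriv ℝ n φ x‖ ≤ B) :
    schwartzSup M φ ≤ B := by
  refine Seminorm.finset_sup_apply_le hB fun i hi => ?_
  rw [Finset.mem_Iic, Prod.le_def] at hi
  exact SchwartzMap.seminorm_le_bound ℂ i.1 i.2 φ hB (h i.1 hi.1 i.2 hi.2)

/-- A continuous seminorm is controlled by finitely many Schwartz seminorms, and the index square of
side `M` contains any finite index set. All later estimates need only the single parameter `M`. -/
lemma exists_bound_of_continuous_seminorm (q : Seminorm ℂ 𝓢(V, ℂ)) (hq : Continuous q) :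
    ∃ (M : ℕ) (C : ℝ), 0 ≤ C ∧ ∀ φ, q φ ≤ C * schwartzSup M φ := by
  obtain ⟨s, C, -, hC⟩ := Seminorm.bound_of_continuous (schwartz_withSeminorms ℂ V ℂ) q hq
  obtain ⟨M, hM⟩ : ∃ M : ℕ, s ⊆ Finset.Iic (M, M) := by
    refine ⟨s.sup (fun p => max p.1 p.2), fun p hp => ?_⟩
    have := Finset.le_sup (f := fun p : ℕ × ℕ => max p.1 p.2) hp
    simp only [Finset.mem_Iic, Prod.le_def]
    exact ⟨(le_max_left _ _).trans this, (le_max_right _ _).trans this⟩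
  refine ⟨M, C, C.2, fun φ => (hC φ).trans ?_⟩
  have h1 : s.sup (schwartzSeminormFamily ℂ V ℂ) ≤ schwartzSup M := Finset.sup_mono hM
  exact mul_le_mul_of_nonneg_left (h1 φ) C.2

lemma exists_bound_distribution (s : 𝓢'(V, ℂ)) :
    ∃ (M : ℕ) (C : ℝ), 0 ≤ C ∧ ∀ φ, ‖s φ‖ ≤ C * schwartzSup M φ := by
  obtain ⟨M, C, h0, h⟩ := exists_bound_of_continuous_seminorm
    ((normSeminorm ℂ ℂ).comp (s : 𝓢(V, ℂ) →L[ℂ] ℂ).toLinearMap) (by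
      change Continuous fun φ => ‖s φ‖
      exact (map_continuous s).norm)
  exact ⟨M, C, h0, h⟩

lemma continuous_schwartzSup (M : ℕ) : Continuous (schwartzSup (V := V) M) := by
  have h := schwartz_withSeminorms ℂ V ℂ
  refine Seminorm.continuous_of_le
    (q := ∑ i ∈ Finset.Iic (M, M), schwartzSeminormFamily ℂ V ℂ i) ?_
    (Seminorm.finset_sup_le_sum _ _)
  have : (⇑(∑ i ∈ Finset.Iic (M, M), schwartzSeminormFamily ℂ V ℂ i) : 𝓢(V, ℂ) → ℝ) =
      fun φ => ∑ i ∈ Finset.Iic (M, M), schwartzSeminormFamily ℂ V ℂ i φ := by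
    ext φ
    simp
  rw [this]
  exact continuous_finsetSum _ fun i _ => h.continuous_seminorm i

lemma exists_bound_clm (A : 𝓢(V, ℂ) →L[ℂ] 𝓢(V, ℂ)) (M : ℕ) :
    ∃ (N : ℕ) (C : ℝ), 0 ≤ C ∧ ∀ φ, schwartzSup M (A φ) ≤ C * schwartzSup N φ :=
  exists_bound_of_continuous_seminorm ((schwartzSup M).comp A.toLinearMap)
    ((continuous_schwartzSup M).comp A.continuous)

/-- A linear functional bounded by a Schwartz seminorm, as a tempered distribution. -/
def distributionOfBound (A : 𝓢(V, ℂ) → ℂ) (hadd : ∀ φ ψ, A (φ + ψ) = A φ + A ψ)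
    (hsmul : ∀ (c : ℂ) φ, A (c • φ) = c * A φ)
    (hb : ∃ (M : ℕ) (C : ℝ), 0 ≤ C ∧ ∀ φ, ‖A φ‖ ≤ C * schwartzSup M φ) : 𝓢'(V, ℂ) :=
  ContinuousLinearMap.toPointwiseConvergenceCLM _ _ _ _
    (SchwartzMap.mkCLMtoNormedSpace (σ := RingHom.id ℂ) A hadd hsmul (by
      obtain ⟨M, C, h0, h⟩ := hb
      exact ⟨Finset.Iic (M, M), C, h0, h⟩))

end Seminorms

/-! ### Translations and their second-order Taylor remainder -/

section Smear

variable {V : Type} [NormedAddCommGroup V] [NormedSpace ℝ V]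

lemma iteratedFDeriv_translate (φ : 𝓢(V, ℂ)) (y x : V) (n : ℕ) :
    iteratedFDeriv ℝ n (φ.compSubConstCLM ℂ (-y)) x = iteratedFDeriv ℝ n φ (x + y) := by
  have : (⇑(φ.compSubConstCLM ℂ (-y)) : V → ℂ) = fun x => φ (x + y) := by
    ext x; simp
  rw [this, iteratedFDeriv_comp_add_right]

lemma norm_le_add_right_of {W : Type} [NormedAddCommGroup W] (x y : W) : 1 + ‖x‖ ≤ (1 + ‖x + y‖) * (1 + ‖y‖) := by
  have : ‖x‖ ≤ ‖x + y‖ + ‖y‖ := by simpa using norm_sub_le (x + y) y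
  nlinarith [norm_nonneg (x + y), norm_nonneg y, mul_nonneg (norm_nonneg (x + y)) (norm_nonneg y)]

lemma schwartzSup_translate_le (M : ℕ) (φ : 𝓢(V, ℂ)) (y : V) :
    schwartzSup M (φ.compSubConstCLM ℂ (-y)) ≤ 2 ^ M * (1 + ‖y‖) ^ M * schwartzSup M φ := by
  have h0 := schwartzSup_nonneg M φ
  refine schwartzSup_le (by positivity) fun k hk n hn x => ?_
  rw [iteratedFDeriv_translate]
  have h1 := pow_mul_norm_iteratedFDeriv_le_schwartzSup hk hn φ (x + y)
  calc ‖x‖ ^ k * ‖iteratedFDeriv ℝ n φ (x + y)‖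
      ≤ ((1 + ‖x + y‖) * (1 + ‖y‖)) ^ k * ‖iteratedFDeriv ℝ n φ (x + y)‖ := by
        gcongr
        linarith [norm_le_add_right_of x y]
    _ = (1 + ‖y‖) ^ k * ((1 + ‖x + y‖) ^ k * ‖iteratedFDeriv ℝ n φ (x + y)‖) := by
        rw [mul_pow]; ring
    _ ≤ (1 + ‖y‖) ^ M * (2 ^ M * schwartzSup M φ) := by
        gcongr
        linarith [norm_nonneg y]
    _ = _ := by ring

/-- The second order Taylor remainder of a translation, as a function. -/
def taylorRem {G : Type} [NormedAddCommGroup G] [NormedSpace ℝ G] (f : V → G) (v x : V) : G :=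
  f (x + v) - f x - fderiv ℝ f x v

/-- The mean value inequality is used twice on the segment: for `fderiv ℝ f`, then for `f` minus its
linear part. The sharp factor `1/2` is not needed. -/
lemma norm_taylorRem_le {G : Type} [NormedAddCommGroup G] [NormedSpace ℝ G] {f : V → G}
    (hf : ContDiff ℝ 2 f) {v x : V} {B : ℝ}
    (hB : ∀ t ∈ Set.Icc (0 : ℝ) 1, ‖iteratedFDeriv ℝ 2 f (x + t • v)‖ ≤ B) :
    ‖taylorRem f v x‖ ≤ B * ‖v‖ ^ 2 := by
  have hB0 : 0 ≤ B := (norm_nonneg _).trans (hB 0 (by simp))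
  have hseg : ∀ z ∈ segment ℝ x (x + v), ∃ t ∈ Set.Icc (0 : ℝ) 1, z = x + t • v := by
    intro z hz
    rw [segment_eq_image'] at hz
    obtain ⟨t, ht, rfl⟩ := hz
    exact ⟨t, ht, by simp⟩
  have hd : Differentiable ℝ (fderiv ℝ f) :=
    (hf.fderiv_right (m := 1) (by norm_num)).differentiable (by norm_num)
  have h2 : ∀ z, ‖fderiv ℝ (fderiv ℝ f) z‖ = ‖iteratedFDeriv ℝ 2 f z‖ := by
    intro z
    rw [← norm_iteratedFDeriv_fderiv (n := 1), ← norm_iteratedFDeriv_fderiv (n := 0)]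
    simp
  have h1 : ∀ z ∈ segment ℝ x (x + v), ‖fderiv ℝ f z - fderiv ℝ f x‖ ≤ B * ‖v‖ := by
    intro z hz
    have hsub : segment ℝ x z ⊆ segment ℝ x (x + v) :=
      (convex_segment x (x + v)).segment_subset (left_mem_segment _ _ _) hz
    have := (convex_segment x z).norm_image_sub_le_of_norm_fderiv_le (𝕜 := ℝ) (f := fderiv ℝ f)
      (C := B) (fun w _ => hd w) (fun w hw => by
        obtain ⟨t, ht, rfl⟩ := hseg w (hsub hw)
        rw [h2]; exact hB t ht) (left_mem_segment ℝ x z) (right_mem_segment ℝ x z)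
    refine this.trans ?_
    obtain ⟨t, ht, rfl⟩ := hseg z hz
    gcongr
    rw [add_sub_cancel_left, norm_smul, Real.norm_of_nonneg ht.1]
    exact mul_le_of_le_one_left (norm_nonneg _) ht.2
  have h3 := (convex_segment x (x + v)).norm_image_sub_le_of_norm_fderiv_le' (𝕜 := ℝ) (f := f)
    (φ := fderiv ℝ f x) (C := B * ‖v‖)
    (fun w _ => (hf.differentiable (by norm_num)) w) h1
    (left_mem_segment ℝ x _) (right_mem_segment ℝ x _)
  rw [add_sub_cancel_left] at h3
  rw [taylorRem]
  linarith [h3, sq (‖v‖)]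

/-- Differentiating the linear term puts the increment `v` in the other slot of the second
derivative, and symmetry of that derivative moves it back. Higher derivatives of the remainder then
follow by induction, with the target space varying. -/
lemma fderiv_taylorRem {G : Type} [NormedAddCommGroup G] [NormedSpace ℝ G] {f : V → G}
    (hf : ContDiff ℝ ∞ f) (v : V) : fderiv ℝ (taylorRem f v) = taylorRem (fderiv ℝ f) v := by
  have hd : Differentiable ℝ f := hf.differentiable (by simp)
  have hf' : ContDiff ℝ ∞ (fderiv ℝ f) := hf.fderiv_right (by simp)
  have hd' : Differentiable ℝ (fderiv ℝ f) := hf'.differentiable (by simp)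
  ext x w
  have hsymm : fderiv ℝ (fderiv ℝ f) x w v = fderiv ℝ (fderiv ℝ f) x v w :=
    ((contDiff_infty.1 hf 2).contDiffAt.isSymmSndFDerivAt (by simp)).eq w v
  have e1 : HasFDerivAt (fun z => f (z + v)) (fderiv ℝ f (x + v)) x :=
    (hasFDerivAt_comp_add_right v).2 (hd (x + v)).hasFDerivAt
  have e2 : HasFDerivAt (fun z => fderiv ℝ f z v) ((fderiv ℝ (fderiv ℝ f) x).flip v) x := by
    simpa using (hd' x).hasFDerivAt.clm_apply (hasFDerivAt_const v x)
  have := ((e1.sub (hd x).hasFDerivAt).sub e2).fderiv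
  have e3 : fderiv ℝ (taylorRem f v) x = _ := this
  rw [e3]
  simp [taylorRem, hsymm]

lemma norm_iteratedFDeriv_taylorRem_le {G : Type} [NormedAddCommGroup G] [NormedSpace ℝ G]
    {f : V → G} (hf : ContDiff ℝ ∞ f) (n : ℕ) {v x : V} {B : ℝ}
    (hB : ∀ t ∈ Set.Icc (0 : ℝ) 1, ‖iteratedFDeriv ℝ (n + 2) f (x + t • v)‖ ≤ B) :
    ‖iteratedFDeriv ℝ n (taylorRem f v) x‖ ≤ B * ‖v‖ ^ 2 := by
  induction n generalizing G with
  | zero =>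
    rw [norm_iteratedFDeriv_zero]
    exact norm_taylorRem_le (contDiff_infty.1 hf 2) hB
  | succ n ih =>
    rw [← norm_iteratedFDeriv_fderiv, fderiv_taylorRem hf]
    refine ih (hf.fderiv_right (by simp)) fun t ht => ?_
    rw [norm_iteratedFDeriv_fderiv]
    exact hB t ht

end Smear

/-! ### Smoothness and growth of the smeared function -/

/-- The function `y ↦ ⟨S_x, φ(x + y)⟩`. -/
def smear (s : 𝓢'(E m, ℂ)) (φ : 𝓢(E m, ℂ)) (y : E m) : ℂ := s (φ.compSubConstCLM ℂ (-y))

/-- The `j`-th standard basis vector. -/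
abbrev basisVec (j : Fin m) : E m := EuclideanSpace.single j (1 : ℝ)

lemma lineDeriv_eq_sum (φ : 𝓢(E m, ℂ)) (v : E m) :
    ∂_{v} φ = ∑ j, (v j : ℂ) • ∂_{basisVec j} φ := by
  ext x
  have hv : v = ∑ j, v j • basisVec j := by
    ext i
    simp [Pi.single_apply]
  simp only [SchwartzMap.lineDerivOp_apply_eq_fderiv, sum_apply, smul_apply]
  conv_lhs => rw [hv]
  simp

/-- This is differentiability of translation in the Schwartz topology. For `‖v‖ ≤ 1` the weight `1 +
‖x‖` is at most twice its value at any point of the segment, so decay at the intermediate points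
controls the remainder. -/
lemma schwartzSup_taylor_le (M : ℕ) (φ : 𝓢(E m, ℂ)) {v : E m} (hv : ‖v‖ ≤ 1) :
    schwartzSup M (φ.compSubConstCLM ℂ (-v) - φ - ∂_{v} φ) ≤
      (2 ^ M * (2 ^ (M + 2) * schwartzSup (M + 2) φ)) * ‖v‖ ^ 2 := by
  have h0 := schwartzSup_nonneg (M + 2) φ
  have hfun : (⇑(φ.compSubConstCLM ℂ (-v) - φ - ∂_{v} φ) : E m → ℂ) = taylorRem φ v := by
    ext x
    simp [taylorRem, SchwartzMap.lineDerivOp_apply_eq_fderiv]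
  refine schwartzSup_le (by positivity) fun k hk n hn x => ?_
  rw [hfun]
  have hpos : 0 < (1 + ‖x‖) ^ k := by positivity
  have hB : ∀ t ∈ Set.Icc (0 : ℝ) 1, ‖iteratedFDeriv ℝ (n + 2) φ (x + t • v)‖ ≤
      (2 ^ M * (2 ^ (M + 2) * schwartzSup (M + 2) φ)) / (1 + ‖x‖) ^ k := by
    intro t ht
    rw [le_div_iff₀ hpos]
    have h1 := pow_mul_norm_iteratedFDeriv_le_schwartzSup (M := M + 2) (k := k) (n := n + 2)
      (by omega) (by omega) φ (x + t • v)
    have h2 : 1 + ‖x‖ ≤ (1 + ‖x + t • v‖) * 2 := by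
      refine (norm_le_add_right_of x (t • v)).trans ?_
      gcongr
      rw [norm_smul, Real.norm_of_nonneg ht.1]
      nlinarith [ht.1, ht.2, norm_nonneg v]
    calc ‖iteratedFDeriv ℝ (n + 2) φ (x + t • v)‖ * (1 + ‖x‖) ^ k
        ≤ ‖iteratedFDeriv ℝ (n + 2) φ (x + t • v)‖ * ((1 + ‖x + t • v‖) * 2) ^ k := by gcongr
      _ = 2 ^ k * ((1 + ‖x + t • v‖) ^ k * ‖iteratedFDeriv ℝ (n + 2) φ (x + t • v)‖) := by
          rw [mul_pow]; ring
      _ ≤ 2 ^ M * (2 ^ (M + 2) * schwartzSup (M + 2) φ) := by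
          gcongr
          norm_num
  have h3 := norm_iteratedFDeriv_taylorRem_le (φ.smooth ⊤) n hB
  calc ‖x‖ ^ k * ‖iteratedFDeriv ℝ n (taylorRem φ v) x‖
      ≤ (1 + ‖x‖) ^ k *
        ((2 ^ M * (2 ^ (M + 2) * schwartzSup (M + 2) φ)) / (1 + ‖x‖) ^ k * ‖v‖ ^ 2) := by
        gcongr
        linarith
    _ = _ := by field_simp

lemma translate_lineDeriv (φ : 𝓢(E m, ℂ)) (v y : E m) :
    ∂_{v} (φ.compSubConstCLM ℂ (-y)) = (∂_{v} φ).compSubConstCLM ℂ (-y) := by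
  ext x
  have : (⇑(φ.compSubConstCLM ℂ (-y)) : E m → ℂ) = fun x => φ (x + y) := by
    ext x; simp
  simp only [SchwartzMap.lineDerivOp_apply_eq_fderiv, SchwartzMap.compSubConstCLM_apply]
  rw [this, fderiv_comp_add_right]
  simp

/-- The map sending `c` to the real linear form `v ↦ v_j c`. -/
def coordSmul (j : Fin m) : ℂ →L[ℝ] (E m →L[ℝ] ℂ) :=
  ContinuousLinearMap.smulRightL ℝ (E m) ℂ (EuclideanSpace.proj j)

@[simp] lemma coordSmul_apply (j : Fin m) (c : ℂ) (v : E m) : coordSmul j c v = v j • c := rfl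

/-- Continuity of `s` carries the quadratic remainder estimate for translations over to the smeared
function. The derivative is again built from smeared functions, of the `∂_j φ`, which drives the
inductions below. -/
lemma hasFDerivAt_smear (s : 𝓢'(E m, ℂ)) (φ : 𝓢(E m, ℂ)) (y : E m) :
    HasFDerivAt (smear s φ) (∑ j, coordSmul j (smear s (∂_{basisVec j} φ) y)) y := by
  obtain ⟨M, C, hC, hs⟩ := exists_bound_distribution s
  rw [hasFDerivAt_iff_isLittleO_nhds_zero]
  set ψ := φ.compSubConstCLM ℂ (-y) with hψ
  have key : ∀ v : E m, smear s φ (y + v) - smear s φ y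
      - (∑ j, coordSmul j (smear s (∂_{basisVec j} φ) y)) v
      = s (ψ.compSubConstCLM ℂ (-v) - ψ - ∂_{v} ψ) := by
    intro v
    rw [map_sub, map_sub, hψ, SchwartzMap.compSubConstCLM_comp, ← neg_add, translate_lineDeriv,
      lineDeriv_eq_sum φ v]
    simp only [smear, map_sum, map_smul]
    simp
  simp_rw [key]
  refine Asymptotics.IsBigO.trans_isLittleO (g := fun v : E m => ‖v‖ ^ 2) ?_
    (Asymptotics.isLittleO_norm_pow_id (by norm_num))
  refine Asymptotics.IsBigO.of_bound (C * (2 ^ M * (2 ^ (M + 2) * schwartzSup (M + 2) ψ))) ?_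
  filter_upwards [Metric.closedBall_mem_nhds (0 : E m) one_pos] with v hv
  rw [mem_closedBall_zero_iff] at hv
  refine (hs _).trans ?_
  rw [norm_pow, norm_norm, mul_assoc C]
  exact mul_le_mul_of_nonneg_left (schwartzSup_taylor_le M ψ hv) hC

lemma fderiv_smear (s : 𝓢'(E m, ℂ)) (φ : 𝓢(E m, ℂ)) :
    fderiv ℝ (smear s φ) = fun y => ∑ j, coordSmul j (smear s (∂_{basisVec j} φ) y) :=
  funext fun y => (hasFDerivAt_smear s φ y).fderiv

lemma contDiff_smear (s : 𝓢'(E m, ℂ)) (φ : 𝓢(E m, ℂ)) : ContDiff ℝ ∞ (smear s φ) := by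
  rw [contDiff_infty]
  intro n
  induction n generalizing φ with
  | zero =>
    have hd : Differentiable ℝ (smear s φ) := fun y => (hasFDerivAt_smear s φ y).differentiableAt
    exact contDiff_zero.2 hd.continuous
  | succ n ih =>
    rw [Nat.cast_succ, contDiff_succ_iff_fderiv]
    refine ⟨fun y => (hasFDerivAt_smear s φ y).differentiableAt, by simp, ?_⟩
    rw [fderiv_smear]
    exact ContDiff.sum fun j _ => (coordSmul j).contDiff.comp (ih _)

/-- The polynomial growth is crude. It is used only on a bounded ball, where what matters is that
the bound is linear in a seminorm of `φ`. -/
lemma exists_bound_iteratedFDeriv_smear (s : 𝓢'(E m, ℂ)) (n : ℕ) :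
    ∃ (M : ℕ) (C : ℝ), 0 ≤ C ∧ ∀ φ y,
      ‖iteratedFDeriv ℝ n (smear s φ) y‖ ≤ C * (1 + ‖y‖) ^ M * schwartzSup M φ := by
  induction n with
  | zero =>
    obtain ⟨M, C, hC, hs⟩ := exists_bound_distribution s
    refine ⟨M, C * 2 ^ M, by positivity, fun φ y => ?_⟩
    rw [norm_iteratedFDeriv_zero]
    refine (hs _).trans ?_
    calc _ ≤ C * (2 ^ M * (1 + ‖y‖) ^ M * schwartzSup M φ) := by
          gcongr; exact schwartzSup_translate_le M φ y
      _ = _ := by ring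
  | succ n ih =>
    obtain ⟨M, C, hC, h⟩ := ih
    choose N D hD hN using fun j : Fin m =>
      exists_bound_clm (LineDeriv.lineDerivOpCLM ℂ 𝓢(E m, ℂ) (basisVec j)) M
    set R := max M (Finset.univ.sup N)
    refine ⟨R, ∑ j, ‖coordSmul (m := m) j‖ * (C * D j),
      Finset.sum_nonneg fun j _ => by have := hD j; positivity, fun φ y => ?_⟩
    rw [← norm_iteratedFDeriv_fderiv, fderiv_smear]
    have hc : ∀ j : Fin m, ContDiff ℝ ∞ fun y : E m => coordSmul j (smear s (∂_{basisVec j} φ) y) :=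
      fun j => (coordSmul j).contDiff.comp (contDiff_smear s _)
    rw [iteratedFDeriv_fun_sum_apply fun j _ => (contDiff_infty.1 (hc j) n).contDiffAt]
    rw [Finset.sum_mul, Finset.sum_mul]
    refine (norm_sum_le _ _).trans (Finset.sum_le_sum fun j _ => ?_)
    refine ((coordSmul j).norm_iteratedFDeriv_comp_left
      (contDiff_infty.1 (contDiff_smear s (∂_{basisVec j} φ)) n).contDiffAt le_rfl).trans ?_
    have h1 : schwartzSup M (∂_{basisVec j} φ) ≤ D j * schwartzSup R φ :=
      (hN j φ).trans (mul_le_mul_of_nonneg_left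
        (schwartzSup_mono ((Finset.le_sup (Finset.mem_univ j)).trans (le_max_right _ _)) φ) (hD j))
    have h2 : (1 + ‖y‖) ^ M ≤ (1 + ‖y‖) ^ R :=
      pow_le_pow_right₀ (by linarith [norm_nonneg y]) (le_max_left _ _)
    have h3 := schwartzSup_nonneg M (∂_{basisVec j} φ)
    calc ‖coordSmul j‖ * ‖iteratedFDeriv ℝ n (smear s (∂_{basisVec j} φ)) y‖
        ≤ ‖coordSmul j‖ * (C * (1 + ‖y‖) ^ M * schwartzSup M (∂_{basisVec j} φ)) := by
          gcongr; exact h _ _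
      _ ≤ ‖coordSmul j‖ * (C * (1 + ‖y‖) ^ R * (D j * schwartzSup R φ)) := by gcongr
      _ = _ := by ring

/-! ### Cutoff at the origin and behaviour at infinity -/

/-- A smooth bump function equal to `1` on the unit ball and supported in the ball of radius `2`. -/
def bump (m : ℕ) : ContDiffBump (0 : E m) := ⟨1, 2, one_pos, one_lt_two⟩

/-- The complex-valued version of `bump`. -/
def cutoff (x : E m) : ℂ := (bump m x : ℂ)

lemma contDiff_cutoff : ContDiff ℝ ∞ (cutoff (m := m)) :=
  Complex.ofRealCLM.contDiff.comp (bump m).contDiff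

lemma cutoff_eq_one {x : E m} (h : ‖x‖ ≤ 1) : cutoff x = 1 := by
  have : bump m x = 1 := (bump m).one_of_mem_closedBall (by simpa [bump] using h)
  simp [cutoff, this]

lemma cutoff_eq_zero {x : E m} (h : 2 ≤ ‖x‖) : cutoff x = 0 := by
  have : bump m x = 0 := (bump m).zero_of_le_dist (by simpa [bump] using h)
  simp [cutoff, this]

lemma norm_one_sub_cutoff_le (x : E m) : ‖1 - cutoff x‖ ≤ 1 := by
  have : (1 - cutoff x) = ((1 - bump m x : ℝ) : ℂ) := by simp [cutoff]
  rw [this, Complex.norm_real, Real.norm_of_nonneg (by linarith [(bump m).le_one (x := x)])]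
  linarith [(bump m).nonneg (x := x)]

lemma hasCompactSupport_cutoff : HasCompactSupport (cutoff (m := m)) :=
  (bump m).hasCompactSupport.comp_left (g := fun r : ℝ => (r : ℂ)) (by simp)

lemma hasTemperateGrowth_cutoff : (cutoff (m := m)).HasTemperateGrowth :=
  hasCompactSupport_cutoff.hasTemperateGrowth contDiff_cutoff

lemma hasTemperateGrowth_one_sub_cutoff :
    (fun x : E m => 1 - cutoff x).HasTemperateGrowth :=
  (Function.HasTemperateGrowth.const (1 : ℂ)).sub hasTemperateGrowth_cutoff

lemma exists_bound_iteratedFDeriv_cutoff (n : ℕ) :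
    ∃ C : ℝ, 0 ≤ C ∧ ∀ x : E m, ‖iteratedFDeriv ℝ n cutoff x‖ ≤ C := by
  obtain ⟨C, hC⟩ := (contDiff_cutoff (m := m)).continuous_iteratedFDeriv (m := n)
    (by exact_mod_cast le_top) |>.bounded_above_of_compact_support
    (hasCompactSupport_cutoff.iteratedFDeriv n)
  exact ⟨C, (norm_nonneg _).trans (hC 0), hC⟩

lemma iteratedFDeriv_cutoff_mul_eq_zero (f : E m → ℂ) (n : ℕ) {x : E m} (hx : 2 < ‖x‖) :
    iteratedFDeriv ℝ n (fun z => cutoff z * f z) x = 0 := by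
  have : (fun z => cutoff z * f z) =ᶠ[𝓝 x] fun _ => 0 := by
    filter_upwards [continuous_norm.continuousAt.eventually (lt_mem_nhds hx)] with z hz
    simp [cutoff_eq_zero hz.le]
  rw [(this.iteratedFDeriv ℝ n).eq_of_nhds]
  simp

/-- The Schwartz function `χ f` for a smooth function `f`. -/
def cutoffMul (f : E m → ℂ) (hf : ContDiff ℝ ∞ f) : 𝓢(E m, ℂ) :=
  (hasCompactSupport_cutoff.mul_right (f' := f)).toSchwartzMap (contDiff_cutoff.mul hf)

@[simp] lemma cutoffMul_apply (f : E m → ℂ) (hf : ContDiff ℝ ∞ f) (x : E m) :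
    cutoffMul f hf x = cutoff x * f x := rfl

/-- By the Leibniz rule, and because the cutoff vanishes beyond radius `2`, only derivatives of `f`
on that ball matter. The constant does not depend on `f`. -/
lemma exists_schwartzSup_cutoffMul_le (m M : ℕ) : ∃ C : ℝ, 0 ≤ C ∧
    ∀ (f : E m → ℂ) (hf : ContDiff ℝ ∞ f) (B : ℝ), 0 ≤ B →
      (∀ n ≤ M, ∀ x, ‖x‖ ≤ 2 → ‖iteratedFDeriv ℝ n f x‖ ≤ B) →
      schwartzSup M (cutoffMul f hf) ≤ C * B := by
  choose C hC0 hC using exists_bound_iteratedFDeriv_cutoff (m := m)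
  refine ⟨2 ^ M * ∑ n ∈ Finset.range (M + 1), ∑ i ∈ Finset.range (n + 1), (n.choose i : ℝ) * C i,
    mul_nonneg (by positivity) (Finset.sum_nonneg fun n _ => Finset.sum_nonneg fun i _ =>
      mul_nonneg (Nat.cast_nonneg _) (hC0 i)), fun f hf B hB h => ?_⟩
  set D := ∑ n ∈ Finset.range (M + 1), ∑ i ∈ Finset.range (n + 1), (n.choose i : ℝ) * C i
  have hD : 0 ≤ D := Finset.sum_nonneg fun n _ => Finset.sum_nonneg fun i _ =>
    mul_nonneg (Nat.cast_nonneg _) (hC0 i)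
  refine schwartzSup_le (by positivity) fun k hk n hn x => ?_
  have hfun : (⇑(cutoffMul f hf) : E m → ℂ) = fun z => cutoff z * f z := rfl
  rw [hfun]
  by_cases hx : 2 < ‖x‖
  · rw [iteratedFDeriv_cutoff_mul_eq_zero f n hx]
    simp only [norm_zero, mul_zero]
    positivity
  rw [not_lt] at hx
  have h1 := norm_iteratedFDeriv_mul_le (contDiff_cutoff (m := m)) hf x (n := n)
    (by exact_mod_cast le_top)
  have h2 : ‖iteratedFDeriv ℝ n (fun z => cutoff z * f z) x‖ ≤ D * B := by
    refine h1.trans ?_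
    calc _ ≤ ∑ i ∈ Finset.range (n + 1), (n.choose i : ℝ) * C i * B := by
          refine Finset.sum_le_sum fun i _ => ?_
          gcongr
          · exact mul_nonneg (Nat.cast_nonneg _) (hC0 i)
          · exact hC i x
          · exact h _ (by omega) x hx
      _ = (∑ i ∈ Finset.range (n + 1), (n.choose i : ℝ) * C i) * B := by rw [Finset.sum_mul]
      _ ≤ D * B := by
          gcongr
          exact Finset.single_le_sum
            (f := fun n => ∑ i ∈ Finset.range (n + 1), (n.choose i : ℝ) * C i)
            (fun n _ => Finset.sum_nonneg fun i _ => mul_nonneg (Nat.cast_nonneg _) (hC0 i))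
            (Finset.mem_range.2 (by omega))
  calc ‖x‖ ^ k * ‖iteratedFDeriv ℝ n (fun z => cutoff z * f z) x‖ ≤ 2 ^ M * (D * B) := by
        refine mul_le_mul ?_ h2 (norm_nonneg _) (by positivity)
        exact (pow_le_pow_left₀ (norm_nonneg _) hx k).trans (pow_le_pow_right₀ (by norm_num) hk)
    _ = _ := by ring

/-- `K` represents the tempered distribution `s` away from the unit ball, with growth of order `a`
at infinity. -/
structure IsFarKernel (s : 𝓢'(E m, ℂ)) (a : ℝ) (K : E m → ℂ) : Prop where
  measurable : Measurable K
  bound : ∃ C : ℝ, 0 ≤ C ∧ ∀ x, ‖K x‖ ≤ C * (1 + ‖x‖) ^ a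
  eq_integral : ∀ φ : 𝓢(E m, ℂ), (∀ x, ‖x‖ ≤ 1 → φ x = 0) → s φ = ∫ x, K x * φ x

/-- Peetre's inequality. For negative `a` it is the case of `-a` with `x` and `y` exchanged. -/
lemma one_add_norm_rpow_le (x y : E m) (a : ℝ) :
    (1 + ‖x‖) ^ a ≤ (1 + ‖y‖) ^ a * (1 + ‖x + y‖) ^ |a| := by
  have hx : 0 < 1 + ‖x‖ := by positivity
  have hy : 0 < 1 + ‖y‖ := by positivity
  have hxy : 0 < 1 + ‖x + y‖ := by positivity
  rcases le_total 0 a with ha | ha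
  · rw [abs_of_nonneg ha, ← Real.mul_rpow hy.le hxy.le]
    exact Real.rpow_le_rpow hx.le (by linarith [norm_le_add_right_of x y]) ha
  · have h1 : 1 + ‖y‖ ≤ (1 + ‖x + y‖) * (1 + ‖x‖) := by
      have := norm_le_add_right_of y x
      rwa [add_comm y x] at this
    have h2 := Real.rpow_le_rpow hy.le h1 (neg_nonneg.2 ha)
    rw [Real.mul_rpow hxy.le hx.le, Real.rpow_neg hx.le, Real.rpow_neg hy.le] at h2
    rw [abs_of_nonpos ha]
    have h3 : 0 < (1 + ‖x‖) ^ a := by positivity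
    have h4 : 0 < (1 + ‖y‖) ^ a := by positivity
    field_simp at h2
    linarith

lemma integrable_one_add_norm_neg_pow (m : ℕ) :
    Integrable (fun x : E m => (1 + ‖x‖) ^ (-((m + 1 : ℕ) : ℝ))) :=
  integrable_one_add_norm (by simp)

/-- `(1 + ‖x‖)^b |φ(x)|` is dominated by a Schwartz seminorm times an integrable function. -/
lemma rpow_mul_norm_le (m : ℕ) {b : ℝ} {N : ℕ} (hN : b + (m + 1 : ℕ) ≤ N) (φ : 𝓢(E m, ℂ)) (x : E m) :
    (1 + ‖x‖) ^ b * ‖φ x‖ ≤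
      2 ^ N * schwartzSup N φ * (1 + ‖x‖) ^ (-((m + 1 : ℕ) : ℝ)) := by
  have h1 := pow_mul_norm_le_schwartzSup N φ x
  have hx : 0 < 1 + ‖x‖ := by positivity
  have h2 : (1 + ‖x‖) ^ b ≤ (1 + ‖x‖) ^ N * (1 + ‖x‖) ^ (-((m + 1 : ℕ) : ℝ)) := by
    rw [← Real.rpow_natCast _ N, ← Real.rpow_add hx]
    exact Real.rpow_le_rpow_of_exponent_le (by linarith [norm_nonneg x]) (by linarith)
  calc (1 + ‖x‖) ^ b * ‖φ x‖
      ≤ ((1 + ‖x‖) ^ N * (1 + ‖x‖) ^ (-((m + 1 : ℕ) : ℝ))) * ‖φ x‖ := by gcongr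
    _ = ((1 + ‖x‖) ^ N * ‖φ x‖) * (1 + ‖x‖) ^ (-((m + 1 : ℕ) : ℝ)) := by ring
    _ ≤ _ := by gcongr

/-- Splitting of a Schwartz function by the cutoff. -/
lemma distribution_split (s : 𝓢'(E m, ℂ)) {a : ℝ} {K : E m → ℂ} (hK : IsFarKernel s a K)
    (φ : 𝓢(E m, ℂ)) :
    s φ = s (cutoffMul φ (φ.smooth ⊤)) + ∫ x, K x * ((1 - cutoff x) * φ x) := by
  have h := hK.eq_integral (SchwartzMap.smulLeftCLM ℂ (fun x => 1 - cutoff x) φ) (fun x hx => by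
    rw [SchwartzMap.smulLeftCLM_apply_apply hasTemperateGrowth_one_sub_cutoff, cutoff_eq_one hx]
    simp)
  simp only [SchwartzMap.smulLeftCLM_apply_apply hasTemperateGrowth_one_sub_cutoff,
    smul_eq_mul] at h
  rw [← h, ← map_add]
  congr 1
  ext x
  simp [SchwartzMap.smulLeftCLM_apply_apply hasTemperateGrowth_one_sub_cutoff]
  ring

/-- Smearing keeps the order of growth or decay at infinity. On the near part `x` stays within
radius `2`, so `φ(x+y)` is small for large `y`, faster than any power. On the far part Peetre's
inequality extracts `(1+‖y‖)^a` and leaves an integrable function of `x+y`. -/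
lemma exists_bound_smear (s : 𝓢'(E m, ℂ)) {a : ℝ} {K : E m → ℂ} (hK : IsFarKernel s a K) :
    ∃ (N : ℕ) (C : ℝ), 0 ≤ C ∧ ∀ φ y, ‖smear s φ y‖ ≤ C * (1 + ‖y‖) ^ a * schwartzSup N φ := by
  obtain ⟨M, C₁, hC₁, hs⟩ := exists_bound_distribution s
  obtain ⟨C₂, hC₂, hcut⟩ := exists_schwartzSup_cutoffMul_le m M
  obtain ⟨C₃, hC₃, hKb⟩ := hK.bound
  -- The power `|a|` pays for Peetre's inequality and `m + 1` for integrability. The same choice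
  -- ensures `-a ≤ N` for the near part.
  obtain ⟨R, hR⟩ := exists_nat_ge (|a| + (m + 1 : ℕ))
  set N := max M R
  set I := ∫ x : E m, (1 + ‖x‖) ^ (-((m + 1 : ℕ) : ℝ)) with hI
  have hI0 : 0 ≤ I := integral_nonneg fun x => by positivity
  refine ⟨N, C₁ * C₂ * (3 ^ N * 2 ^ N) + C₃ * 2 ^ N * I, by positivity, fun φ y => ?_⟩
  have hP := schwartzSup_nonneg N φ
  have hy : 0 < 1 + ‖y‖ := by positivity
  set ψ := φ.compSubConstCLM ℂ (-y) with hψ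
  have hψx : ∀ x, ψ x = φ (x + y) := fun x => by simp [hψ]
  have hRN : (R : ℝ) ≤ N := by exact_mod_cast le_max_right _ _
  have h1 : ‖s (cutoffMul ψ (ψ.smooth ⊤))‖ ≤
      C₁ * C₂ * (3 ^ N * 2 ^ N) * (1 + ‖y‖) ^ a * schwartzSup N φ := by
    have hb : ∀ n ≤ M, ∀ x, ‖x‖ ≤ 2 → ‖iteratedFDeriv ℝ n ψ x‖ ≤
        3 ^ N * 2 ^ N * (1 + ‖y‖) ^ a * schwartzSup N φ := by
      intro n hn x hx
      rw [iteratedFDeriv_translate]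
      have e1 := pow_mul_norm_iteratedFDeriv_le_schwartzSup (M := N) (k := N) (n := n) le_rfl
        (hn.trans (le_max_left _ _)) φ (x + y)
      have e2 : 1 + ‖y‖ ≤ 3 * (1 + ‖x + y‖) := by
        have : ‖y‖ ≤ ‖x + y‖ + ‖x‖ := by simpa using norm_sub_le (x + y) x
        linarith [norm_nonneg (x + y)]
      have e3 : (1 + ‖y‖) ^ (-a) ≤ (1 + ‖y‖) ^ N := by
        rw [← Real.rpow_natCast]
        refine Real.rpow_le_rpow_of_exponent_le (by linarith [norm_nonneg y]) ?_
        have : (0 : ℝ) ≤ (m + 1 : ℕ) := Nat.cast_nonneg _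
        linarith [neg_le_abs a]
      have e4 : (1 + ‖y‖) ^ (-a) * ‖iteratedFDeriv ℝ n φ (x + y)‖ ≤
          3 ^ N * (2 ^ N * schwartzSup N φ) := by
        calc _ ≤ (3 * (1 + ‖x + y‖)) ^ N * ‖iteratedFDeriv ℝ n φ (x + y)‖ := by
              gcongr
              exact e3.trans (pow_le_pow_left₀ hy.le e2 N)
          _ = 3 ^ N * ((1 + ‖x + y‖) ^ N * ‖iteratedFDeriv ℝ n φ (x + y)‖) := by
              rw [mul_pow]; ring
          _ ≤ _ := by gcongr
      rw [Real.rpow_neg hy.le] at e4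
      have hpos : 0 < (1 + ‖y‖) ^ a := by positivity
      rw [inv_mul_le_iff₀ hpos] at e4
      linarith
    refine (hs _).trans ?_
    calc C₁ * schwartzSup M (cutoffMul ψ (ψ.smooth ⊤))
        ≤ C₁ * (C₂ * (3 ^ N * 2 ^ N * (1 + ‖y‖) ^ a * schwartzSup N φ)) := by
          gcongr
          exact hcut _ _ _ (by positivity) hb
      _ = _ := by ring
  have h2 : ‖∫ x, K x * ((1 - cutoff x) * ψ x)‖ ≤
      C₃ * 2 ^ N * I * (1 + ‖y‖) ^ a * schwartzSup N φ := by
    have hshift : ∫ x : E m, (1 + ‖x + y‖) ^ (-((m + 1 : ℕ) : ℝ)) = I :=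
      integral_add_right_eq_self (fun x : E m => (1 + ‖x‖) ^ (-((m + 1 : ℕ) : ℝ))) y
    have hint : Integrable fun x : E m => (C₃ * (1 + ‖y‖) ^ a * (2 ^ N * schwartzSup N φ)) *
        (1 + ‖x + y‖) ^ (-((m + 1 : ℕ) : ℝ)) :=
      ((integrable_one_add_norm_neg_pow m).comp_add_right y).const_mul _
    refine (norm_integral_le_of_norm_le hint (ae_of_all _ fun x => ?_)).trans ?_
    · rw [norm_mul, norm_mul, hψx]
      have e1 := rpow_mul_norm_le m (b := |a|) (N := N) (hR.trans hRN) φ (x + y)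
      calc ‖K x‖ * (‖1 - cutoff x‖ * ‖φ (x + y)‖)
          ≤ (C₃ * ((1 + ‖y‖) ^ a * (1 + ‖x + y‖) ^ |a|)) * (1 * ‖φ (x + y)‖) := by
            gcongr
            · exact (hKb x).trans (mul_le_mul_of_nonneg_left (one_add_norm_rpow_le x y a) hC₃)
            · exact norm_one_sub_cutoff_le x
        _ = C₃ * (1 + ‖y‖) ^ a * ((1 + ‖x + y‖) ^ |a| * ‖φ (x + y)‖) := by ring
        _ ≤ C₃ * (1 + ‖y‖) ^ a *
            (2 ^ N * schwartzSup N φ * (1 + ‖x + y‖) ^ (-((m + 1 : ℕ) : ℝ))) := by gcongr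
        _ = _ := by ring
    · rw [integral_const_mul, hshift]
      apply le_of_eq; ring
  rw [smear, distribution_split s hK]
  refine (norm_add_le _ _).trans ?_
  linarith

/-! ### Existence of the convolution -/

/-- The limit of `⟨T, η_k g⟩` for `g(y) = ⟨S_x, φ(x + y)⟩`, when `K` represents `T` away from the
unit ball. -/
def convPairing (s t : 𝓢'(E m, ℂ)) (K : E m → ℂ) (φ : 𝓢(E m, ℂ)) : ℂ :=
  t (cutoffMul (smear s φ) (contDiff_smear s φ)) + ∫ x, K x * ((1 - cutoff x) * smear s φ x)

section

variable {s t : 𝓢'(E m, ℂ)} {a b : ℝ} {K L : E m → ℂ}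

/-- The truncation `η_k g`. -/
def truncation (s : 𝓢'(E m, ℂ)) (φ : 𝓢(E m, ℂ)) {η : ℕ → E m → ℝ} (hη : IsApproxUnit η) (k : ℕ) :
    𝓢(E m, ℂ) :=
  HasCompactSupport.toSchwartzMap (f := fun y => (η k y : ℂ) * smear s φ y)
    (((hη.compact_support k).comp_left (g := fun r : ℝ => (r : ℂ)) (by simp)).mul_right)
    ((Complex.ofRealCLM.contDiff.comp (hη.smooth k)).mul (contDiff_smear s φ))

@[simp] lemma truncation_apply (s : 𝓢'(E m, ℂ)) (φ : 𝓢(E m, ℂ)) {η : ℕ → E m → ℝ}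
    (hη : IsApproxUnit η) (k : ℕ) (y : E m) :
    truncation s φ hη k y = (η k y : ℂ) * smear s φ y := rfl

/-- The growth exponents add, and `a + b ≤ -(m+1)` is what makes the product integrable at infinity.
-/
lemma exists_far_bound (hL : IsFarKernel s a L) (hK : IsFarKernel t b K)
    (hab : a + b ≤ -((m + 1 : ℕ) : ℝ)) : ∃ (N : ℕ) (C : ℝ), 0 ≤ C ∧ ∀ φ x,
      ‖K x * ((1 - cutoff x) * smear s φ x)‖ ≤
        C * schwartzSup N φ * (1 + ‖x‖) ^ (-((m + 1 : ℕ) : ℝ)) := by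
  obtain ⟨N, C, hC, hs⟩ := exists_bound_smear s hL
  obtain ⟨D, hD, hKb⟩ := hK.bound
  refine ⟨N, D * C, by positivity, fun φ x => ?_⟩
  have hP := schwartzSup_nonneg N φ
  have hx : 0 < 1 + ‖x‖ := by positivity
  rw [norm_mul, norm_mul]
  calc ‖K x‖ * (‖1 - cutoff x‖ * ‖smear s φ x‖)
      ≤ (D * (1 + ‖x‖) ^ b) * (1 * (C * (1 + ‖x‖) ^ a * schwartzSup N φ)) := by
        gcongr
        · exact hKb x
        · exact norm_one_sub_cutoff_le x
        · exact hs φ x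
    _ = D * C * schwartzSup N φ * (1 + ‖x‖) ^ (a + b) := by
        rw [Real.rpow_add hx]; ring
    _ ≤ _ := by
        gcongr
        linarith [norm_nonneg x]

lemma continuous_cutoff : Continuous (cutoff (m := m)) := contDiff_cutoff.continuous

lemma continuous_smear (s : 𝓢'(E m, ℂ)) (φ : 𝓢(E m, ℂ)) : Continuous (smear s φ) :=
  (contDiff_smear s φ).continuous

lemma integrable_far (hL : IsFarKernel s a L) (hK : IsFarKernel t b K)
    (hab : a + b ≤ -((m + 1 : ℕ) : ℝ)) (φ : 𝓢(E m, ℂ)) :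
    Integrable fun x => K x * ((1 - cutoff x) * smear s φ x) := by
  obtain ⟨N, C, -, h⟩ := exists_far_bound hL hK hab
  refine ((integrable_one_add_norm_neg_pow m).const_mul (C * schwartzSup N φ)).mono' ?_
    (ae_of_all _ (h φ))
  exact hK.measurable.aestronglyMeasurable.mul
    ((continuous_const.sub continuous_cutoff).mul (continuous_smear s φ)).aestronglyMeasurable

/-- Continuity in `φ` is needed later, to make the contribution of a small low-frequency part
negligible. -/
lemma exists_bound_convPairing (hL : IsFarKernel s a L) (hK : IsFarKernel t b K)
    (hab : a + b ≤ -((m + 1 : ℕ) : ℝ)) : ∃ (N : ℕ) (C : ℝ), 0 ≤ C ∧ ∀ φ,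
      ‖convPairing s t K φ‖ ≤ C * schwartzSup N φ := by
  obtain ⟨N₁, C₁, hC₁, h₁⟩ := exists_far_bound hL hK hab
  obtain ⟨M, C₂, hC₂, h₂⟩ := exists_bound_distribution t
  obtain ⟨C₃, hC₃, h₃⟩ := exists_schwartzSup_cutoffMul_le m M
  choose R D hD hR using exists_bound_iteratedFDeriv_smear s
  set I := ∫ x : E m, (1 + ‖x‖) ^ (-((m + 1 : ℕ) : ℝ)) with hI
  have hI0 : 0 ≤ I := integral_nonneg fun x => by positivity
  set Q := (Finset.range (M + 1)).sup R with hQ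
  set G := ∑ n ∈ Finset.range (M + 1), D n * 3 ^ Q with hG
  have hG0 : 0 ≤ G := Finset.sum_nonneg fun n _ => mul_nonneg (hD n) (by positivity)
  set N := max N₁ Q
  refine ⟨N, C₂ * C₃ * G + C₁ * I, by positivity, fun φ => ?_⟩
  have hP := schwartzSup_nonneg N φ
  have hb : ∀ n ≤ M, ∀ x : E m, ‖x‖ ≤ 2 →
      ‖iteratedFDeriv ℝ n (smear s φ) x‖ ≤ G * schwartzSup N φ := by
    intro n hn x hx
    have hn' : n ∈ Finset.range (M + 1) := Finset.mem_range.2 (by omega)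
    have hRQ : R n ≤ Q := Finset.le_sup hn'
    have hDn := hD n
    calc _ ≤ D n * (1 + ‖x‖) ^ R n * schwartzSup (R n) φ := hR n φ x
      _ ≤ D n * 3 ^ Q * schwartzSup N φ := by
          have e1 : (1 + ‖x‖) ^ R n ≤ 3 ^ Q :=
            (pow_le_pow_left₀ (by positivity) (by linarith) _).trans
              (pow_le_pow_right₀ (by norm_num) hRQ)
          have e2 := schwartzSup_mono (hRQ.trans (le_max_right N₁ Q)) φ
          have e3 := schwartzSup_nonneg (R n) φ
          gcongr
      _ ≤ G * schwartzSup N φ := by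
          gcongr
          exact Finset.single_le_sum (f := fun n => D n * 3 ^ Q)
            (fun n _ => mul_nonneg (hD n) (by positivity)) hn'
  have e1 : ‖t (cutoffMul (smear s φ) (contDiff_smear s φ))‖ ≤ C₂ * C₃ * G * schwartzSup N φ := by
    refine (h₂ _).trans ?_
    calc _ ≤ C₂ * (C₃ * (G * schwartzSup N φ)) := by
          gcongr
          exact h₃ _ _ _ (by positivity) hb
      _ = _ := by ring
  have e2 : ‖∫ x, K x * ((1 - cutoff x) * smear s φ x)‖ ≤ C₁ * I * schwartzSup N φ := by
    refine (norm_integral_le_of_norm_le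
      ((integrable_one_add_norm_neg_pow m).const_mul (C₁ * schwartzSup N₁ φ))
      (ae_of_all _ (h₁ φ))).trans ?_
    rw [integral_const_mul, ← hI]
    have := schwartzSup_mono (le_max_left N₁ Q) φ
    calc _ ≤ C₁ * schwartzSup N φ * I := by gcongr
      _ = _ := by ring
  refine (norm_add_le _ _).trans ?_
  linarith

lemma smear_sub (s : 𝓢'(E m, ℂ)) (φ ψ : 𝓢(E m, ℂ)) (y : E m) :
    smear s (φ - ψ) y = smear s φ y - smear s ψ y := by simp [smear]

lemma convPairing_sub (hL : IsFarKernel s a L) (hK : IsFarKernel t b K)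
    (hab : a + b ≤ -((m + 1 : ℕ) : ℝ)) (φ ψ : 𝓢(E m, ℂ)) :
    convPairing s t K (φ - ψ) = convPairing s t K φ - convPairing s t K ψ := by
  have h1 : cutoffMul (smear s (φ - ψ)) (contDiff_smear s _) =
      cutoffMul (smear s φ) (contDiff_smear s _) - cutoffMul (smear s ψ) (contDiff_smear s _) := by
    ext x
    simp [smear_sub, mul_sub]
  have h2 : ∫ x, K x * ((1 - cutoff x) * smear s (φ - ψ) x) =
      (∫ x, K x * ((1 - cutoff x) * smear s φ x)) -
        ∫ x, K x * ((1 - cutoff x) * smear s ψ x) := by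
    rw [← integral_sub (integrable_far hL hK hab φ) (integrable_far hL hK hab ψ)]
    simp [smear_sub, mul_sub]
  rw [convPairing, convPairing, convPairing, h1, h2, map_sub]
  ring

/-- The near part is eventually constant, since `η_k = 1` on the support of the cutoff. The far part
converges by dominated convergence, using the uniform bound on `η_k`. The limit does not depend on
the sequence. -/
lemma tendsto_truncation (hL : IsFarKernel s a L) (hK : IsFarKernel t b K)
    (hab : a + b ≤ -((m + 1 : ℕ) : ℝ)) (φ : 𝓢(E m, ℂ)) {η : ℕ → E m → ℝ} (hη : IsApproxUnit η) :
    Tendsto (fun k => t (truncation s φ hη k)) atTop (𝓝 (convPairing s t K φ)) := by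
  have hsplit : ∀ k, t (truncation s φ hη k) =
      t (cutoffMul (truncation s φ hη k) ((truncation s φ hη k).smooth ⊤)) +
        ∫ x, K x * ((1 - cutoff x) * truncation s φ hη k x) := fun k => distribution_split t hK _
  simp_rw [hsplit]
  refine Tendsto.add ?_ ?_
  · refine tendsto_const_nhds.congr' ?_
    filter_upwards [hη.eventually_one (Metric.closedBall 0 2) (isCompact_closedBall _ _)] with k hk
    congr 1
    ext x
    simp only [cutoffMul_apply, truncation_apply]
    by_cases hx : ‖x‖ ≤ 2
    · rw [hk x (by simpa using hx)]; simp
    · rw [cutoff_eq_zero (not_le.1 hx).le]; simp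
  · obtain ⟨N, C, hC, h⟩ := exists_far_bound hL hK hab
    obtain ⟨D, hD⟩ := hη.bounded 0
    refine tendsto_integral_of_dominated_convergence
      (fun x => D * (C * schwartzSup N φ * (1 + ‖x‖) ^ (-((m + 1 : ℕ) : ℝ)))) (fun k => ?_)
      (((integrable_one_add_norm_neg_pow m).const_mul _).const_mul _) (fun k => ae_of_all _ fun x => ?_)
      (ae_of_all _ fun x => ?_)
    · exact hK.measurable.aestronglyMeasurable.mul
        ((continuous_const.sub continuous_cutoff).mul
          (truncation s φ hη k).continuous).aestronglyMeasurable
    · have h1 := hD k x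
      rw [norm_iteratedFDeriv_zero] at h1
      have : K x * ((1 - cutoff x) * truncation s φ hη k x) =
          (η k x : ℂ) * (K x * ((1 - cutoff x) * smear s φ x)) := by
        rw [truncation_apply]; ring
      rw [this, norm_mul, Complex.norm_real]
      exact mul_le_mul h1 (h φ x) (norm_nonneg _) ((norm_nonneg _).trans h1)
    · refine tendsto_const_nhds.congr' ?_
      filter_upwards [hη.eventually_one {x} isCompact_singleton] with k hk
      rw [truncation_apply, hk x rfl]
      simp

end

/-! ### Dilations, symbols and high frequencies -/

/-- Dilation of Schwartz functions, `φ ↦ φ(c ·)`. -/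
def dilate (c : ℝ) (hc : 0 < c) : 𝓢(E m, ℂ) →L[ℂ] 𝓢(E m, ℂ) :=
  SchwartzMap.compCLMOfContinuousLinearEquiv ℂ
    (ContinuousLinearEquiv.smulLeft (Units.mk0 c hc.ne'))

@[simp] lemma dilate_apply (c : ℝ) (hc : 0 < c) (φ : 𝓢(E m, ℂ)) (x : E m) :
    dilate c hc φ x = φ (c • x) := rfl

lemma exists_isApproxUnit (m : ℕ) : ∃ η : ℕ → E m → ℝ, IsApproxUnit η := by
  have hsm : ContDiff ℝ ∞ (bump m) := (bump m).contDiff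
  refine ⟨fun k x => bump m (((k : ℝ) + 1)⁻¹ • x), fun k => ?_, fun k => ?_, fun K hK => ?_, fun n => ?_⟩
  · exact hsm.comp (contDiff_const_smul _)
  · exact (bump m).hasCompactSupport.comp_smul (by positivity)
  · obtain ⟨R, hR⟩ := hK.isBounded.exists_norm_le
    obtain ⟨N, hN⟩ := exists_nat_ge R
    filter_upwards [eventually_ge_atTop N] with k hk x hx
    refine (bump m).one_of_mem_closedBall ?_
    have hk' : (N : ℝ) ≤ k := by exact_mod_cast hk
    simp only [bump, mem_closedBall_zero_iff, norm_smul, norm_inv]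
    rw [Real.norm_of_nonneg (by positivity), inv_mul_le_iff₀ (by positivity)]
    linarith [hR x hx]
  · obtain ⟨C, hC⟩ := hsm.continuous_iteratedFDeriv (m := n)
      (by exact_mod_cast le_top) |>.bounded_above_of_compact_support
      ((bump m).hasCompactSupport.iteratedFDeriv n)
    refine ⟨C, fun k x => ?_⟩
    rw [iteratedFDeriv_comp_const_smul _ (contDiff_infty.1 hsm n)]
    rw [norm_smul, norm_pow, norm_inv, Real.norm_of_nonneg (by positivity)]
    have h1 : ((k : ℝ) + 1)⁻¹ ^ n ≤ 1 :=
      pow_le_one₀ (by positivity) (inv_le_one_of_one_le₀ (by linarith [k.cast_nonneg (α := ℝ)]))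
    exact (mul_le_of_le_one_left (norm_nonneg _) h1).trans (hC _)

lemma IsApproxUnit.comp_smul {η : ℕ → E m → ℝ} (hη : IsApproxUnit η) {c : ℝ} (hc : 0 < c) :
    IsApproxUnit fun k x => η k (c • x) := by
  refine ⟨fun k => (hη.smooth k).comp (contDiff_const_smul _),
    fun k => (hη.compact_support k).comp_smul hc.ne', fun K hK => ?_, fun n => ?_⟩
  · filter_upwards [hη.eventually_one ((fun x => c • x) '' K)
      (hK.image (continuous_const_smul c))] with k hk x hx
    exact hk _ ⟨x, hx, rfl⟩
  · obtain ⟨C, hC⟩ := hη.bounded n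
    refine ⟨c ^ n * C, fun k x => ?_⟩
    rw [iteratedFDeriv_comp_const_smul _ (contDiff_infty.1 (hη.smooth k) n), norm_smul, norm_pow,
      Real.norm_of_nonneg hc.le]
    gcongr
    exact hC k _

lemma fourier_dilate (c : ℝ) (hc : 0 < c) (φ : 𝓢(E m, ℂ)) (ξ : E m) :
    𝓕 (dilate c hc φ) ξ = ((c ^ m)⁻¹ : ℝ) • 𝓕 φ (c⁻¹ • ξ) := by
  rw [SchwartzMap.fourier_coe, SchwartzMap.fourier_coe, Real.fourier_eq, Real.fourier_eq]
  have h := Measure.integral_comp_smul (volume : Measure (E m))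
    (fun v => Real.fourierChar (-inner ℝ v (c⁻¹ • ξ)) • φ v) c
  rw [finrank_euclideanSpace_fin, abs_of_nonneg (by positivity)] at h
  rw [← h]
  refine integral_congr_ae (ae_of_all _ fun v => ?_)
  simp only [dilate_apply, inner_smul_left, inner_smul_right]
  congr 3
  simp
  field_simp

lemma fourier_translate (φ : 𝓢(E m, ℂ)) (y ξ : E m) :
    𝓕 (φ.compSubConstCLM ℂ (-y)) ξ = (Real.fourierChar (inner ℝ ξ y) : ℂ) * 𝓕 φ ξ := by
  rw [SchwartzMap.fourier_coe, SchwartzMap.fourier_coe, Real.fourier_eq, Real.fourier_eq]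
  rw [← integral_add_right_eq_self _ (-y), ← integral_const_mul]
  refine integral_congr_ae (ae_of_all _ fun v => ?_)
  simp only [SchwartzMap.compSubConstCLM_apply, Circle.smul_def, smul_eq_mul]
  rw [← mul_assoc, ← Circle.coe_mul, ← AddChar.map_add_eq_mul]
  congr 3
  · rw [inner_add_left, inner_neg_left, real_inner_comm y ξ]; ring
  · simp

/-- A function which is smooth of temperate growth away from a neighbourhood of the origin. -/
structure IsSymbol (σ : E m → ℂ) : Prop where
  hasTemperateGrowth : (fun ξ => (1 - cutoff ((2 : ℝ) • ξ)) * σ ξ).HasTemperateGrowth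

/-- The tempered distribution `s` is homogeneous of degree `-m-μ`, is a function away from the
origin, and its Fourier transform is the function `σ` away from the origin. -/
structure HasSymbol (s : 𝓢'(E m, ℂ)) (μ : ℂ) (σ : E m → ℂ) : Prop where
  map_dilate : ∀ (c : ℝ) (hc : 0 < c) φ, s (dilate c hc φ) = (c : ℂ) ^ μ * s φ
  far : ∃ K, IsFarKernel s (-m - μ.re) K
  isSymbol : IsSymbol σ
  eq_integral : ∀ φ : 𝓢(E m, ℂ), (∀ ξ, ‖ξ‖ ≤ 1 → 𝓕 φ ξ = 0) → s φ = ∫ ξ, σ ξ * 𝓕 φ ξ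

lemma smear_dilate {s : 𝓢'(E m, ℂ)} {μ : ℂ} {σ : E m → ℂ} (hs : HasSymbol s μ σ) (c : ℝ)
    (hc : 0 < c) (φ : 𝓢(E m, ℂ)) (y : E m) :
    smear s (dilate c hc φ) y = (c : ℂ) ^ μ * smear s φ (c • y) := by
  rw [smear, smear, ← hs.map_dilate c hc]
  congr 1
  ext x
  simp

/-- A dilation of `φ` can be moved onto the truncating sequence, which remains admissible, so the
limit is unchanged. The homogeneity factors `c^μ` and `c^(-μ)` cancel. -/
lemma convPairing_dilate {s t : 𝓢'(E m, ℂ)} {μ : ℂ} {σ τ : E m → ℂ} {a b : ℝ} {K L : E m → ℂ}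
    (hs : HasSymbol s μ σ) (ht : HasSymbol t (-μ) τ) (hL : IsFarKernel s a L)
    (hK : IsFarKernel t b K) (hab : a + b ≤ -((m + 1 : ℕ) : ℝ)) (c : ℝ) (hc : 0 < c)
    (φ : 𝓢(E m, ℂ)) : convPairing s t K (dilate c hc φ) = convPairing s t K φ := by
  obtain ⟨η, hη⟩ := exists_isApproxUnit m
  have h1 := tendsto_truncation hL hK hab (dilate c hc φ) hη
  have h2 := tendsto_truncation hL hK hab φ (hη.comp_smul (inv_pos.2 hc))
  refine tendsto_nhds_unique h1 (h2.congr fun k => ?_)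
  have h3 : truncation s (dilate c hc φ) hη k =
      (c : ℂ) ^ μ • dilate c hc (truncation s φ (hη.comp_smul (inv_pos.2 hc)) k) := by
    ext y
    simp only [truncation_apply, smul_apply, dilate_apply, smear_dilate hs, smul_eq_mul, smul_smul,
      inv_mul_cancel₀ hc.ne', one_smul]
    ring
  rw [h3, map_smul, ht.map_dilate, smul_eq_mul, ← mul_assoc, ← Complex.cpow_add _ _ (by
    exact_mod_cast hc.ne')]
  simp

/-- The convolution `s ∗ φ` on the Fourier side. -/
lemma smear_eq_fourierInv {s : 𝓢'(E m, ℂ)} {μ : ℂ} {σ : E m → ℂ} (hs : HasSymbol s μ σ)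
    (φ : 𝓢(E m, ℂ)) (hφ : ∀ ξ, ‖ξ‖ ≤ 1 → 𝓕 φ ξ = 0) :
    ∃ G : 𝓢(E m, ℂ), (∀ ξ, G ξ = σ ξ * 𝓕 φ ξ) ∧ ∀ y, smear s φ y = 𝓕⁻ G y := by
  -- The factor `1 - cutoff (2ξ)` equals `1` for `‖ξ‖ ≥ 1`, and `φ̂` vanishes on the unit ball.
  -- Multiplying by it leaves `σ φ̂` unchanged while making the multiplier smooth at the origin.
  set G := SchwartzMap.smulLeftCLM ℂ (fun ξ => (1 - cutoff ((2 : ℝ) • ξ)) * σ ξ) (𝓕 φ) with hGdef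
  have hG : ∀ ξ, G ξ = σ ξ * 𝓕 φ ξ := by
    intro ξ
    rw [hGdef, SchwartzMap.smulLeftCLM_apply_apply hs.isSymbol.hasTemperateGrowth]
    by_cases h : ‖ξ‖ ≤ 1
    · simp [hφ ξ h]
    · rw [cutoff_eq_zero (by rw [norm_smul]; norm_num; linarith)]
      simp
  refine ⟨G, hG, fun y => ?_⟩
  have h1 : ∀ ξ, ‖ξ‖ ≤ 1 → 𝓕 (φ.compSubConstCLM ℂ (-y)) ξ = 0 := fun ξ h => by
    rw [fourier_translate, hφ ξ h, mul_zero]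
  rw [smear, hs.eq_integral _ h1, SchwartzMap.fourierInv_coe, Real.fourierInv_eq]
  refine integral_congr_ae (ae_of_all _ fun ξ => ?_)
  simp only [fourier_translate, hG, Circle.smul_def, smul_eq_mul]
  ring

/-- Here the smeared function is itself Schwartz, the inverse transform of `σ φ̂`, so the pairing is
simply `t` evaluated on it. Its transform again vanishes on the unit ball, and the symbol of `t`
applies. -/
lemma convPairing_eq_of_fourier_eq_zero {s t : 𝓢'(E m, ℂ)} {μ ν : ℂ} {σ τ : E m → ℂ} {b : ℝ}
    {K : E m → ℂ} (hs : HasSymbol s μ σ) (ht : HasSymbol t ν τ) (hK : IsFarKernel t b K)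
    (φ : 𝓢(E m, ℂ)) (hφ : ∀ ξ, ‖ξ‖ ≤ 1 → 𝓕 φ ξ = 0) :
    convPairing s t K φ = ∫ ξ, σ ξ * τ ξ * 𝓕 φ ξ := by
  obtain ⟨G, hG, hsm⟩ := smear_eq_fourierInv hs φ hφ
  have h1 : smear s φ = ⇑(𝓕⁻ G : 𝓢(E m, ℂ)) := funext hsm
  have h2 : convPairing s t K φ = t (𝓕⁻ G) := by
    rw [distribution_split t hK, convPairing]
    congr 1
    · congr 1
      ext x
      simp [h1]
    · simp_rw [h1]
  have h3 : 𝓕 (𝓕⁻ G) = G := FourierTransform.fourier_fourierInv_eq G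
  rw [h2, ht.eq_integral _ (fun ξ h => by rw [h3, hG, hφ ξ h, mul_zero])]
  rw [h3]
  refine integral_congr_ae (ae_of_all _ fun ξ => ?_)
  simp only [hG]
  ring

/-! ### Bounded multipliers and the removal of low frequencies -/

lemma integrable_mul_of_bounded {ρ : E m → ℂ} (hm : Measurable ρ) {C : ℝ} (hb : ∀ ξ, ‖ρ ξ‖ ≤ C)
    (φ : 𝓢(E m, ℂ)) : Integrable fun ξ => ρ ξ * φ ξ :=
  φ.integrable.bdd_mul hm.aestronglyMeasurable (ae_of_all _ hb)

/-- The tempered distribution whose Fourier transform is the bounded function `ρ`. -/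
def multiplierDist (ρ : E m → ℂ) (hm : Measurable ρ) (hb : ∃ C : ℝ, ∀ ξ, ‖ρ ξ‖ ≤ C) :
    𝓢'(E m, ℂ) :=
  distributionOfBound (fun φ => ∫ ξ, ρ ξ * 𝓕 φ ξ)
    (fun φ ψ => by
      obtain ⟨C, hC⟩ := hb
      rw [← integral_add (integrable_mul_of_bounded hm hC _) (integrable_mul_of_bounded hm hC _)]
      simp [FourierTransform.fourier_add, mul_add])
    (fun c φ => by
      rw [← integral_const_mul]
      simp only [FourierTransform.fourier_smul, smul_apply, smul_eq_mul]
      congr 1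
      ext ξ
      ring)
    (by
      obtain ⟨C, hC⟩ := hb
      obtain ⟨N, D, hD, hN⟩ := exists_bound_clm (FourierTransform.fourierCLM ℂ 𝓢(E m, ℂ)) (m + 1)
      set I := ∫ x : E m, (1 + ‖x‖) ^ (-((m + 1 : ℕ) : ℝ)) with hI
      have hI0 : 0 ≤ I := integral_nonneg fun x => by positivity
      have hC0 : 0 ≤ C := (norm_nonneg _).trans (hC 0)
      refine ⟨N, C * 2 ^ (m + 1) * I * D, by positivity, fun φ => ?_⟩
      have h1 : ∀ ξ, ‖ρ ξ * 𝓕 φ ξ‖ ≤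
          C * (2 ^ (m + 1) * schwartzSup (m + 1) (𝓕 φ)) * (1 + ‖ξ‖) ^ (-((m + 1 : ℕ) : ℝ)) := by
        intro ξ
        have h2 := rpow_mul_norm_le m (b := 0) (N := m + 1) (by simp) (𝓕 φ) ξ
        rw [Real.rpow_zero, one_mul] at h2
        rw [norm_mul, mul_assoc C]
        exact mul_le_mul (hC ξ) h2 (norm_nonneg _) hC0
      refine (norm_integral_le_of_norm_le
        ((integrable_one_add_norm_neg_pow m).const_mul _) (ae_of_all _ h1)).trans ?_
      rw [integral_const_mul, ← hI]
      have h3 : schwartzSup (m + 1) (𝓕 φ) ≤ D * schwartzSup N φ := hN φ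
      calc _ ≤ C * (2 ^ (m + 1) * (D * schwartzSup N φ)) * I := by gcongr
        _ = _ := by ring)

@[simp] lemma multiplierDist_apply (ρ : E m → ℂ) (hm : Measurable ρ)
    (hb : ∃ C : ℝ, ∀ ξ, ‖ρ ξ‖ ≤ C) (φ : 𝓢(E m, ℂ)) :
    multiplierDist ρ hm hb φ = ∫ ξ, ρ ξ * 𝓕 φ ξ := rfl

lemma multiplierDist_dilate (ρ : E m → ℂ) (hm : Measurable ρ) (hb : ∃ C : ℝ, ∀ ξ, ‖ρ ξ‖ ≤ C)
    (hρ : ∀ c : ℝ, 0 < c → ∀ ξ, ρ (c • ξ) = ρ ξ) (c : ℝ) (hc : 0 < c) (φ : 𝓢(E m, ℂ)) :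
    multiplierDist ρ hm hb (dilate c hc φ) = multiplierDist ρ hm hb φ := by
  rw [multiplierDist_apply, multiplierDist_apply]
  have h := Measure.integral_comp_smul (volume : Measure (E m)) (fun ξ => ρ ξ * 𝓕 φ ξ) c⁻¹
  rw [finrank_euclideanSpace_fin, inv_pow, inv_inv, abs_of_nonneg (by positivity)] at h
  simp only [hρ _ (inv_pos.2 hc)] at h
  have h2 : ∀ ξ, ρ ξ * 𝓕 (dilate c hc φ) ξ = ((c ^ m)⁻¹ : ℝ) • (ρ ξ * 𝓕 φ (c⁻¹ • ξ)) := by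
    intro ξ
    rw [fourier_dilate, mul_smul_comm]
  simp_rw [h2]
  rw [integral_smul, h, smul_smul, inv_mul_cancel₀ (by positivity), one_smul]

/-- The Schwartz function with Fourier transform `χ φ̂`. -/
def lowPass (φ : 𝓢(E m, ℂ)) : 𝓢(E m, ℂ) := 𝓕⁻ (cutoffMul (𝓕 φ : 𝓢(E m, ℂ)) ((𝓕 φ).smooth ⊤))

lemma fourier_lowPass (φ : 𝓢(E m, ℂ)) (ξ : E m) : 𝓕 (lowPass φ) ξ = cutoff ξ * 𝓕 φ ξ := by
  rw [lowPass, FourierTransform.fourier_fourierInv_eq, cutoffMul_apply]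

/-- The transform of `φ(·/ε)` is `ε^m φ̂(ε·)`. For `ε ≤ 1` each of its derivatives is `O(ε^m)`, and
this bound survives the cutoff and the inverse transform. -/
lemma exists_schwartzSup_lowPass_dilate_le (N : ℕ) (φ : 𝓢(E m, ℂ)) :
    ∃ C : ℝ, 0 ≤ C ∧ ∀ (ε : ℝ) (hε : 0 < ε), ε ≤ 1 →
      schwartzSup N (lowPass (dilate ε⁻¹ (inv_pos.2 hε) φ)) ≤ C * ε ^ m := by
  obtain ⟨M, D, hD, hM⟩ := exists_bound_clm (FourierTransform.fourierInvCLM ℂ 𝓢(E m, ℂ)) N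
  obtain ⟨C, hC, hcut⟩ := exists_schwartzSup_cutoffMul_le m M
  set P := schwartzSup M (𝓕 φ)
  have hP : 0 ≤ P := schwartzSup_nonneg _ _
  refine ⟨D * (C * (2 ^ M * P)), by positivity, fun ε hε hε1 => ?_⟩
  set ψ := dilate ε⁻¹ (inv_pos.2 hε) φ
  have h1 : schwartzSup N (lowPass ψ) ≤ D * schwartzSup M (cutoffMul (𝓕 ψ : 𝓢(E m, ℂ)) ((𝓕 ψ).smooth ⊤)) :=
    hM _
  refine h1.trans ?_
  have hfun : ⇑(𝓕 ψ : 𝓢(E m, ℂ)) = (ε ^ m) • fun ξ => 𝓕 φ (ε • ξ) := by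
    ext ξ
    simp [ψ, fourier_dilate]
  have h2 : ∀ n ≤ M, ∀ ξ, ‖ξ‖ ≤ 2 → ‖iteratedFDeriv ℝ n (𝓕 ψ : 𝓢(E m, ℂ)) ξ‖ ≤ ε ^ m * (2 ^ M * P) := by
    intro n hn ξ _
    have hsm : ContDiff ℝ n (𝓕 φ : 𝓢(E m, ℂ)) := contDiff_infty.1 ((𝓕 φ).smooth ⊤) n
    have hsm' : ContDiff ℝ n fun ξ => 𝓕 φ (ε • ξ) := hsm.comp (contDiff_const_smul ε)
    rw [hfun, iteratedFDeriv_const_smul_apply hsm'.contDiffAt, iteratedFDeriv_comp_const_smul _ hsm,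
      norm_smul, norm_smul, norm_pow, norm_pow, Real.norm_of_nonneg hε.le]
    have h3 := norm_iteratedFDeriv_le_schwartzSup hn (𝓕 φ) (ε • ξ)
    exact mul_le_mul_of_nonneg_left
      ((mul_le_of_le_one_left (norm_nonneg _) (pow_le_one₀ hε.le hε1)).trans h3) (by positivity)
  have h4 := hcut _ ((𝓕 ψ).smooth ⊤) _ (by positivity) h2
  calc _ ≤ D * (C * (ε ^ m * (2 ^ M * P))) := by gcongr
    _ = _ := by ring

/-- Convolution of two homogeneous distributions with complementary degrees. -/
theorem convPairing_eq_multiplier (hm : 1 ≤ m) {s t : 𝓢'(E m, ℂ)} {μ : ℂ} {σ τ : E m → ℂ}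
    (hs : HasSymbol s μ σ) (ht : HasSymbol t (-μ) τ) {a b : ℝ} {K L : E m → ℂ}
    (hL : IsFarKernel s a L) (hK : IsFarKernel t b K) (hab : a + b ≤ -((m + 1 : ℕ) : ℝ))
    (hmeas : Measurable fun ξ => σ ξ * τ ξ) (hbdd : ∃ C : ℝ, ∀ ξ, ‖σ ξ * τ ξ‖ ≤ C)
    (hhom : ∀ c : ℝ, 0 < c → ∀ ξ, σ (c • ξ) * τ (c • ξ) = σ ξ * τ ξ) (φ : 𝓢(E m, ℂ)) :
    convPairing s t K φ = multiplierDist (fun ξ => σ ξ * τ ξ) hmeas hbdd φ := by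
  set r := multiplierDist (fun ξ => σ ξ * τ ξ) hmeas hbdd with hr
  obtain ⟨N₁, C₁, hC₁, h₁⟩ := exists_bound_convPairing hL hK hab
  obtain ⟨N₂, C₂, hC₂, h₂⟩ := exists_bound_distribution r
  set N := max N₁ N₂
  obtain ⟨C, hC, hlow⟩ := exists_schwartzSup_lowPass_dilate_le N φ
  have hzero : ∀ ψ : 𝓢(E m, ℂ), (∀ ξ, ‖ξ‖ ≤ 1 → 𝓕 ψ ξ = 0) → convPairing s t K ψ = r ψ :=
    fun ψ hψ => convPairing_eq_of_fourier_eq_zero hs ht hK ψ hψ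
  -- By dilation invariance `φ` may be replaced by `φ(·/ε)`. The two functionals agree on its
  -- high-frequency part, so their difference sees only the low-frequency part, which is small.
  have hbound : ∀ ε : ℝ, 0 < ε → ε ≤ 1 → ‖convPairing s t K φ - r φ‖ ≤ (C₁ + C₂) * C * ε := by
    intro ε hε hε1
    set ψ := dilate ε⁻¹ (inv_pos.2 hε) φ with hψ
    have e1 : convPairing s t K φ = convPairing s t K ψ :=
      (convPairing_dilate hs ht hL hK hab _ _ φ).symm
    have e2 : r φ = r ψ := (multiplierDist_dilate _ hmeas hbdd hhom _ _ φ).symm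
    have e3 := hzero (ψ - lowPass ψ) fun ξ hξ => by
      have h3 : 𝓕 (ψ - lowPass ψ) = 𝓕 ψ - 𝓕 (lowPass ψ) :=
        map_sub (FourierTransform.fourierCLM ℂ 𝓢(E m, ℂ)) _ _
      rw [h3, sub_apply, fourier_lowPass, cutoff_eq_one hξ]
      ring
    rw [convPairing_sub hL hK hab, map_sub] at e3
    have e4 : convPairing s t K φ - r φ = convPairing s t K (lowPass ψ) - r (lowPass ψ) := by
      rw [e1, e2]
      linear_combination e3
    -- The assumption `m ≥ 1` turns `ε^m` into a quantity that tends to zero.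
    have e5 : schwartzSup N (lowPass ψ) ≤ C * ε := (hlow ε hε hε1).trans (by
      gcongr
      exact pow_le_of_le_one hε.le hε1 (by omega))
    rw [e4]
    calc _ ≤ ‖convPairing s t K (lowPass ψ)‖ + ‖r (lowPass ψ)‖ := norm_sub_le _ _
      _ ≤ C₁ * schwartzSup N (lowPass ψ) + C₂ * schwartzSup N (lowPass ψ) := by
          refine add_le_add ((h₁ _).trans ?_) ((h₂ _).trans ?_)
          · exact mul_le_mul_of_nonneg_left (schwartzSup_mono (le_max_left _ _) _) hC₁
          · exact mul_le_mul_of_nonneg_left (schwartzSup_mono (le_max_right _ _) _) hC₂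
      _ ≤ C₁ * (C * ε) + C₂ * (C * ε) := by gcongr
      _ = _ := by ring
  have hlim : Tendsto (fun ε : ℝ => (C₁ + C₂) * C * ε) (𝓝[>] 0) (𝓝 0) := by
    have : Tendsto (fun ε : ℝ => (C₁ + C₂) * C * ε) (𝓝 0) (𝓝 ((C₁ + C₂) * C * 0)) :=
      tendsto_id.const_mul _
    rw [mul_zero] at this
    exact this.mono_left nhdsWithin_le_nhds
  have h0 : ‖convPairing s t K φ - r φ‖ ≤ 0 := by
    refine ge_of_tendsto hlim ?_
    filter_upwards [self_mem_nhdsWithin, nhdsWithin_le_nhds (Iic_mem_nhds one_pos)] with ε h h'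
    exact hbound ε h h'
  exact sub_eq_zero.1 (norm_le_zero_iff.1 h0)

theorem isScalarConv_multiplierDist (hm : 1 ≤ m) {s t : 𝓢'(E m, ℂ)} {μ : ℂ} {σ τ : E m → ℂ}
    (hs : HasSymbol s μ σ) (ht : HasSymbol t (-μ) τ)
    (hmeas : Measurable fun ξ => σ ξ * τ ξ) (hbdd : ∃ C : ℝ, ∀ ξ, ‖σ ξ * τ ξ‖ ≤ C)
    (hhom : ∀ c : ℝ, 0 < c → ∀ ξ, σ (c • ξ) * τ (c • ξ) = σ ξ * τ ξ) :
    IsScalarConv s t (multiplierDist (fun ξ => σ ξ * τ ξ) hmeas hbdd) := by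
  intro φ η hη
  obtain ⟨L, hL⟩ := hs.far
  obtain ⟨K, hK⟩ := ht.far
  -- The exponents add up to `-2m`, which is at most `-(m+1)` because `m ≥ 1`.
  have hab : (-(m : ℝ) - μ.re) + (-(m : ℝ) - (-μ).re) ≤ -((m + 1 : ℕ) : ℝ) := by
    have : (1 : ℝ) ≤ m := by exact_mod_cast hm
    push_cast
    rw [Complex.neg_re]
    linarith
  refine ⟨truncation s φ hη, fun k y => rfl, ?_⟩
  rw [← convPairing_eq_multiplier hm hs ht hL hK hab hmeas hbdd hhom]
  exact tendsto_truncation hL hK hab φ hη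

/-! ### The Hadamard finite part as a function of the exponent -/

/-- The `j`-th Taylor coefficient at the origin. -/
def taylorCoeff (ψ : ℝ → ℂ) (j : ℕ) : ℂ := iteratedDeriv j ψ 0 / (j.factorial : ℂ)

/-- The Taylor polynomial of order `< N` at the origin. -/
def taylorSum (N : ℕ) (ψ : ℝ → ℂ) (r : ℝ) : ℂ :=
  ∑ j ∈ Finset.range N, taylorCoeff ψ j * (r : ℂ) ^ j

lemma taylorSum_succ (N : ℕ) (ψ : ℝ → ℂ) (r : ℝ) :
    taylorSum (N + 1) ψ r = taylorSum N ψ r + taylorCoeff ψ N * (r : ℂ) ^ N :=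
  Finset.sum_range_succ _ _

lemma continuous_taylorSum (N : ℕ) (ψ : ℝ → ℂ) : Continuous (taylorSum N ψ) := by
  unfold taylorSum
  fun_prop

lemma hasDerivAt_taylorSum (N : ℕ) (ψ : ℝ → ℂ) (r : ℝ) :
    HasDerivAt (taylorSum (N + 1) ψ) (taylorSum N (deriv ψ) r) r := by
  have h1 : ∀ j : ℕ, HasDerivAt (fun r : ℝ => (r : ℂ) ^ j) ((j : ℂ) * (r : ℂ) ^ (j - 1)) r := by
    intro j
    have := (hasDerivAt_pow j (r : ℂ)).comp_ofReal
    simpa using this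
  have h2 : HasDerivAt (taylorSum (N + 1) ψ)
      (∑ j ∈ Finset.range (N + 1), taylorCoeff ψ j * ((j : ℂ) * (r : ℂ) ^ (j - 1))) r :=
    HasDerivAt.fun_sum fun j _ => (h1 j).const_mul _
  convert h2 using 1
  rw [Finset.sum_range_succ']
  simp only [CharP.cast_eq_zero, zero_mul, mul_zero, add_zero, Nat.add_sub_cancel]
  refine Finset.sum_congr rfl fun j _ => ?_
  rw [taylorCoeff, taylorCoeff, iteratedDeriv_succ', Nat.factorial_succ]
  have h3 : ((j : ℂ) + 1) ≠ 0 := by exact_mod_cast Nat.succ_ne_zero j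
  push_cast
  field_simp

lemma norm_sub_taylorSum_le (N : ℕ) {ψ : ℝ → ℂ} (hψ : ContDiff ℝ ∞ ψ) {B : ℝ}
    (hB : ∀ r ∈ Set.Icc (0 : ℝ) 1, ‖iteratedDeriv N ψ r‖ ≤ B) {r : ℝ}
    (hr : r ∈ Set.Icc (0 : ℝ) 1) : ‖ψ r - taylorSum N ψ r‖ ≤ B * r ^ N := by
  induction N generalizing ψ r with
  | zero => simpa [taylorSum] using hB r hr
  | succ N ih =>
    have hd : Differentiable ℝ ψ := hψ.differentiable (by simp)
    have hψ' : ContDiff ℝ ∞ (deriv ψ) := by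
      have := (contDiff_succ_iff_deriv (n := ∞) (f := ψ)).1 (by simpa using hψ)
      exact this.2.2
    have h1 : ∀ x ∈ Set.Icc 0 r,
        ‖deriv ψ x - taylorSum N (deriv ψ) x‖ ≤ B * r ^ N := by
      intro x hx
      have hx1 : x ∈ Set.Icc (0 : ℝ) 1 := ⟨hx.1, hx.2.trans hr.2⟩
      refine (ih hψ' (fun y hy => by rw [← iteratedDeriv_succ']; exact hB y hy) hx1).trans ?_
      have hB0 : 0 ≤ B := (norm_nonneg _).trans (hB 0 (by simp))
      gcongr
      · exact hx.1
      · exact hx.2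
    have h2 := (convex_Icc (0 : ℝ) r).norm_image_sub_le_of_norm_hasDerivWithin_le
      (f := fun x => ψ x - taylorSum (N + 1) ψ x)
      (fun x _ => ((hd x).hasDerivAt.sub (hasDerivAt_taylorSum N ψ x)).hasDerivWithinAt) h1
      (Set.left_mem_Icc.2 hr.1) (Set.right_mem_Icc.2 hr.1)
    have h3 : ψ 0 - taylorSum (N + 1) ψ 0 = 0 := by
      simp [taylorSum, Finset.sum_range_succ', taylorCoeff]
    rw [h3, sub_zero, sub_zero, Real.norm_of_nonneg hr.1] at h2
    rw [pow_succ]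
    linarith

/-- Smooth functions on the line with rapid decay at `+∞`. -/
structure IsRapid (ψ : ℝ → ℂ) : Prop where
  smooth : ContDiff ℝ ∞ ψ
  decay : ∀ k : ℕ, ∃ C : ℝ, ∀ r, 1 ≤ r → r ^ k * ‖ψ r‖ ≤ C

/-- `ψ` with its Taylor polynomial subtracted on `(0,1]`. -/
def regPart (N : ℕ) (ψ : ℝ → ℂ) (r : ℝ) : ℂ :=
  ψ r - Set.indicator (Set.Ioc (0 : ℝ) 1) (taylorSum N ψ) r

/-- The poles of the finite part. -/
def poleSum (N : ℕ) (s : ℂ) (ψ : ℝ → ℂ) : ℂ :=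
  ∑ j ∈ Finset.range N, if s + j + 1 = 0 then 0 else taylorCoeff ψ j * (1 / (s + j + 1))

lemma locallyIntegrableOn_regPart (N : ℕ) {ψ : ℝ → ℂ} (hψ : Continuous ψ) :
    LocallyIntegrableOn (regPart N ψ) (Set.Ioi 0) := by
  have h1 : LocallyIntegrable (regPart N ψ) := by
    refine hψ.locallyIntegrable.sub ?_
    exact (continuous_taylorSum N ψ).locallyIntegrable.indicator measurableSet_Ioc
  exact h1.locallyIntegrableOn _

lemma regPart_isBigO_zero (N : ℕ) {ψ : ℝ → ℂ} (hψ : ContDiff ℝ ∞ ψ) :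
    regPart N ψ =O[𝓝[>] 0] (fun r : ℝ => r ^ (-(-(N : ℝ)))) := by
  obtain ⟨B, hB⟩ := isCompact_Icc.exists_bound_of_continuousOn
    (s := Set.Icc (0 : ℝ) 1) (hψ.continuous_iteratedDeriv N (by exact_mod_cast le_top)).continuousOn
  refine Asymptotics.IsBigO.of_bound B ?_
  filter_upwards [Ioc_mem_nhdsGT one_pos] with r hr
  rw [regPart, Set.indicator_of_mem hr, neg_neg, Real.rpow_natCast,
    Real.norm_of_nonneg (pow_nonneg hr.1.le _)]
  exact norm_sub_taylorSum_le N hψ hB ⟨hr.1.le, hr.2⟩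

lemma regPart_isBigO_top (N k : ℕ) {ψ : ℝ → ℂ} (hψ : IsRapid ψ) :
    regPart N ψ =O[atTop] (fun r : ℝ => r ^ (-(k : ℝ))) := by
  obtain ⟨C, hC⟩ := hψ.decay k
  refine Asymptotics.IsBigO.of_bound C ?_
  filter_upwards [eventually_gt_atTop 1] with r hr
  have hr0 : 0 < r := one_pos.trans hr
  rw [regPart, Set.indicator_of_notMem (fun h => absurd h.2 (not_le.2 hr)), sub_zero,
    Real.norm_of_nonneg (Real.rpow_nonneg hr0.le _), Real.rpow_neg hr0.le, Real.rpow_natCast,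
    ← div_eq_mul_inv, le_div_iff₀ (by positivity), mul_comm]
  exact hC r hr.le

lemma mellinConvergent_regPart (N : ℕ) {ψ : ℝ → ℂ} (hψ : IsRapid ψ) {s : ℂ} (hs : -(N : ℝ) < s.re) :
    MellinConvergent (regPart N ψ) s := by
  obtain ⟨k, hk⟩ := exists_nat_gt s.re
  exact mellinConvergent_of_isBigO_rpow (locallyIntegrableOn_regPart N hψ.smooth.continuous)
    (regPart_isBigO_top N k hψ) hk (regPart_isBigO_zero N hψ.smooth) hs

lemma differentiableAt_mellin_regPart (N : ℕ) {ψ : ℝ → ℂ} (hψ : IsRapid ψ) {s : ℂ}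
    (hs : -(N : ℝ) < s.re) : DifferentiableAt ℂ (mellin (regPart N ψ)) s := by
  obtain ⟨k, hk⟩ := exists_nat_gt s.re
  exact mellin_differentiableAt_of_isBigO_rpow (locallyIntegrableOn_regPart N hψ.smooth.continuous)
    (regPart_isBigO_top N k hψ) hk (regPart_isBigO_zero N hψ.smooth) hs

/-- One more subtracted Taylor term costs `∫₀¹ r^(s-1+N) dr = 1/(s+N)` times its coefficient, which
is the term that the pole sum gains. -/
lemma mellin_regPart_succ (N : ℕ) {ψ : ℝ → ℂ} (hψ : IsRapid ψ) {s : ℂ} (hs : -(N : ℝ) < s.re) :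
    mellin (regPart (N + 1) ψ) s = mellin (regPart N ψ) s - taylorCoeff ψ N * (1 / (s + N)) := by
  have h1 := hasMellin_cpow_Ioc (N : ℂ) (s := s) (by simp; linarith)
  have h2 := hasMellin_const_smul h1.1 (taylorCoeff ψ N)
  have h3 := hasMellin_sub (mellinConvergent_regPart N hψ hs) h2.1
  rw [h2.2, h1.2] at h3
  rw [← smul_eq_mul, ← h3.2]
  congr 1
  ext r
  by_cases hr : r ∈ Set.Ioc (0 : ℝ) 1
  · simp only [regPart, Set.indicator_of_mem hr, taylorSum_succ, smul_eq_mul, Complex.cpow_natCast]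
    ring
  · simp only [regPart, Set.indicator_of_notMem hr]
    simp

lemma finitePart_eq_ceil (s : ℂ) {ψ : ℝ → ℂ} (hψ : IsRapid ψ) :
    finitePart s ψ = mellin (regPart ⌈-s.re⌉₊ ψ) (s + 1) + poleSum ⌈-s.re⌉₊ s ψ := by
  set N := ⌈-s.re⌉₊ with hN
  have hle : -s.re ≤ N := Nat.le_ceil _
  have hc : MellinConvergent (regPart N ψ) (s + 1) :=
    mellinConvergent_regPart N hψ (by simp; linarith)
  rw [finitePart, poleSum, ← hN]
  simp only [taylorCoeff]
  congr 1
  rw [MellinConvergent, ← Set.Ioc_union_Ioi_eq_Ioi (zero_le_one (α := ℝ)), integrableOn_union] at hc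
  rw [mellin, ← Set.Ioc_union_Ioi_eq_Ioi (zero_le_one (α := ℝ)),
    setIntegral_union (Set.Ioc_disjoint_Ioi le_rfl) measurableSet_Ioi hc.1 hc.2]
  congr 1
  · refine setIntegral_congr_fun measurableSet_Ioc fun r hr => ?_
    simp only [regPart, Set.indicator_of_mem hr, add_sub_cancel_right, smul_eq_mul, taylorSum,
      taylorCoeff]
  · refine setIntegral_congr_fun measurableSet_Ioi fun r hr => ?_
    have : r ∉ Set.Ioc (0 : ℝ) 1 := fun h => absurd h.2 (not_le.2 hr)
    simp only [regPart, Set.indicator_of_notMem this, add_sub_cancel_right, smul_eq_mul, sub_zero]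

/-- The number of subtracted terms is immaterial once it is large enough. One fixed `N` therefore
serves a whole neighbourhood of `s`, although the ceiling in the definition jumps. -/
lemma finitePart_eq (N : ℕ) {s : ℂ} (hs : -(N : ℝ) ≤ s.re) {ψ : ℝ → ℂ} (hψ : IsRapid ψ) :
    finitePart s ψ = mellin (regPart N ψ) (s + 1) + poleSum N s ψ := by
  have hle : ⌈-s.re⌉₊ ≤ N := Nat.ceil_le.2 (by linarith)
  induction N, hle using Nat.le_induction with
  | base => exact finitePart_eq_ceil s hψ
  | succ N hN ih =>
    have hN' : -s.re ≤ N := Nat.ceil_le.1 hN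
    rw [ih (by linarith), mellin_regPart_succ N hψ (by simp; linarith), poleSum, poleSum,
      Finset.sum_range_succ]
    have hne : s + N + 1 ≠ 0 := by
      intro h
      have := congrArg Complex.re h
      simp at this
      linarith
    rw [if_neg hne, show s + 1 + (N : ℂ) = s + N + 1 by ring]
    ring

/-- For fixed `N` the regularized Mellin transform is holomorphic, so only the explicit pole terms
can be singular. A pole whose Taylor coefficient vanishes is absent. -/
lemma differentiableAt_finitePart {ψ : ℝ → ℂ} (hψ : IsRapid ψ) {s : ℂ}
    (hs : ∀ j : ℕ, s + j + 1 = 0 → iteratedDeriv j ψ 0 = 0) :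
    DifferentiableAt ℂ (fun s => finitePart s ψ) s := by
  obtain ⟨N, hN⟩ := exists_nat_gt (-s.re)
  have hnhds : ∀ᶠ z : ℂ in 𝓝 s, -(N : ℝ) < z.re :=
    Complex.continuous_re.continuousAt.eventually (lt_mem_nhds (by linarith))
  have heq : (fun z => finitePart z ψ) =ᶠ[𝓝 s]
      fun z => mellin (regPart N ψ) (z + 1) + poleSum N z ψ := by
    filter_upwards [hnhds] with z hz using finitePart_eq N hz.le hψ
  refine DifferentiableAt.congr_of_eventuallyEq ?_ heq
  refine DifferentiableAt.add ?_ ?_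
  · have h1 : DifferentiableAt ℂ (mellin (regPart N ψ)) (s + 1) :=
      differentiableAt_mellin_regPart N hψ (by simp; linarith)
    exact h1.comp (f := fun z : ℂ => z + 1) s (by fun_prop)
  · unfold poleSum
    refine DifferentiableAt.fun_sum fun j _ => ?_
    by_cases hj : s + j + 1 = 0
    · have : taylorCoeff ψ j = 0 := by rw [taylorCoeff, hs j hj, zero_div]
      simp [this]
    · have hcont : ContinuousAt (fun z : ℂ => z + j + 1) s := by fun_prop
      have hev : (fun z : ℂ => if z + j + 1 = 0 then 0 else taylorCoeff ψ j * (1 / (z + j + 1)))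
          =ᶠ[𝓝 s] fun z => taylorCoeff ψ j * (1 / (z + j + 1)) := by
        filter_upwards [hcont.eventually_ne hj] with z hz
        rw [if_neg hz]
      refine DifferentiableAt.congr_of_eventuallyEq ?_ hev
      fun_prop (disch := exact hj)

lemma finitePart_of_neg_one_lt {s : ℂ} (hs : -1 < s.re) {ψ : ℝ → ℂ} (hψ : IsRapid ψ) :
    finitePart s ψ = mellin ψ (s + 1) := by
  have hreg : regPart 0 ψ = ψ := by
    ext r
    simp only [regPart, Set.indicator_apply, taylorSum]
    simp
  -- For `-1 < Re s < 0` the definition still subtracts the constant term, although the integral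
  -- converges without this. The contribution `1/(s+1)` is added back.
  rcases le_or_gt 0 s.re with h | h
  · rw [finitePart_eq 0 (by simpa using h) hψ, poleSum, hreg]
    simp
  · rw [finitePart_eq 1 (by simpa using hs.le) hψ, mellin_regPart_succ 0 hψ (by simp; linarith),
      poleSum, hreg]
    have hne : s + 1 ≠ 0 := by
      intro h'
      have := congrArg Complex.re h'
      simp at this
      linarith
    simp [hne]

lemma finitePart_const_mul (s c : ℂ) (ψ : ℝ → ℂ) :
    finitePart s (fun r => c * ψ r) = c * finitePart s ψ := by
  have h1 : ∀ j, iteratedDeriv j (fun r => c * ψ r) 0 = c * iteratedDeriv j ψ 0 := fun j =>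
    iteratedDeriv_const_mul_field c ψ
  simp only [finitePart, h1, mul_add]
  congr 1
  · congr 1
    · rw [← integral_const_mul]
      congr 1
      ext r
      have : ∑ j ∈ Finset.range ⌈-s.re⌉₊, c * iteratedDeriv j ψ 0 / (j.factorial : ℂ) * (r : ℂ) ^ j
          = c * ∑ j ∈ Finset.range ⌈-s.re⌉₊, iteratedDeriv j ψ 0 / (j.factorial : ℂ) * (r : ℂ) ^ j := by
        rw [Finset.mul_sum]
        exact Finset.sum_congr rfl fun j _ => by ring
      rw [this]
      ring
    · rw [← integral_const_mul]
      congr 1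
      ext r
      ring
  · rw [Finset.mul_sum]
    refine Finset.sum_congr rfl fun j _ => ?_
    split_ifs
    · simp
    · ring

lemma taylorCoeff_add {ψ χ : ℝ → ℂ} (hψ : ContDiff ℝ ∞ ψ) (hχ : ContDiff ℝ ∞ χ) (j : ℕ) :
    taylorCoeff (fun r => ψ r + χ r) j = taylorCoeff ψ j + taylorCoeff χ j := by
  rw [taylorCoeff, taylorCoeff, taylorCoeff, iteratedDeriv_fun_add
    (contDiff_infty.1 hψ j).contDiffAt (contDiff_infty.1 hχ j).contDiffAt, add_div]

lemma IsRapid.add {ψ χ : ℝ → ℂ} (hψ : IsRapid ψ) (hχ : IsRapid χ) :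
    IsRapid fun r => ψ r + χ r := by
  refine ⟨hψ.smooth.add hχ.smooth, fun k => ?_⟩
  obtain ⟨C, hC⟩ := hψ.decay k
  obtain ⟨D, hD⟩ := hχ.decay k
  refine ⟨C + D, fun r hr => ?_⟩
  have := norm_add_le (ψ r) (χ r)
  calc r ^ k * ‖ψ r + χ r‖ ≤ r ^ k * (‖ψ r‖ + ‖χ r‖) := by gcongr
    _ ≤ _ := by rw [mul_add]; exact add_le_add (hC r hr) (hD r hr)

lemma finitePart_add (s : ℂ) {ψ χ : ℝ → ℂ} (hψ : IsRapid ψ) (hχ : IsRapid χ) :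
    finitePart s (fun r => ψ r + χ r) = finitePart s ψ + finitePart s χ := by
  obtain ⟨N, hN⟩ := exists_nat_gt (-s.re)
  have hs : -(N : ℝ) < (s + 1).re := by simp; linarith
  have hs' : -(N : ℝ) ≤ s.re := by linarith
  rw [finitePart_eq N hs' hψ, finitePart_eq N hs' hχ, finitePart_eq N hs' (hψ.add hχ)]
  have h1 : regPart N (fun r => ψ r + χ r) = fun r => regPart N ψ r + regPart N χ r := by
    ext r
    by_cases hr : r ∈ Set.Ioc (0 : ℝ) 1
    · simp only [regPart, Set.indicator_of_mem hr, taylorSum, taylorCoeff_add hψ.smooth hχ.smooth,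
        add_mul, Finset.sum_add_distrib]
      ring
    · simp only [regPart, Set.indicator_of_notMem hr]
      ring
  have h2 : poleSum N s (fun r => ψ r + χ r) = poleSum N s ψ + poleSum N s χ := by
    simp only [poleSum, taylorCoeff_add hψ.smooth hχ.smooth]
    rw [← Finset.sum_add_distrib]
    refine Finset.sum_congr rfl fun j _ => ?_
    split_ifs
    · simp
    · ring
  rw [h1, h2, (hasMellin_add (mellinConvergent_regPart N hψ hs)
    (mellinConvergent_regPart N hχ hs)).2]
  ring

lemma finitePart_of_eventuallyEq_zero (s : ℂ) {ψ : ℝ → ℂ} (hψ : IsRapid ψ)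
    (h0 : ∀ᶠ r in 𝓝 (0 : ℝ), ψ r = 0) : finitePart s ψ = mellin ψ (s + 1) := by
  obtain ⟨N, hN⟩ := exists_nat_gt (-s.re)
  have h1 : ∀ j, taylorCoeff ψ j = 0 := by
    intro j
    have : ψ =ᶠ[𝓝 0] fun _ => 0 := h0
    rw [taylorCoeff, this.iteratedDeriv_eq]
    simp
  rw [finitePart_eq N (by linarith) hψ]
  have h2 : regPart N ψ = ψ := by
    ext r
    simp [regPart, Set.indicator_apply, taylorSum, h1]
  simp [h2, poleSum, h1]

/-- Finitely many derivatives on `[0,1]` and one decay rate at infinity control the finite part,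
which makes it a tempered distribution after spherical integration. -/
lemma exists_bound_finitePart (s : ℂ) : ∃ (N K : ℕ) (C : ℝ), 0 ≤ C ∧
    ∀ (ψ : ℝ → ℂ), ContDiff ℝ ∞ ψ → ∀ B : ℝ,
      (∀ j ≤ N, ∀ r ∈ Set.Icc (0 : ℝ) 1, ‖iteratedDeriv j ψ r‖ ≤ B) →
      (∀ r, 1 ≤ r → r ^ K * ‖ψ r‖ ≤ B) → ‖finitePart s ψ‖ ≤ C * B := by
  set N := ⌈-s.re⌉₊ with hN
  have hle : -s.re ≤ N := Nat.le_ceil _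
  -- This decay order makes `r^(Re s - K)` integrable on `(1,∞)`.
  obtain ⟨K, hK⟩ := exists_nat_gt (s.re + 1)
  set I₁ := ∫ r in Set.Ioc (0 : ℝ) 1, r ^ (s.re + N) with hI₁
  set I₂ := ∫ r in Set.Ioi (1 : ℝ), r ^ (s.re - K) with hI₂
  have hi₁ : IntegrableOn (fun r : ℝ => r ^ (s.re + N)) (Set.Ioc 0 1) := by
    have := intervalIntegral.intervalIntegrable_rpow' (a := 0) (b := 1) (r := s.re + N)
      (by linarith)
    rwa [intervalIntegrable_iff_integrableOn_Ioc_of_le zero_le_one] at this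
  have hi₂ : IntegrableOn (fun r : ℝ => r ^ (s.re - K)) (Set.Ioi 1) :=
    integrableOn_Ioi_rpow_of_lt (by linarith) one_pos
  have hI₁0 : 0 ≤ I₁ := setIntegral_nonneg measurableSet_Ioc fun r hr => Real.rpow_nonneg hr.1.le _
  have hI₂0 : 0 ≤ I₂ := setIntegral_nonneg measurableSet_Ioi fun r hr =>
    Real.rpow_nonneg (zero_le_one.trans (le_of_lt hr)) _
  set S := ∑ j ∈ Finset.range N, ‖1 / (s + j + 1)‖
  have hS : 0 ≤ S := Finset.sum_nonneg fun _ _ => norm_nonneg _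
  refine ⟨N, K, I₁ + I₂ + S, by positivity, fun ψ hψ B hB hBK => ?_⟩
  have hB0 : 0 ≤ B := (norm_nonneg _).trans (hB 0 (Nat.zero_le _) 0 (by simp))
  rw [finitePart, ← hN]
  refine (norm_add₃_le).trans ?_
  rw [add_mul, add_mul]
  refine add_le_add (add_le_add ?_ ?_) ?_
  · rw [hI₁, ← integral_mul_const]
    refine norm_integral_le_of_norm_le (hi₁.mul_const B)
      ((ae_restrict_iff' measurableSet_Ioc).2 (ae_of_all _ fun r hr => ?_))
    rw [norm_mul, Complex.norm_cpow_eq_rpow_re_of_pos hr.1, Real.rpow_add hr.1, Real.rpow_natCast,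
      mul_assoc]
    have := norm_sub_taylorSum_le N hψ (hB N le_rfl) ⟨hr.1.le, hr.2⟩
    rw [mul_comm B] at this
    exact mul_le_mul_of_nonneg_left this (Real.rpow_nonneg hr.1.le _)
  · rw [hI₂, ← integral_mul_const]
    refine norm_integral_le_of_norm_le (hi₂.mul_const B)
      ((ae_restrict_iff' measurableSet_Ioi).2 (ae_of_all _ fun r hr => ?_))
    have hr1 : (1 : ℝ) < r := hr
    have hr0 : 0 < r := one_pos.trans hr1
    rw [norm_mul, Complex.norm_cpow_eq_rpow_re_of_pos hr0, Real.rpow_sub hr0, Real.rpow_natCast,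
      div_mul_eq_mul_div, mul_div_assoc]
    refine mul_le_mul_of_nonneg_left ?_ (Real.rpow_nonneg hr0.le _)
    rw [le_div_iff₀ (by positivity), mul_comm]
    exact hBK r hr1.le
  · rw [Finset.sum_mul]
    refine (norm_sum_le _ _).trans (Finset.sum_le_sum fun j hj => ?_)
    split_ifs
    · simp only [norm_zero]
      positivity
    · rw [norm_mul, mul_comm]
      refine mul_le_mul_of_nonneg_left ?_ (norm_nonneg _)
      rw [norm_div, Complex.norm_natCast]
      have h1 : (1 : ℝ) ≤ j.factorial := by exact_mod_cast j.factorial_pos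
      have h2 := hB j (Finset.mem_range.1 hj).le 0 (by simp)
      exact (div_le_self (norm_nonneg _) h1).trans h2

/-! ### Weighted spherical integrals -/

/-- The surface measure of the unit sphere. -/
abbrev sphereMeasure (m : ℕ) : Measure (Metric.sphere (0 : E m) 1) :=
  (volume : Measure (E m)).toSphere

/-- The weighted spherical integral `∫ w(θ) φ(r θ) dS(θ)`. -/
def sphInt (w : E m → ℂ) (φ : 𝓢(E m, ℂ)) (r : ℝ) : ℂ :=
  ∫ θ : Metric.sphere (0 : E m) 1, w θ * φ (r • (θ : E m)) ∂sphereMeasure m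

/-- The `j`-th coordinate function. -/
def coord (j : Fin m) (x : E m) : ℂ := ((x j : ℝ) : ℂ)

lemma contDiff_coord (j : Fin m) : ContDiff ℝ ∞ (coord j) := by
  unfold coord
  exact Complex.ofRealCLM.contDiff.comp (EuclideanSpace.proj (𝕜 := ℝ) j).contDiff

lemma continuous_coord (j : Fin m) : Continuous (coord j) := (contDiff_coord j).continuous

lemma integrable_sphere {f : Metric.sphere (0 : E m) 1 → ℂ} (hf : Continuous f) :
    Integrable f (sphereMeasure m) := by
  have := isCompact_sphere (0 : E m) 1
  have : CompactSpace (Metric.sphere (0 : E m) 1) := isCompact_iff_compactSpace.1 this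
  exact hf.integrable_of_hasCompactSupport (HasCompactSupport.of_compactSpace _)

lemma exists_bound_weight {w : E m → ℂ} (hw : Continuous w) :
    ∃ C : ℝ, 0 ≤ C ∧ ∀ θ : Metric.sphere (0 : E m) 1, ‖w θ‖ ≤ C := by
  obtain ⟨C, hC⟩ := (isCompact_sphere (0 : E m) 1).exists_bound_of_continuousOn hw.continuousOn
  exact ⟨max C 0, le_max_right _ _, fun θ => (hC θ θ.2).trans (le_max_left _ _)⟩

lemma norm_sphInt_le_of_le {w : E m → ℂ} {C B : ℝ} (hC : ∀ θ : Metric.sphere (0 : E m) 1, ‖w θ‖ ≤ C)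
    (hC0 : 0 ≤ C) (φ : 𝓢(E m, ℂ)) (r : ℝ) (hB : ∀ x, ‖x‖ = |r| → ‖φ x‖ ≤ B) :
    ‖sphInt w φ r‖ ≤ C * B * (sphereMeasure m).real Set.univ := by
  refine norm_integral_le_of_norm_le_const (ae_of_all _ fun θ => ?_)
  rw [norm_mul]
  have h1 : ‖(θ : E m)‖ = 1 := by simp
  exact mul_le_mul (hC θ) (hB _ (by rw [norm_smul, h1, mul_one, Real.norm_eq_abs]))
    (norm_nonneg _) hC0

/-- The radial derivative of `φ(rθ)` is `∑ θ_j (∂_j φ)(rθ)`. It is again a sum of weighted spherical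
integrals, so smoothness and all derivative bounds follow by induction over arbitrary continuous
weights. -/
lemma hasDerivAt_sphInt {w : E m → ℂ} (hw : Continuous w) (φ : 𝓢(E m, ℂ)) (r : ℝ) :
    HasDerivAt (sphInt w φ)
      (∑ j, sphInt (fun x => w x * coord j x) (∂_{basisVec j} φ) r) r := by
  obtain ⟨C, hC0, hC⟩ := exists_bound_weight hw
  have hd : ∀ (θ : Metric.sphere (0 : E m) 1) (x : ℝ),
      HasDerivAt (fun x : ℝ => w θ * φ (x • (θ : E m)))
        (w θ * (fderiv ℝ φ (x • (θ : E m)) θ)) x := by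
    intro θ x
    have h1 : HasDerivAt (fun x : ℝ => x • (θ : E m)) (θ : E m) x := by
      simpa using (hasDerivAt_id x).smul_const (θ : E m)
    exact ((φ.differentiableAt.hasFDerivAt).comp_hasDerivAt x h1).const_mul _
  have hcont : ∀ (x : ℝ), Continuous fun θ : Metric.sphere (0 : E m) 1 =>
      w θ * φ (x • (θ : E m)) := fun x =>
    (hw.comp continuous_subtype_val).mul
      (φ.continuous.comp (continuous_subtype_val.const_smul x))
  have hfc : Continuous (fderiv ℝ φ) := (φ.smooth 1).continuous_fderiv (by norm_num)
  have hcont' : Continuous fun θ : Metric.sphere (0 : E m) 1 =>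
      w θ * (fderiv ℝ φ (r • (θ : E m)) θ) :=
    (hw.comp continuous_subtype_val).mul
      ((hfc.comp (continuous_subtype_val.const_smul r)).clm_apply continuous_subtype_val)
  have key := hasDerivAt_integral_of_dominated_loc_of_deriv_le (μ := sphereMeasure m)
    (F := fun (x : ℝ) (θ : Metric.sphere (0 : E m) 1) => w θ * φ (x • (θ : E m)))
    (F' := fun (x : ℝ) (θ : Metric.sphere (0 : E m) 1) => w θ * (fderiv ℝ φ (x • (θ : E m)) θ))
    (x₀ := r) (s := Set.univ) (bound := fun _ => C * (2 ^ 1 * schwartzSup 1 φ)) Filter.univ_mem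
    (Eventually.of_forall fun x => (hcont x).aestronglyMeasurable)
    (integrable_sphere (hcont r)) hcont'.aestronglyMeasurable
    (ae_of_all _ fun θ x _ => by
      rw [norm_mul]
      refine mul_le_mul (hC θ) ?_ (norm_nonneg _) hC0
      refine (ContinuousLinearMap.le_opNorm _ _).trans ?_
      have h1 : ‖(θ : E m)‖ = 1 := by simp
      rw [h1, mul_one, ← norm_iteratedFDeriv_one]
      exact norm_iteratedFDeriv_le_schwartzSup le_rfl φ _)
    (integrable_const _) (ae_of_all _ fun θ x _ => hd θ x)
  have hsum : ∑ j, sphInt (fun x => w x * coord j x) (∂_{basisVec j} φ) r =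
      ∫ θ : Metric.sphere (0 : E m) 1, w θ * (fderiv ℝ φ (r • (θ : E m)) θ) ∂sphereMeasure m := by
    unfold sphInt
    rw [← integral_finsetSum]
    · refine integral_congr_ae (ae_of_all _ fun θ => ?_)
      have h2 := congrArg (fun ψ : 𝓢(E m, ℂ) => ψ (r • (θ : E m))) (lineDeriv_eq_sum φ (θ : E m))
      simp only [SchwartzMap.lineDerivOp_apply_eq_fderiv, sum_apply, smul_apply] at h2
      simp only [h2, Finset.mul_sum, coord, SchwartzMap.lineDerivOp_apply_eq_fderiv, smul_eq_mul,
        mul_assoc]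
    · intro j _
      exact integrable_sphere (((hw.mul (continuous_coord j)).comp continuous_subtype_val).mul
        ((∂_{basisVec j} φ).continuous.comp (continuous_subtype_val.const_smul r)))
  rw [hsum]
  exact key.2

lemma deriv_sphInt {w : E m → ℂ} (hw : Continuous w) (φ : 𝓢(E m, ℂ)) :
    deriv (sphInt w φ) =
      fun r => ∑ j, sphInt (fun x => w x * coord j x) (∂_{basisVec j} φ) r :=
  funext fun r => (hasDerivAt_sphInt hw φ r).deriv

lemma contDiff_sphInt {w : E m → ℂ} (hw : Continuous w) (φ : 𝓢(E m, ℂ)) :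
    ContDiff ℝ ∞ (sphInt w φ) := by
  rw [contDiff_infty]
  intro n
  induction n generalizing w φ with
  | zero =>
    have hd : Differentiable ℝ (sphInt w φ) :=
      fun r => (hasDerivAt_sphInt hw φ r).differentiableAt
    exact contDiff_zero.2 hd.continuous
  | succ n ih =>
    rw [Nat.cast_succ, contDiff_succ_iff_deriv]
    refine ⟨fun r => (hasDerivAt_sphInt hw φ r).differentiableAt, by simp, ?_⟩
    rw [deriv_sphInt hw]
    exact ContDiff.sum fun j _ => ih (hw.mul (continuous_coord j)) _

lemma exists_bound_iteratedDeriv_sphInt {w : E m → ℂ} (hw : Continuous w) (n : ℕ) :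
    ∃ (N : ℕ) (C : ℝ), 0 ≤ C ∧ ∀ φ r, ‖iteratedDeriv n (sphInt w φ) r‖ ≤ C * schwartzSup N φ := by
  induction n generalizing w with
  | zero =>
    obtain ⟨C, hC0, hC⟩ := exists_bound_weight hw
    refine ⟨0, C * (sphereMeasure m).real Set.univ, by positivity, fun φ r => ?_⟩
    rw [iteratedDeriv_zero]
    refine (norm_sphInt_le_of_le hC hC0 φ r (B := schwartzSup 0 φ) fun x _ => ?_).trans
      (le_of_eq (by ring))
    simpa using pow_mul_norm_le_schwartzSup 0 φ x
  | succ n ih =>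
    choose N C hC0 hC using fun j : Fin m => ih (hw.mul (continuous_coord j))
    choose M D hD hM using fun j : Fin m =>
      exists_bound_clm (LineDeriv.lineDerivOpCLM ℂ 𝓢(E m, ℂ) (basisVec j)) (N j)
    refine ⟨Finset.univ.sup M, ∑ j, C j * D j,
      Finset.sum_nonneg fun j _ => mul_nonneg (hC0 j) (hD j), fun φ r => ?_⟩
    have hcd : ∀ j : Fin m, ContDiff ℝ ∞
        (sphInt (fun x => w x * coord j x) (∂_{basisVec j} φ)) := fun j =>
      contDiff_sphInt (hw.mul (continuous_coord j)) _
    rw [iteratedDeriv_succ', deriv_sphInt hw,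
      iteratedDeriv_fun_sum fun j _ => (contDiff_infty.1 (hcd j) n).contDiffAt, Finset.sum_mul]
    refine (norm_sum_le _ _).trans (Finset.sum_le_sum fun j _ => ?_)
    refine (hC j _ r).trans ?_
    have h1 : schwartzSup (N j) (∂_{basisVec j} φ) ≤ D j * schwartzSup (M j) φ := hM j φ
    have h2 := schwartzSup_mono (Finset.le_sup (f := M) (Finset.mem_univ j)) φ
    rw [mul_assoc]
    exact mul_le_mul_of_nonneg_left (h1.trans (mul_le_mul_of_nonneg_left h2 (hD j))) (hC0 j)

lemma exists_decay_sphInt {w : E m → ℂ} (hw : Continuous w) (k : ℕ) :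
    ∃ C : ℝ, 0 ≤ C ∧ ∀ φ r, 1 ≤ r → r ^ k * ‖sphInt w φ r‖ ≤ C * schwartzSup k φ := by
  obtain ⟨C, hC0, hC⟩ := exists_bound_weight hw
  refine ⟨C * 2 ^ k * (sphereMeasure m).real Set.univ, by positivity, fun φ r hr => ?_⟩
  have hr0 : 0 < r := by linarith
  have h1 := norm_sphInt_le_of_le hC hC0 φ r (B := 2 ^ k * schwartzSup k φ / r ^ k) fun x hx => by
    rw [le_div_iff₀ (by positivity), mul_comm]
    refine le_trans ?_ (pow_mul_norm_le_schwartzSup k φ x)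
    rw [hx, abs_of_pos hr0]
    gcongr
    linarith
  calc r ^ k * ‖sphInt w φ r‖
      ≤ r ^ k * (C * (2 ^ k * schwartzSup k φ / r ^ k) * (sphereMeasure m).real Set.univ) := by
        gcongr
    _ = _ := by field_simp

lemma isRapid_sphInt {w : E m → ℂ} (hw : Continuous w) (φ : 𝓢(E m, ℂ)) : IsRapid (sphInt w φ) := by
  refine ⟨contDiff_sphInt hw φ, fun k => ?_⟩
  obtain ⟨C, -, hC⟩ := exists_decay_sphInt hw k
  exact ⟨_, fun r hr => hC φ r hr⟩

lemma sphInt_add {w : E m → ℂ} (hw : Continuous w) (φ ψ : 𝓢(E m, ℂ)) (r : ℝ) :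
    sphInt w (φ + ψ) r = sphInt w φ r + sphInt w ψ r := by
  unfold sphInt
  rw [← integral_add]
  · simp [mul_add]
  all_goals
    exact integrable_sphere ((hw.comp continuous_subtype_val).mul
      ((SchwartzMap.continuous _).comp (continuous_subtype_val.const_smul r)))

lemma sphInt_smul (w : E m → ℂ) (c : ℂ) (φ : 𝓢(E m, ℂ)) (r : ℝ) :
    sphInt w (c • φ) r = c * sphInt w φ r := by
  unfold sphInt
  rw [← integral_const_mul]
  congr 1
  ext θ
  simp
  ring

/-! ### Finite-part distributions, their poles and analytic continuation -/

/-- The distribution `Fp r^l w(θ)`, unnormalized. -/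
def fpDist (w : E m → ℂ) (hw : Continuous w) (l : ℂ) : 𝓢'(E m, ℂ) :=
  distributionOfBound (fun φ => finitePart (l + m - 1) (sphInt w φ))
    (fun φ ψ => by
      have : sphInt w (φ + ψ) = fun r => sphInt w φ r + sphInt w ψ r :=
        funext (sphInt_add hw φ ψ)
      rw [this, finitePart_add _ (isRapid_sphInt hw φ) (isRapid_sphInt hw ψ)])
    (fun c φ => by
      have : sphInt w (c • φ) = fun r => c * sphInt w φ r := funext (sphInt_smul w c φ)
      rw [this, finitePart_const_mul])
    (by
      obtain ⟨N, K, C, hC, h⟩ := exists_bound_finitePart (l + m - 1)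
      choose M D hD hM using exists_bound_iteratedDeriv_sphInt hw
      obtain ⟨A, hA, hdec⟩ := exists_decay_sphInt hw K
      set R := max K ((Finset.range (N + 1)).sup M)
      set G := A + ∑ n ∈ Finset.range (N + 1), D n
      have hS : 0 ≤ ∑ n ∈ Finset.range (N + 1), D n := Finset.sum_nonneg fun n _ => hD n
      refine ⟨R, C * G, by positivity, fun φ => ?_⟩
      rw [mul_assoc]
      refine h _ (contDiff_sphInt hw φ) _ (fun j hj r _ => ?_) (fun r hr => ?_)
      · have hj' : j ∈ Finset.range (N + 1) := Finset.mem_range.2 (by omega)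
        have h1 : M j ≤ R := (Finset.le_sup hj').trans (le_max_right _ _)
        have h2 : D j ≤ G := (Finset.single_le_sum (fun n _ => hD n) hj').trans (by simp [G, hA])
        refine (hM j φ r).trans (mul_le_mul h2 (schwartzSup_mono h1 φ) (schwartzSup_nonneg _ _) ?_)
        positivity
      · refine (hdec φ r hr).trans (mul_le_mul ?_ (schwartzSup_mono (le_max_left _ _) φ)
          (schwartzSup_nonneg _ _) (by positivity))
        simp [G, hS])

@[simp] lemma fpDist_apply (w : E m → ℂ) (hw : Continuous w) (l : ℂ) (φ : 𝓢(E m, ℂ)) :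
    fpDist w hw l φ = finitePart (l + m - 1) (sphInt w φ) := rfl

open scoped Pointwise in
-- The surface measure of a set is a multiple of the Lebesgue measure of the cone over it, and
-- Lebesgue measure is invariant under `x ↦ -x`.
lemma sphereMeasure_neg :
    MeasurePreserving (fun θ : Metric.sphere (0 : E m) 1 => -θ) (sphereMeasure m)
      (sphereMeasure m) := by
  have hmeas : Measurable (fun θ : Metric.sphere (0 : E m) 1 => -θ) := continuous_neg.measurable
  refine ⟨hmeas, ?_⟩
  ext s hs
  rw [Measure.map_apply hmeas hs, Measure.toSphere_apply' _ (hmeas hs), Measure.toSphere_apply' _ hs]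
  congr 1
  have hset : Set.Ioo (0 : ℝ) 1 • ((↑) '' ((fun θ : Metric.sphere (0 : E m) 1 => -θ) ⁻¹' s) :
      Set (E m)) = Neg.neg ⁻¹' (Set.Ioo (0 : ℝ) 1 • ((↑) '' s : Set (E m))) := by
    ext x
    simp only [Set.mem_smul, Set.mem_image, Set.mem_preimage]
    constructor
    · rintro ⟨a, ha, y, ⟨θ, hθ, rfl⟩, rfl⟩
      exact ⟨a, ha, -θ, ⟨-θ, hθ, by simp⟩, by simp⟩
    · rintro ⟨a, ha, y, ⟨θ, hθ, rfl⟩, h⟩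
      exact ⟨a, ha, -θ, ⟨-θ, by simpa using hθ, by simp⟩, by rw [smul_neg, h, neg_neg]⟩
  rw [hset]
  exact (Measure.measurePreserving_neg volume).measure_preimage_equiv (f := MeasurableEquiv.neg _) _

lemma sphInt_neg {w : E m → ℂ} {c : ℂ} (hw : ∀ x, w (-x) = c * w x) (φ : 𝓢(E m, ℂ)) (r : ℝ) :
    sphInt w φ (-r) = c * sphInt w φ r := by
  unfold sphInt
  rw [← (sphereMeasure_neg (m := m)).integral_comp
    (Homeomorph.neg _).measurableEmbedding, ← integral_const_mul]
  congr 1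
  ext θ
  simp [hw]
  ring

/-- A homogeneous polynomial weight of degree `κ ≤ 1`. -/
structure IsWeight (κ : ℕ) (h : E m → ℂ) : Prop where
  le_one : κ ≤ 1
  contDiff : ContDiff ℝ ∞ h
  map_smul : ∀ (r : ℝ) x, h (r • x) = (r : ℂ) ^ κ * h x
  norm_le : ∀ x, ‖h x‖ ≤ ‖x‖ ^ κ

lemma IsWeight.continuous {κ : ℕ} {h : E m → ℂ} (hh : IsWeight κ h) : Continuous h :=
  hh.contDiff.continuous

lemma isWeight_one : IsWeight 0 (fun _ : E m => (1 : ℂ)) :=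
  ⟨zero_le_one, contDiff_const, by simp, by simp⟩

lemma isWeight_coord (j : Fin m) : IsWeight 1 (coord j) :=
  ⟨le_rfl, contDiff_coord j, by simp [coord], fun x => by
    rw [coord, Complex.norm_real, pow_one]
    exact PiLp.norm_apply_le x j⟩

/-- The antipodal map gives the spherical integral the parity of `κ` in `r`, so Taylor coefficients
of the opposite parity vanish. Half of the poles of the finite part disappear for this reason. -/
lemma iteratedDeriv_sphInt_eq_zero {κ : ℕ} {h : E m → ℂ} (hh : IsWeight κ h) (φ : 𝓢(E m, ℂ))
    {j : ℕ} (hj : Odd (j + κ)) : iteratedDeriv j (sphInt h φ) 0 = 0 := by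
  have h1 : (fun r => sphInt h φ (-r)) = fun r => (-1 : ℂ) ^ κ * sphInt h φ r := by
    ext r
    exact sphInt_neg (fun x => by simpa using hh.map_smul (-1) x) φ r
  have h2 := iteratedDeriv_comp_neg j (sphInt h φ) 0
  rw [h1, iteratedDeriv_const_mul_field, neg_zero] at h2
  have h3 : ((-1 : ℂ)) ^ j * (-1) ^ κ = -1 := by rw [← pow_add, hj.neg_one_pow]
  have h4 : ((-1 : ℂ)) ^ j * (-1) ^ j = 1 := by rw [← pow_add, Even.neg_one_pow ⟨j, rfl⟩]
  have h5 : ((-1 : ℝ) ^ j • iteratedDeriv j (sphInt h φ) 0 : ℂ)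
      = (-1 : ℂ) ^ j * iteratedDeriv j (sphInt h φ) 0 := by
    rw [Complex.real_smul]; push_cast; ring
  rw [h5] at h2
  linear_combination (-1 / 2 : ℂ) * ((-1) ^ j * h2) + (1 / 2) * iteratedDeriv j (sphInt h φ) 0 * h3
    - (1 / 2) * iteratedDeriv j (sphInt h φ) 0 * h4

/-- The exponents at which the finite part has no pole. -/
def regularSet (m κ : ℕ) : Set ℂ := {l | ∀ n : ℕ, (l + m + κ) / 2 ≠ -n}

/-- A pole at `l = -m - j` survives only for `j` of the parity of `κ`. As `κ ≤ 1`, such a `j` is `κ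
+ 2n`, and these exponents are the ones left out of `regularSet`. -/
lemma differentiableAt_fpDist {κ : ℕ} {h : E m → ℂ} (hh : IsWeight κ h) (φ : 𝓢(E m, ℂ)) {l : ℂ}
    (hl : l ∈ regularSet m κ) : DifferentiableAt ℂ (fun l => fpDist h hh.continuous l φ) l := by
  have h1 : DifferentiableAt ℂ (fun s => finitePart s (sphInt h φ)) (l + m - 1) := by
    refine differentiableAt_finitePart (isRapid_sphInt hh.continuous φ) fun j hj => ?_
    refine iteratedDeriv_sphInt_eq_zero hh φ ?_
    by_contra hodd
    rw [Nat.not_odd_iff_even] at hodd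
    obtain ⟨n, hn⟩ : ∃ n, j = κ + 2 * n := by
      obtain ⟨q, hq⟩ := hodd
      have := hh.le_one
      exact ⟨q - κ, by omega⟩
    refine hl n ?_
    have h2 : (l + m : ℂ) = -((κ + 2 * n : ℕ) : ℂ) := by
      rw [← hn]; linear_combination hj
    push_cast at h2
    linear_combination (1 / 2) * h2
  exact h1.comp (f := fun l : ℂ => l + m - 1) l (by fun_prop)

lemma countable_compl_regularSet (m κ : ℕ) : (regularSet m κ)ᶜ.Countable := by
  have : (regularSet m κ)ᶜ ⊆ Set.range fun n : ℕ => (-2 * n - m - κ : ℂ) := by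
    intro l hl
    simp only [regularSet, Set.mem_compl_iff, Set.mem_ofPred_eq, not_forall, not_not] at hl
    obtain ⟨n, hn⟩ := hl
    exact ⟨n, by simp only; linear_combination (-2 : ℂ) * hn⟩
  exact (Set.countable_range _).mono this

lemma isPreconnected_regularSet (m κ : ℕ) : IsPreconnected (regularSet m κ) := by
  have := ((countable_compl_regularSet m κ).isConnected_compl_of_one_lt_rank
    (by rw [Complex.rank_real_complex]; norm_num)).isPreconnected
  rwa [compl_compl] at this

/-- The excluded points are the zeros of the entire function `1/Γ((l+m+κ)/2)`. -/
lemma isOpen_regularSet (m κ : ℕ) : IsOpen (regularSet m κ) := by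
  have h1 : regularSet m κ = {l | (Complex.Gamma ((l + m + κ) / 2))⁻¹ ≠ 0} := by
    ext l
    simp only [regularSet, Set.mem_ofPred_eq, ne_eq, inv_eq_zero, Complex.Gamma_eq_zero_iff,
      not_exists]
  rw [h1]
  have h2 : Continuous fun l : ℂ => (Complex.Gamma ((l + m + κ) / 2))⁻¹ :=
    Complex.differentiable_one_div_Gamma.continuous.comp (by fun_prop)
  exact isOpen_ne_fun h2 continuous_const

lemma mem_regularSet_of_re {κ : ℕ} {l : ℂ} (hl : -(m : ℝ) < l.re) : l ∈ regularSet m κ := by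
  intro n hn
  have h1 : l = -(2 * n : ℕ) - m - (κ : ℕ) := by push_cast; linear_combination (2 : ℂ) * hn
  have := congrArg Complex.re h1
  simp only [Complex.sub_re, Complex.neg_re, Complex.natCast_re] at this
  have h2 : (0 : ℝ) ≤ (2 * n : ℕ) := Nat.cast_nonneg _
  have h3 : (0 : ℝ) ≤ κ := Nat.cast_nonneg _
  linarith

/-- Analytic continuation from the strip `-m < Re l < 0`. -/
lemma eq_of_eq_on_strip (hm : 1 ≤ m) {κ : ℕ} {F G : ℂ → ℂ}
    (hF : ∀ l ∈ regularSet m κ, DifferentiableAt ℂ F l)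
    (hG : ∀ l ∈ regularSet m κ, DifferentiableAt ℂ G l)
    (hFG : ∀ l : ℂ, -(m : ℝ) < l.re → l.re < 0 → F l = G l) {l : ℂ} (hl : l ∈ regularSet m κ) :
    F l = G l := by
  have hm' : (1 : ℝ) ≤ m := by exact_mod_cast hm
  have ho := isOpen_regularSet m κ
  have hF' : AnalyticOnNhd ℂ F (regularSet m κ) :=
    DifferentiableOn.analyticOnNhd (fun l hl => (hF l hl).differentiableWithinAt) ho
  have hG' : AnalyticOnNhd ℂ G (regularSet m κ) :=
    DifferentiableOn.analyticOnNhd (fun l hl => (hG l hl).differentiableWithinAt) ho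
  -- The base point `-1/2` lies in the strip for every `m ≥ 1`.
  have hz : ((-1 / 2 : ℝ) : ℂ) ∈ regularSet m κ :=
    mem_regularSet_of_re (by rw [Complex.ofReal_re]; linarith)
  refine hF'.eqOn_of_preconnected_of_eventuallyEq hG' (isPreconnected_regularSet m κ) hz ?_ hl
  have h1 : ∀ᶠ z : ℂ in 𝓝 ((-1 / 2 : ℝ) : ℂ), -(m : ℝ) < z.re :=
    Complex.continuous_re.continuousAt.eventually (lt_mem_nhds (by rw [Complex.ofReal_re]; linarith))
  have h2 : ∀ᶠ z : ℂ in 𝓝 ((-1 / 2 : ℝ) : ℂ), z.re < 0 :=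
    Complex.continuous_re.continuousAt.eventually (gt_mem_nhds (by rw [Complex.ofReal_re]; norm_num))
  filter_upwards [h1, h2] with z hz1 hz2 using hFG z hz1 hz2

lemma sphInt_dilate (w : E m → ℂ) (c : ℝ) (hc : 0 < c) (φ : 𝓢(E m, ℂ)) (r : ℝ) :
    sphInt w (dilate c hc φ) r = sphInt w φ (c * r) := by
  simp [sphInt, smul_smul]

/-- In the strip the finite part is a convergent Mellin integral, and scaling `r` gives the factor.
The identity persists under continuation as long as the poles are avoided. -/
lemma fpDist_dilate (hm : 1 ≤ m) {κ : ℕ} {h : E m → ℂ} (hh : IsWeight κ h) (c : ℝ) (hc : 0 < c)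
    (φ : 𝓢(E m, ℂ)) {l : ℂ} (hl : l ∈ regularSet m κ) :
    fpDist h hh.continuous l (dilate c hc φ) = (c : ℂ) ^ (-m - l) * fpDist h hh.continuous l φ := by
  have hc' : (c : ℂ) ≠ 0 := by exact_mod_cast hc.ne'
  refine eq_of_eq_on_strip hm (F := fun l => fpDist h hh.continuous l (dilate c hc φ))
    (G := fun l => (c : ℂ) ^ (-m - l) * fpDist h hh.continuous l φ)
    (fun l hl => differentiableAt_fpDist hh _ hl) (fun l hl => ?_) (fun l h1 h2 => ?_) hl
  · refine DifferentiableAt.mul ?_ (differentiableAt_fpDist hh _ hl)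
    exact (by fun_prop : DifferentiableAt ℂ (fun l : ℂ => -m - l) l).const_cpow (Or.inl hc')
  · have hre : -1 < (l + m - 1).re := by simp; linarith
    simp only [fpDist_apply]
    rw [finitePart_of_neg_one_lt hre (isRapid_sphInt hh.continuous _),
      finitePart_of_neg_one_lt hre (isRapid_sphInt hh.continuous _)]
    have : sphInt h (dilate c hc φ) = fun r => sphInt h φ (c * r) :=
      funext (sphInt_dilate h c hc φ)
    rw [this, mellin_comp_mul_left _ _ hc, smul_eq_mul]
    congr 2
    ring

/-! ### Polar coordinates and homogeneous functions -/

section Polar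

lemma norm_cpow_ofReal_le {r : ℝ} (hr : 0 < r) (s : ℂ) : ‖(r : ℂ) ^ s‖ = r ^ s.re :=
  Complex.norm_cpow_eq_rpow_re_of_pos hr s

/-- Integration in polar coordinates. -/
lemma integral_polar (hm : 1 ≤ m) {f : E m → ℂ} (hf : Integrable f) :
    ∫ x, f x = ∫ r in Set.Ioi (0 : ℝ), (r : ℂ) ^ (m - 1) *
      ∫ θ : Metric.sphere (0 : E m) 1, f (r • (θ : E m)) ∂sphereMeasure m := by
  have : Nontrivial (E m) := by
    have : Nonempty (Fin m) := ⟨⟨0, hm⟩⟩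
    infer_instance
  have hmp := (volume : Measure (E m)).measurePreserving_homeomorphUnitSphereProd
  have hemb := (homeomorphUnitSphereProd (E m)).measurableEmbedding
  set g : Metric.sphere (0 : E m) 1 × Set.Ioi (0 : ℝ) → ℂ := fun p => f ((p.2 : ℝ) • (p.1 : E m))
    with hg
  have hcomp : ∀ x : ({0}ᶜ : Set (E m)), g (homeomorphUnitSphereProd (E m) x) = f x := by
    intro x
    have hx : ‖(x : E m)‖ ≠ 0 := norm_ne_zero_iff.2 x.2
    simp [hg, smul_smul, hx]
  have hfi : Integrable (fun x : ({0}ᶜ : Set (E m)) => f x)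
      (Measure.comap (↑) (volume : Measure (E m))) := by
    have := (integrableOn_iff_comap_subtypeVal (μ := (volume : Measure (E m))) (f := f)
      (measurableSet_singleton (0 : E m)).compl).1 hf.integrableOn
    exact this
  have hgi : Integrable g ((sphereMeasure m).prod
      (Measure.volumeIoiPow (Module.finrank ℝ (E m) - 1))) := by
    rw [← hmp.integrable_comp_emb hemb]
    exact hfi.congr (ae_of_all _ fun x => (hcomp x).symm)
  calc ∫ x, f x = ∫ x : ({0}ᶜ : Set (E m)), f x ∂(Measure.comap (↑) (volume : Measure (E m))) := by
        rw [integral_subtype_comap (measurableSet_singleton _).compl f, restrict_compl_singleton]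
    _ = ∫ p, g p ∂((sphereMeasure m).prod
          (Measure.volumeIoiPow (Module.finrank ℝ (E m) - 1))) := by
        rw [← hmp.integral_comp hemb]
        exact integral_congr_ae (ae_of_all _ fun x => (hcomp x).symm)
    _ = ∫ r : Set.Ioi (0 : ℝ), (∫ θ : Metric.sphere (0 : E m) 1, f ((r : ℝ) • (θ : E m))
          ∂sphereMeasure m) ∂(Measure.volumeIoiPow (Module.finrank ℝ (E m) - 1)) :=
        integral_prod_symm _ hgi
    _ = _ := by
        simp only [Measure.volumeIoiPow, ENNReal.ofReal, finrank_euclideanSpace_fin]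
        rw [integral_withDensity_eq_integral_smul
            ((measurable_subtype_coe.pow_const _).real_toNNReal),
          integral_subtype_comap measurableSet_Ioi fun a : ℝ => Real.toNNReal (a ^ (m - 1)) •
            ∫ θ : Metric.sphere (0 : E m) 1, f (a • (θ : E m)) ∂sphereMeasure m]
        refine setIntegral_congr_fun measurableSet_Ioi fun x hx => ?_
        rw [NNReal.smul_def, Real.coe_toNNReal _ (pow_nonneg (le_of_lt hx) _), Complex.real_smul]
        push_cast
        rfl

/-- The homogeneous function `|x|^(l-κ) h(x)` of degree `l`. -/
def homKernel (κ : ℕ) (h : E m → ℂ) (l : ℂ) (x : E m) : ℂ := ((‖x‖ : ℝ) : ℂ) ^ (l - κ) * h x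

lemma measurable_homKernel {κ : ℕ} {h : E m → ℂ} (hh : IsWeight κ h) (l : ℂ) :
    Measurable (homKernel κ h l) := by
  have h1 : Measurable fun x : E m => ((‖x‖ : ℝ) : ℂ) := by fun_prop
  exact (h1.pow_const _).mul hh.continuous.measurable

lemma norm_homKernel_le {κ : ℕ} {h : E m → ℂ} (hh : IsWeight κ h) (l : ℂ) {x : E m} (hx : x ≠ 0) :
    ‖homKernel κ h l x‖ ≤ ‖x‖ ^ l.re := by
  have hx' : 0 < ‖x‖ := norm_pos_iff.2 hx
  rw [homKernel, norm_mul, norm_cpow_ofReal_le hx']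
  refine (mul_le_mul_of_nonneg_left (hh.norm_le x) (Real.rpow_nonneg hx'.le _)).trans ?_
  rw [← Real.rpow_natCast, ← Real.rpow_add hx']
  simp

lemma homKernel_smul {κ : ℕ} {h : E m → ℂ} (hh : IsWeight κ h) (l : ℂ) {r : ℝ} (hr : 0 < r)
    (x : E m) : homKernel κ h l (r • x) = (r : ℂ) ^ l * homKernel κ h l x := by
  have hr' : (r : ℂ) ≠ 0 := by exact_mod_cast hr.ne'
  rw [homKernel, homKernel, norm_smul, Real.norm_of_nonneg hr.le, hh.map_smul, Complex.ofReal_mul,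
    Complex.mul_cpow_ofReal_nonneg hr.le (norm_nonneg x), Complex.cpow_sub _ _ hr',
    Complex.cpow_natCast]
  field_simp

/-- The Jacobian `r^(m-1)` and the homogeneity factor `r^l` combine to the Mellin weight
`r^((l+m)-1)`. -/
lemma mellin_sphInt_eq (hm : 1 ≤ m) {κ : ℕ} {h : E m → ℂ} (hh : IsWeight κ h) (l : ℂ)
    (φ : 𝓢(E m, ℂ)) (hint : Integrable fun x => homKernel κ h l x * φ x) :
    mellin (sphInt h φ) (l + m) = ∫ x, homKernel κ h l x * φ x := by
  rw [integral_polar hm hint, mellin]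
  refine setIntegral_congr_fun measurableSet_Ioi fun r hr => ?_
  have hr0 : (0 : ℝ) < r := hr
  have hr' : (r : ℂ) ≠ 0 := by exact_mod_cast hr0.ne'
  have h1 : ∀ θ : Metric.sphere (0 : E m) 1,
      homKernel κ h l (r • (θ : E m)) * φ (r • (θ : E m)) =
        (r : ℂ) ^ l * (h θ * φ (r • (θ : E m))) := by
    intro θ
    rw [homKernel_smul hh l hr0, homKernel]
    simp
    ring
  simp only [h1, integral_const_mul, smul_eq_mul]
  rw [sphInt, ← mul_assoc]
  congr 1
  rw [← Complex.cpow_natCast, ← Complex.cpow_add _ _ hr', Nat.cast_sub hm]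
  congr 1
  push_cast
  ring

lemma integrable_norm_rpow_mul (hm : 1 ≤ m) {a : ℝ} (ha : -(m : ℝ) < a) (φ : 𝓢(E m, ℂ)) :
    Integrable fun x : E m => ‖x‖ ^ a * ‖φ x‖ := by
  have hnt : Nontrivial (E m) := by
    have : Nonempty (Fin m) := ⟨⟨0, hm⟩⟩
    infer_instance
  obtain ⟨N, hN⟩ := exists_nat_gt (m + a)
  have hmc : ((m - 1 : ℕ) : ℝ) = m - 1 := by rw [Nat.cast_sub hm]; simp
  have h1 : Integrable (fun x : E m => (fun r : ℝ => r ^ a * (1 + r) ^ (-(N : ℝ))) ‖x‖) := by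
    rw [integrable_fun_norm_addHaar (volume : Measure (E m))
        (f := fun r : ℝ => r ^ a * (1 + r) ^ (-(N : ℝ))), finrank_euclideanSpace_fin,
      ← Set.Ioc_union_Ioi_eq_Ioi (zero_le_one (α := ℝ)), integrableOn_union]
    have hmeas : Measurable fun y : ℝ => y ^ (m - 1) • (y ^ a * (1 + y) ^ (-(N : ℝ))) := by
      fun_prop
    constructor
    · have hi : IntegrableOn (fun r : ℝ => r ^ (m - 1 + a)) (Set.Ioc 0 1) := by
        have := intervalIntegral.intervalIntegrable_rpow' (a := 0) (b := 1) (r := m - 1 + a)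
          (by linarith)
        rwa [intervalIntegrable_iff_integrableOn_Ioc_of_le zero_le_one] at this
      refine hi.mono' hmeas.aestronglyMeasurable
        ((ae_restrict_iff' measurableSet_Ioc).2 (ae_of_all _ fun r hr => ?_))
      have hr0 := hr.1
      rw [Real.norm_of_nonneg (by positivity), Real.rpow_add hr0, ← hmc, Real.rpow_natCast,
        smul_eq_mul]
      refine mul_le_mul_of_nonneg_left ?_ (by positivity)
      refine mul_le_of_le_one_right (by positivity) ?_
      exact Real.rpow_le_one_of_one_le_of_nonpos (by linarith) (by simp)
    · have hi : IntegrableOn (fun r : ℝ => r ^ (m - 1 + a - N)) (Set.Ioi 1) :=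
        integrableOn_Ioi_rpow_of_lt (by linarith) one_pos
      refine hi.mono' hmeas.aestronglyMeasurable
        ((ae_restrict_iff' measurableSet_Ioi).2 (ae_of_all _ fun r hr => ?_))
      have hr0 : 0 < r := one_pos.trans hr
      rw [Real.norm_of_nonneg (by positivity), sub_eq_add_neg, Real.rpow_add hr0, Real.rpow_add hr0,
        ← hmc, Real.rpow_natCast, smul_eq_mul, mul_assoc]
      refine mul_le_mul_of_nonneg_left ?_ (by positivity)
      refine mul_le_mul_of_nonneg_left ?_ (by positivity)
      exact Real.rpow_le_rpow_of_nonpos hr0 (by linarith) (by simp)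
  refine (h1.const_mul (2 ^ N * schwartzSup N φ)).mono' ?_ (ae_of_all _ fun x => ?_)
  · have : Measurable fun x : E m => ‖x‖ ^ a := by fun_prop
    exact this.aestronglyMeasurable.mul φ.continuous.norm.aestronglyMeasurable
  · have h2 := pow_mul_norm_le_schwartzSup N φ x
    have hx : 0 < 1 + ‖x‖ := by positivity
    simp only [Real.rpow_neg hx.le, Real.rpow_natCast]
    rw [Real.norm_of_nonneg (by positivity)]
    have h3 : ‖φ x‖ ≤ 2 ^ N * schwartzSup N φ * ((1 + ‖x‖) ^ N)⁻¹ := by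
      rw [← div_eq_mul_inv, le_div_iff₀ (by positivity), mul_comm]
      exact h2
    calc ‖x‖ ^ a * ‖φ x‖ ≤ ‖x‖ ^ a * (2 ^ N * schwartzSup N φ * ((1 + ‖x‖) ^ N)⁻¹) := by gcongr
      _ = _ := by ring

lemma ae_ne_zero (hm : 1 ≤ m) : ∀ᵐ x : E m, x ≠ 0 := by
  have hnt : Nontrivial (E m) := by
    have : Nonempty (Fin m) := ⟨⟨0, hm⟩⟩
    infer_instance
  exact Measure.ae_ne volume 0

lemma integrable_homKernel_mul (hm : 1 ≤ m) {κ : ℕ} {h : E m → ℂ} (hh : IsWeight κ h) {l : ℂ}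
    (hl : -(m : ℝ) < l.re) (φ : 𝓢(E m, ℂ)) : Integrable fun x => homKernel κ h l x * φ x := by
  refine (integrable_norm_rpow_mul hm hl φ).mono'
    ((measurable_homKernel hh l).aestronglyMeasurable.mul φ.continuous.aestronglyMeasurable) ?_
  filter_upwards [ae_ne_zero hm] with x hx
  rw [norm_mul]
  exact mul_le_mul_of_nonneg_right (norm_homKernel_le hh l hx) (norm_nonneg _)

lemma integrable_homKernel_mul_of_far (hm : 1 ≤ m) {κ : ℕ} {h : E m → ℂ} (hh : IsWeight κ h)
    (l : ℂ) (φ : 𝓢(E m, ℂ)) (hφ : ∀ x, ‖x‖ ≤ 1 → φ x = 0) :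
    Integrable fun x => homKernel κ h l x * φ x := by
  have hm' : (1 : ℝ) ≤ m := by exact_mod_cast hm
  refine (integrable_norm_rpow_mul hm (a := max l.re 0) (by
    have := le_max_right l.re 0
    linarith) φ).mono'
    ((measurable_homKernel hh l).aestronglyMeasurable.mul φ.continuous.aestronglyMeasurable) ?_
  refine ae_of_all _ fun x => ?_
  by_cases hx : ‖x‖ ≤ 1
  · rw [hφ x hx]; simp
  · rw [not_le] at hx
    have hx0 : x ≠ 0 := norm_pos_iff.1 (one_pos.trans hx)
    rw [norm_mul]
    refine mul_le_mul_of_nonneg_right ((norm_homKernel_le hh l hx0).trans ?_) (norm_nonneg _)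
    exact Real.rpow_le_rpow_of_exponent_le hx.le (le_max_left _ _)

lemma fpDist_eq_integral (hm : 1 ≤ m) {κ : ℕ} {h : E m → ℂ} (hh : IsWeight κ h) {l : ℂ}
    (hl : -(m : ℝ) < l.re) (φ : 𝓢(E m, ℂ)) :
    fpDist h hh.continuous l φ = ∫ x, homKernel κ h l x * φ x := by
  rw [fpDist_apply, finitePart_of_neg_one_lt (by simp; linarith) (isRapid_sphInt hh.continuous φ),
    ← mellin_sphInt_eq hm hh l φ (integrable_homKernel_mul hm hh hl φ)]
  congr 1
  ring

lemma sphInt_eventually_eq_zero (w : E m → ℂ) (φ : 𝓢(E m, ℂ)) (hφ : ∀ x, ‖x‖ ≤ 1 → φ x = 0) :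
    ∀ᶠ r in 𝓝 (0 : ℝ), sphInt w φ r = 0 := by
  filter_upwards [Metric.closedBall_mem_nhds (0 : ℝ) one_pos] with r hr
  rw [mem_closedBall_zero_iff] at hr
  have : ∀ θ : Metric.sphere (0 : E m) 1, w θ * φ (r • (θ : E m)) = 0 := by
    intro θ
    rw [hφ, mul_zero]
    simpa [norm_smul] using hr
  simp [sphInt, this]

lemma fpDist_eq_integral_of_far (hm : 1 ≤ m) {κ : ℕ} {h : E m → ℂ} (hh : IsWeight κ h) (l : ℂ)
    (φ : 𝓢(E m, ℂ)) (hφ : ∀ x, ‖x‖ ≤ 1 → φ x = 0) :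
    fpDist h hh.continuous l φ = ∫ x, homKernel κ h l x * φ x := by
  rw [fpDist_apply, finitePart_of_eventuallyEq_zero _ (isRapid_sphInt hh.continuous φ)
    (sphInt_eventually_eq_zero h φ hφ),
    ← mellin_sphInt_eq hm hh l φ (integrable_homKernel_mul_of_far hm hh l φ hφ)]
  congr 1
  ring

/-- All Taylor coefficients of the spherical integral vanish, so no pole is left. Applied to `φ̂`,
this makes the Fourier side of the continuation holomorphic at every exponent. -/
lemma differentiable_fpDist_of_far {h : E m → ℂ} (hh : Continuous h)
    (φ : 𝓢(E m, ℂ)) (hφ : ∀ x, ‖x‖ ≤ 1 → φ x = 0) :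
    Differentiable ℂ fun l => fpDist h hh l φ := by
  intro l
  have h1 : DifferentiableAt ℂ (fun s => finitePart s (sphInt h φ)) (l + m - 1) := by
    refine differentiableAt_finitePart (isRapid_sphInt hh φ) fun j _ => ?_
    have : sphInt h φ =ᶠ[𝓝 0] fun _ => 0 := sphInt_eventually_eq_zero h φ hφ
    rw [this.iteratedDeriv_eq]
    simp
  exact h1.comp (f := fun l : ℂ => l + m - 1) l (by fun_prop)

lemma isFarKernel_fpDist (hm : 1 ≤ m) {κ : ℕ} {h : E m → ℂ} (hh : IsWeight κ h) (l : ℂ) :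
    ∃ K, IsFarKernel (fpDist h hh.continuous l) l.re K := by
  -- For `‖x‖ > 1` the quantities `‖x‖` and `1 + ‖x‖` differ by a factor of at most `2`, which gives
  -- the constant `2^|Re l|`.
  refine ⟨Set.indicator {x | 1 < ‖x‖} (homKernel κ h l), ?_, ⟨2 ^ |l.re|, by positivity,
    fun x => ?_⟩, fun φ hφ => ?_⟩
  · exact (measurable_homKernel hh l).indicator (measurableSet_lt measurable_const measurable_norm)
  · by_cases hx : 1 < ‖x‖
    · rw [Set.indicator_of_mem (by exact hx)]
      have hx0 : x ≠ 0 := norm_pos_iff.1 (one_pos.trans hx)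
      refine (norm_homKernel_le hh l hx0).trans ?_
      have h0 : 0 < ‖x‖ := one_pos.trans hx
      rcases le_total 0 l.re with ha | ha
      · rw [abs_of_nonneg ha]
        calc ‖x‖ ^ l.re ≤ (1 + ‖x‖) ^ l.re := Real.rpow_le_rpow h0.le (by linarith) ha
          _ ≤ 2 ^ l.re * (1 + ‖x‖) ^ l.re :=
            le_mul_of_one_le_left (by positivity) (Real.one_le_rpow (by norm_num) ha)
      · rw [abs_of_nonpos ha]
        have h1 : (2 * ‖x‖) ^ l.re ≤ (1 + ‖x‖) ^ l.re :=
          Real.rpow_le_rpow_of_nonpos (by positivity) (by linarith) ha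
        rw [Real.mul_rpow (by norm_num) h0.le] at h1
        rw [Real.rpow_neg (by norm_num)]
        have h2 : (0 : ℝ) < 2 ^ l.re := by positivity
        rwa [inv_mul_eq_div, le_div_iff₀ h2, mul_comm]
    · rw [Set.indicator_of_notMem (by exact hx)]
      simp only [norm_zero]
      positivity
  · rw [fpDist_eq_integral_of_far hm hh l φ hφ]
    congr 1
    ext x
    by_cases hx : 1 < ‖x‖
    · rw [Set.indicator_of_mem (by exact hx)]
    · rw [hφ x (not_lt.1 hx)]; simp

end Polar

/-! ### Gaussians and the Fourier transform -/

/-- The Gaussian `exp(-π t |x|²)`. -/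
def gauss (t : ℝ) (x : E m) : ℂ := Complex.exp (-(((Real.pi * t : ℝ)) : ℂ) * ((‖x‖ : ℝ) : ℂ) ^ 2)

lemma gauss_eq_ofReal (t : ℝ) (x : E m) :
    gauss t x = ((Real.exp (-(Real.pi * t * ‖x‖ ^ 2)) : ℝ) : ℂ) := by
  rw [gauss]; push_cast; congr 1; ring

lemma norm_gauss (t : ℝ) (x : E m) : ‖gauss t x‖ = Real.exp (-(Real.pi * t * ‖x‖ ^ 2)) := by
  rw [gauss_eq_ofReal, Complex.norm_real, Real.norm_of_nonneg (Real.exp_pos _).le]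

lemma norm_gauss_le {t : ℝ} (ht : 0 ≤ t) (x : E m) : ‖gauss t x‖ ≤ 1 := by
  rw [norm_gauss, Real.exp_le_one_iff, neg_nonpos]
  positivity

lemma continuous_gauss (t : ℝ) : Continuous (gauss t : E m → ℂ) := by
  unfold gauss; fun_prop

lemma hasFDerivAt_gauss (t : ℝ) (x : E m) : HasFDerivAt (gauss t : E m → ℂ)
    ((gauss t x * -(((2 * Real.pi * t : ℝ)) : ℂ)) • (Complex.ofRealCLM ∘L innerSL ℝ x)) x := by
  have h1 : HasFDerivAt (fun x : E m => -(Real.pi * t * ‖x‖ ^ 2))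
      (-((Real.pi * t) • ((2 : ℕ) • innerSL ℝ x))) x :=
    ((hasStrictFDerivAt_norm_sq x).hasFDerivAt.const_mul (Real.pi * t)).neg
  have h2 := (Complex.ofRealCLM.hasFDerivAt.comp x h1.exp)
  have h3 : (gauss t : E m → ℂ) = Complex.ofRealCLM ∘ fun x : E m =>
      Real.exp (-(Real.pi * t * ‖x‖ ^ 2)) := funext (gauss_eq_ofReal t)
  rw [h3]
  refine h2.congr_fderiv ?_
  ext v
  simp
  ring

lemma integrable_mul_schwartz_of_le {g : E m → ℂ} (hg : Continuous g) (hb : ∀ x, ‖g x‖ ≤ 1)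
    (φ : 𝓢(E m, ℂ)) : Integrable fun x => g x * φ x :=
  φ.integrable.bdd_mul hg.aestronglyMeasurable (ae_of_all _ hb)

/-- The Fourier transform moves across the integral, and it takes `gauss t⁻¹` to `t^(m/2) gauss t`.
-/
lemma integral_gauss_mul {t : ℝ} (ht : 0 < t) (φ : 𝓢(E m, ℂ)) :
    ∫ x, gauss t x * φ x = (t : ℂ) ^ (-(m : ℂ) / 2) * ∫ ξ, gauss t⁻¹ ξ * 𝓕 φ ξ := by
  have ht' : (t : ℂ) ≠ 0 := by exact_mod_cast ht.ne'
  have hpi : (Real.pi : ℂ) ≠ 0 := by exact_mod_cast Real.pi_ne_zero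
  have hb : 0 < (((Real.pi * t⁻¹ : ℝ)) : ℂ).re := by
    rw [Complex.ofReal_re]; positivity
  have hF : 𝓕 (gauss t⁻¹ : E m → ℂ) = fun w => (t : ℂ) ^ ((m : ℂ) / 2) * gauss t w := by
    ext w
    have := fourier_gaussian_innerProductSpace hb w
    rw [finrank_euclideanSpace_fin] at this
    unfold gauss
    rw [this]
    congr 2
    · push_cast
      field_simp
    · push_cast
      field_simp
  have hint : Integrable (gauss t⁻¹ : E m → ℂ) := by
    have := GaussianFourier.integrable_cexp_neg_mul_sq_norm_add hb 0 (0 : E m)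
    have h0 : (gauss t⁻¹ : E m → ℂ) =
        fun v => Complex.exp (-((Real.pi * t⁻¹ : ℝ) : ℂ) * ((‖v‖ : ℝ) : ℂ) ^ 2) := rfl
    rw [h0]
    simpa using this
  have h1 := VectorFourier.integral_fourierIntegral_smul_eq_flip (L := innerₗ (E m))
    Real.continuous_fourierChar continuous_inner hint (φ.integrable (μ := volume))
  rw [flip_innerₗ] at h1
  change ∫ ξ, 𝓕 (gauss t⁻¹ : E m → ℂ) ξ • φ ξ = ∫ x, gauss t⁻¹ x • 𝓕 (φ : E m → ℂ) x at h1
  rw [hF] at h1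
  simp only [smul_eq_mul, mul_assoc, integral_const_mul] at h1
  rw [SchwartzMap.fourier_coe, ← h1, ← mul_assoc, ← Complex.cpow_add _ _ ht']
  rw [show -(m : ℂ) / 2 + (m : ℂ) / 2 = 0 by ring, Complex.cpow_zero, one_mul]

lemma coord_eq_inner (j : Fin m) (x : E m) : coord j x = ((inner ℝ x (basisVec j) : ℝ) : ℂ) := by
  simp [coord, basisVec, EuclideanSpace.inner_single_right]

lemma hasTemperateGrowth_coord (j : Fin m) : (coord j).HasTemperateGrowth := by
  have : (coord j : E m → ℂ) = Complex.ofRealCLM ∘L (EuclideanSpace.proj (𝕜 := ℝ) j) := rfl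
  rw [this]
  exact ContinuousLinearMap.hasTemperateGrowth _

/-- Multiplication by the `j`-th coordinate. -/
def mulCoord (j : Fin m) (φ : 𝓢(E m, ℂ)) : 𝓢(E m, ℂ) := SchwartzMap.smulLeftCLM ℂ (coord j) φ

lemma mulCoord_apply (j : Fin m) (φ : 𝓢(E m, ℂ)) (x : E m) :
    mulCoord j φ x = coord j x * φ x := by
  rw [mulCoord, SchwartzMap.smulLeftCLM_apply_apply (hasTemperateGrowth_coord j), smul_eq_mul]

lemma lineDeriv_fourier (j : Fin m) (φ : 𝓢(E m, ℂ)) (ξ : E m) :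
    (∂_{(basisVec j : E m)} (𝓕 φ : 𝓢(E m, ℂ))) ξ =
      -(2 * Real.pi * Complex.I) * 𝓕 (mulCoord j φ) ξ := by
  have hg : (fun x : E m => inner ℝ x (basisVec j)).HasTemperateGrowth :=
    ((innerSL ℝ).flip (basisVec j)).hasTemperateGrowth
  have h1 : (SchwartzMap.smulLeftCLM ℂ (fun x : E m => inner ℝ x (basisVec j)) φ) =
      mulCoord j φ := by
    ext x
    rw [mulCoord_apply, SchwartzMap.smulLeftCLM_apply_apply hg, coord_eq_inner, Complex.real_smul]
  rw [SchwartzMap.lineDerivOp_fourier_eq, h1, FourierTransform.fourier_smul]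
  simp

lemma fourier_lineDeriv (j : Fin m) (φ : 𝓢(E m, ℂ)) (ξ : E m) :
    𝓕 (∂_{(basisVec j : E m)} φ) ξ = (2 * Real.pi * Complex.I) * (coord j ξ * 𝓕 φ ξ) := by
  have hg : (fun x : E m => inner ℝ x (basisVec j)).HasTemperateGrowth :=
    ((innerSL ℝ).flip (basisVec j)).hasTemperateGrowth
  rw [SchwartzMap.fourier_lineDerivOp_eq, smul_apply, SchwartzMap.smulLeftCLM_apply_apply hg,
    coord_eq_inner, Complex.real_smul, smul_eq_mul]

/-- The factor `x_j` is moved onto `φ`, where it becomes a derivative of `φ̂`. Integration by parts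
throws the derivative onto the Gaussian, and this yields `ξ_j`, an extra `t⁻¹` and the factor `i`.
-/
lemma integral_coord_gauss_mul {t : ℝ} (ht : 0 < t) (j : Fin m) (φ : 𝓢(E m, ℂ)) :
    ∫ x, coord j x * gauss t x * φ x =
      Complex.I * (t : ℂ) ^ (-(m : ℂ) / 2 - 1) * ∫ ξ, coord j ξ * gauss t⁻¹ ξ * 𝓕 φ ξ := by
  have ht' : (t : ℂ) ≠ 0 := by exact_mod_cast ht.ne'
  have hti : 0 ≤ t⁻¹ := (inv_pos.2 ht).le
  have hpi : (Real.pi : ℂ) ≠ 0 := by exact_mod_cast Real.pi_ne_zero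
  have h1 : ∫ x, coord j x * gauss t x * φ x = ∫ x, gauss t x * mulCoord j φ x := by
    congr 1; ext x; rw [mulCoord_apply]; ring
  have hd : ∀ x : E m, fderiv ℝ (gauss t⁻¹) x (basisVec j) =
      -(2 * Real.pi * (t : ℂ)⁻¹) * (coord j x * gauss t⁻¹ x) := by
    intro x
    rw [(hasFDerivAt_gauss _ x).fderiv, coord_eq_inner]
    simp
    ring
  have hparts : ∫ ξ, gauss t⁻¹ ξ * fderiv ℝ (𝓕 φ : 𝓢(E m, ℂ)) ξ (basisVec j) =
      -∫ ξ, fderiv ℝ (gauss t⁻¹) ξ (basisVec j) * (𝓕 φ : 𝓢(E m, ℂ)) ξ := by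
    refine integral_mul_fderiv_eq_neg_fderiv_mul_of_integrable ?_ ?_ ?_
      (fun x _ => (hasFDerivAt_gauss _ x).differentiableAt)
      (fun x _ => (𝓕 φ : 𝓢(E m, ℂ)).differentiableAt)
    · have := (integrable_mul_schwartz_of_le (continuous_gauss t⁻¹) (norm_gauss_le hti)
        (mulCoord j (𝓕 φ))).const_mul (-(2 * Real.pi * (t : ℂ)⁻¹))
      refine this.congr (ae_of_all _ fun x => ?_)
      simp only [hd, mulCoord_apply]
      ring
    · exact integrable_mul_schwartz_of_le (continuous_gauss t⁻¹) (norm_gauss_le hti)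
        (∂_{(basisVec j : E m)} (𝓕 φ : 𝓢(E m, ℂ)))
    · exact integrable_mul_schwartz_of_le (continuous_gauss t⁻¹) (norm_gauss_le hti) (𝓕 φ)
  have hleft : ∀ ξ, fderiv ℝ (𝓕 φ : 𝓢(E m, ℂ)) ξ (basisVec j) =
      -(2 * Real.pi * Complex.I) * 𝓕 (mulCoord j φ) ξ := fun ξ => by
    rw [← lineDeriv_fourier]; rfl
  have hl : ∫ ξ, gauss t⁻¹ ξ * fderiv ℝ (𝓕 φ : 𝓢(E m, ℂ)) ξ (basisVec j) =
      -(2 * Real.pi * Complex.I) * ∫ ξ, gauss t⁻¹ ξ * 𝓕 (mulCoord j φ) ξ := by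
    rw [← integral_const_mul]
    congr 1; ext ξ; rw [hleft]; ring
  have hr : ∫ ξ, fderiv ℝ (gauss t⁻¹) ξ (basisVec j) * (𝓕 φ : 𝓢(E m, ℂ)) ξ =
      -(2 * Real.pi * (t : ℂ)⁻¹) * ∫ ξ, coord j ξ * gauss t⁻¹ ξ * 𝓕 φ ξ := by
    rw [← integral_const_mul]
    congr 1; ext ξ; rw [hd]; ring
  rw [hl, hr] at hparts
  rw [h1, integral_gauss_mul ht, Complex.cpow_sub _ _ ht', Complex.cpow_one]
  have h2 : ∫ ξ, gauss t⁻¹ ξ * 𝓕 (mulCoord j φ) ξ =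
      Complex.I * (t : ℂ)⁻¹ * ∫ ξ, coord j ξ * gauss t⁻¹ ξ * 𝓕 φ ξ := by
    have h3 : (2 * Real.pi * Complex.I : ℂ) ≠ 0 := by simp [hpi]
    refine mul_left_cancel₀ h3 ?_
    linear_combination -hparts - (2 * Real.pi * (t : ℂ)⁻¹ *
      ∫ ξ, coord j ξ * gauss t⁻¹ ξ * 𝓕 φ ξ) * Complex.I_sq
  rw [h2]
  field_simp

/-! ### The Fourier transform of homogeneous functions -/

/-- The behaviour of a weight under the Fourier transform, tested on Gaussians. -/
def IsGaussWeight (κ : ℕ) (h : E m → ℂ) : Prop :=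
  ∀ (t : ℝ), 0 < t → ∀ φ : 𝓢(E m, ℂ), ∫ x, h x * gauss t x * φ x =
    Complex.I ^ κ * (t : ℂ) ^ (-(m : ℂ) / 2 - κ) * ∫ ξ, h ξ * gauss t⁻¹ ξ * 𝓕 φ ξ

lemma isGaussWeight_one : IsGaussWeight 0 (fun _ : E m => (1 : ℂ)) := fun t ht φ => by
  simpa using integral_gauss_mul ht φ

lemma isGaussWeight_coord (j : Fin m) : IsGaussWeight 1 (coord j) := fun t ht φ => by
  simpa using integral_coord_gauss_mul ht j φ

/-- Powers of `‖x‖` are superpositions of Gaussians: `∫ t^(s-1) e^(-πt‖x‖²) dt = Γ(s) π^(-s)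
‖x‖^(-2s)`. One hypothesis makes the `t`-integral converge, the other makes the kernel locally
integrable, and Fubini does the rest. -/
lemma mellin_gauss (hm : 1 ≤ m) {κ : ℕ} {h : E m → ℂ} (hh : IsWeight κ h) {s : ℂ} (hs : 0 < s.re)
    (hs' : -(m : ℝ) < κ - 2 * s.re) (φ : 𝓢(E m, ℂ)) :
    mellin (fun t => ∫ x, h x * gauss t x * φ x) s =
      Complex.Gamma s * (Real.pi : ℂ) ^ (-s) * ∫ x, homKernel κ h (κ - 2 * s) x * φ x := by
  have hpos : ∀ x : E m, x ≠ 0 → 0 < Real.pi * ‖x‖ ^ 2 := fun x hx => by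
    have := norm_pos_iff.2 hx
    positivity
  have hinner : ∀ x : E m, x ≠ 0 →
      ∫ t in Set.Ioi (0 : ℝ), (t : ℂ) ^ (s - 1) * (h x * gauss t x * φ x) =
        Complex.Gamma s * (Real.pi : ℂ) ^ (-s) * (homKernel κ h (κ - 2 * s) x * φ x) := by
    intro x hx
    have h1 := Complex.integral_cpow_mul_exp_neg_mul_Ioi hs (hpos x hx)
    have h2 : ∀ t : ℝ, (t : ℂ) ^ (s - 1) * (h x * gauss t x * φ x) = (h x * φ x) *
        ((t : ℂ) ^ (s - 1) * Complex.exp (-(((Real.pi * ‖x‖ ^ 2 : ℝ)) * t))) := by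
      intro t
      have : gauss t x = Complex.exp (-(((Real.pi * ‖x‖ ^ 2 : ℝ)) * t)) := by
        rw [gauss]; push_cast; ring_nf
      rw [this]; ring
    simp only [h2, integral_const_mul]
    rw [h1]
    have h3 : (1 / ((Real.pi * ‖x‖ ^ 2 : ℝ) : ℂ)) ^ s =
        (Real.pi : ℂ) ^ (-s) * ((‖x‖ : ℝ) : ℂ) ^ (-2 * s) := by
      have hx0 := norm_pos_iff.2 hx
      have e1 : (1 / ((Real.pi * ‖x‖ ^ 2 : ℝ) : ℂ)) = ((Real.pi * ‖x‖ ^ 2 : ℝ) : ℂ)⁻¹ := one_div _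
      rw [e1, Complex.inv_cpow _ _ (by
        rw [Complex.arg_ofReal_of_nonneg (hpos x hx).le]; exact Real.pi_pos.ne),
        ← Complex.cpow_neg, Complex.ofReal_mul,
        Complex.mul_cpow_ofReal_nonneg Real.pi_pos.le (by positivity)]
      congr 1
      have hx1 : ((‖x‖ : ℝ) : ℂ) ≠ 0 := by exact_mod_cast hx0.ne'
      rw [pow_two, Complex.ofReal_mul, Complex.mul_cpow_ofReal_nonneg hx0.le hx0.le,
        ← Complex.cpow_add _ _ hx1]
      congr 1
      ring
    rw [h3, homKernel, show (κ - 2 * s - κ : ℂ) = -2 * s by ring]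
    ring
  have hreal : ∀ x : E m, x ≠ 0 →
      ∫ t in Set.Ioi (0 : ℝ), ‖(t : ℂ) ^ (s - 1) * (h x * gauss t x * φ x)‖ =
        Real.Gamma s.re * Real.pi ^ (-s.re) * ‖homKernel κ h (κ - 2 * s) x * φ x‖ := by
    intro x hx
    have hx0 := norm_pos_iff.2 hx
    have h1 := Real.integral_rpow_mul_exp_neg_mul_Ioi hs (hpos x hx)
    have h2 : ∫ t in Set.Ioi (0 : ℝ), ‖(t : ℂ) ^ (s - 1) * (h x * gauss t x * φ x)‖ =
        ∫ t in Set.Ioi (0 : ℝ), (‖h x‖ * ‖φ x‖) *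
          (t ^ (s.re - 1) * Real.exp (-(Real.pi * ‖x‖ ^ 2 * t))) := by
      refine setIntegral_congr_fun measurableSet_Ioi fun t ht => ?_
      have ht0 : (0 : ℝ) < t := ht
      simp only [norm_mul, norm_gauss, Complex.norm_cpow_eq_rpow_re_of_pos ht0, Complex.sub_re,
        Complex.one_re]
      rw [show Real.pi * t * ‖x‖ ^ 2 = Real.pi * ‖x‖ ^ 2 * t by ring]
      ring
    rw [h2, integral_const_mul, h1, one_div, Real.inv_rpow (hpos x hx).le,
      ← Real.rpow_neg (hpos x hx).le, Real.mul_rpow Real.pi_pos.le (by positivity), homKernel,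
      norm_mul, norm_mul, Complex.norm_cpow_eq_rpow_re_of_pos hx0, ← Real.rpow_natCast,
      ← Real.rpow_mul hx0.le]
    have e : (κ - 2 * s - κ : ℂ).re = ((2 : ℕ) : ℝ) * (-s.re) := by simp
    rw [e]
    ring
  have hae : ∀ᵐ x : E m, x ≠ 0 := ae_ne_zero hm
  have hmeas : Measurable fun p : ℝ × E m =>
      (p.1 : ℂ) ^ (s - 1) * (h p.2 * gauss p.1 p.2 * φ p.2) := by
    have h1 : Continuous fun p : ℝ × E m => (h p.2 * gauss p.1 p.2 * φ p.2) := by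
      have h2 : Continuous fun p : ℝ × E m => h p.2 := hh.continuous.comp continuous_snd
      have h3 : Continuous fun p : ℝ × E m => φ p.2 := φ.continuous.comp continuous_snd
      have h5 : Continuous fun p : ℝ × E m => gauss p.1 p.2 := by unfold gauss; fun_prop
      exact (h2.mul h5).mul h3
    have h4 : Measurable fun p : ℝ × E m => (p.1 : ℂ) ^ (s - 1) :=
      (Complex.measurable_ofReal.comp measurable_fst).pow_const _
    exact h4.mul h1.measurable
  have hfub : Integrable (fun p : ℝ × E m =>
      (p.1 : ℂ) ^ (s - 1) * (h p.2 * gauss p.1 p.2 * φ p.2))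
      ((volume.restrict (Set.Ioi (0 : ℝ))).prod volume) := by
    rw [integrable_prod_iff' hmeas.aestronglyMeasurable]
    constructor
    · filter_upwards [hae] with x hx
      -- Where this product is nonzero the `t`-integral has been computed and is nonzero, so its
      -- integrand is integrable. Otherwise the integrand is identically zero.
      by_cases hz : homKernel κ h (κ - 2 * s) x * φ x = 0
      · have hhz : h x * φ x = 0 := by
          rw [homKernel, mul_assoc, mul_eq_zero] at hz
          refine hz.resolve_left ?_
          have := norm_pos_iff.2 hx
          rw [Complex.cpow_eq_zero_iff]
          simp [hx]
        have : (fun t : ℝ => (t : ℂ) ^ (s - 1) * (h x * gauss t x * φ x)) = fun _ => 0 := by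
          ext t
          linear_combination ((t : ℂ) ^ (s - 1) * gauss t x) * hhz
        rw [this]
        exact integrable_zero _ _ _
      · refine Integrable.of_integral_ne_zero ?_
        rw [hinner x hx]
        refine mul_ne_zero (mul_ne_zero (Complex.Gamma_ne_zero_of_re_pos hs) ?_) hz
        rw [Ne, Complex.cpow_eq_zero_iff]
        simp [Real.pi_ne_zero]
    · have := ((integrable_homKernel_mul hm hh (l := κ - 2 * s) (by simpa using hs')
        φ).norm.const_mul (Real.Gamma s.re * Real.pi ^ (-s.re)))
      refine this.congr ?_
      filter_upwards [hae] with x hx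
      rw [hreal x hx]
  have hswap := integral_integral_swap
    (f := fun (t : ℝ) (x : E m) => (t : ℂ) ^ (s - 1) * (h x * gauss t x * φ x)) hfub
  rw [mellin]
  simp only [smul_eq_mul, ← integral_const_mul]
  rw [hswap]
  refine integral_congr_ae ?_
  filter_upwards [hae] with x hx
  exact hinner x hx

/-- The constant relating a homogeneous function of degree `l` to its Fourier transform. -/
def fourierConst (m κ : ℕ) (l : ℂ) : ℂ :=
  Complex.I ^ κ * Complex.Gamma ((l + m + κ) / 2) * (Real.pi : ℂ) ^ (-l - m / 2) *
    (Complex.Gamma ((κ - l) / 2))⁻¹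

/-- Take the Mellin transform in `t` of the Gaussian identity. The substitution `t ↦ 1/t` exchanges
the parameters `(κ-l)/2` and `(l+m+κ)/2`, and the ratio of the two Gamma factors is the constant. In
the strip both integrals converge absolutely. -/
lemma integral_homKernel_mul_eq (hm : 1 ≤ m) {κ : ℕ} {h : E m → ℂ} (hh : IsWeight κ h)
    (hg : IsGaussWeight κ h) {l : ℂ} (hl : -(m : ℝ) < l.re) (hl' : l.re < 0) (φ : 𝓢(E m, ℂ)) :
    ∫ x, homKernel κ h l x * φ x =
      fourierConst m κ l * ∫ ξ, homKernel κ h (-m - l) ξ * 𝓕 φ ξ := by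
  have hpi : (Real.pi : ℂ) ≠ 0 := by exact_mod_cast Real.pi_ne_zero
  have hκ : (0 : ℝ) ≤ κ := Nat.cast_nonneg _
  have hs : 0 < ((κ - l) / 2 : ℂ).re := by
    simp; linarith
  have hs2 : 0 < ((l + m + κ) / 2 : ℂ).re := by
    simp; linarith
  have h1 := mellin_gauss hm hh hs (by simp; linarith) φ
  have h2 := mellin_gauss hm hh hs2 (by simp; linarith) (𝓕 φ)
  have h3 : mellin (fun t => ∫ x, h x * gauss t x * φ x) ((κ - l) / 2) =
      Complex.I ^ κ * mellin (fun t => ∫ ξ, h ξ * gauss t ξ * 𝓕 φ ξ) ((l + m + κ) / 2) := by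
    have h4 : mellin (fun t => ∫ x, h x * gauss t x * φ x) ((κ - l) / 2) =
        mellin (fun t : ℝ => Complex.I ^ κ • ((t : ℂ) ^ (-(m : ℂ) / 2 - κ) •
          (fun u : ℝ => ∫ ξ, h ξ * gauss u ξ * 𝓕 φ ξ) t⁻¹)) ((κ - l) / 2) := by
      refine setIntegral_congr_fun measurableSet_Ioi fun t ht => ?_
      simp only [hg t ht φ, smul_eq_mul]
      ring
    rw [h4, mellin_const_smul, mellin_cpow_smul,
      mellin_comp_inv (fun u : ℝ => ∫ ξ, h ξ * gauss u ξ * 𝓕 φ ξ), smul_eq_mul]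
    congr 2
    ring
  rw [h1, h2] at h3
  rw [show (κ - 2 * ((κ - l) / 2) : ℂ) = l by ring,
    show (κ - 2 * ((l + m + κ) / 2) : ℂ) = -m - l by ring] at h3
  have hG := Complex.Gamma_ne_zero_of_re_pos hs
  have hp : (Real.pi : ℂ) ^ (-((κ - l) / 2) : ℂ) ≠ 0 := by
    rw [Ne, Complex.cpow_eq_zero_iff]; simp [hpi]
  refine mul_left_cancel₀ (mul_ne_zero hG hp) ?_
  rw [h3, fourierConst, show (-l - m / 2 : ℂ) = -((l + m + κ) / 2) - (-((κ - l) / 2)) by ring,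
    Complex.cpow_sub _ _ hpi]
  field_simp

/-- Both sides continue from the strip. The poles of the Gamma factor in `fourierConst` are the
exponents excluded by `regularSet`, and the integral over `ξ` is entire in `l` because `φ̂` vanishes
on the unit ball. -/
lemma fpDist_eq_fourier (hm : 1 ≤ m) {κ : ℕ} {h : E m → ℂ} (hh : IsWeight κ h)
    (hg : IsGaussWeight κ h) {l : ℂ} (hl : l ∈ regularSet m κ) (φ : 𝓢(E m, ℂ))
    (hφ : ∀ ξ, ‖ξ‖ ≤ 1 → 𝓕 φ ξ = 0) :
    fpDist h hh.continuous l φ =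
      fourierConst m κ l * ∫ ξ, homKernel κ h (-m - l) ξ * 𝓕 φ ξ := by
  have hpi : (Real.pi : ℂ) ≠ 0 := by exact_mod_cast Real.pi_ne_zero
  rw [← fpDist_eq_integral_of_far hm hh _ (𝓕 φ) hφ]
  refine eq_of_eq_on_strip hm (κ := κ) (F := fun l => fpDist h hh.continuous l φ)
    (G := fun l => fourierConst m κ l * fpDist h hh.continuous (-m - l) (𝓕 φ))
    (fun l hl => differentiableAt_fpDist hh _ hl) (fun l hl => ?_) (fun l h1 h2 => ?_) hl
  · refine DifferentiableAt.mul ?_ ?_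
    · unfold fourierConst
      refine DifferentiableAt.mul (DifferentiableAt.mul (DifferentiableAt.mul
        (differentiableAt_const _) ?_) ?_) ?_
      · exact (Complex.differentiableAt_Gamma _ hl).comp (f := fun l : ℂ => (l + m + κ) / 2) l
          (by fun_prop)
      · exact (by fun_prop : DifferentiableAt ℂ (fun l : ℂ => -l - m / 2) l).const_cpow (Or.inl hpi)
      · exact (Complex.differentiable_one_div_Gamma _).comp (f := fun l : ℂ => (κ - l) / 2) l
          (by fun_prop)
    · exact (differentiable_fpDist_of_far hh.continuous (𝓕 φ) hφ _).comp
        (f := fun l : ℂ => -m - l) l (by fun_prop)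
  · rw [fpDist_eq_integral hm hh h1, integral_homKernel_mul_eq hm hh hg h1 h2,
      fpDist_eq_integral_of_far hm hh _ (𝓕 φ) hφ]

/-! ### Symbols of finite parts and of distributions at the origin -/

/-- Homogeneous functions that are smooth away from the origin are symbols. -/
lemma isSymbol_of_homogeneous {σ : E m → ℂ} {μ : ℂ} (hsm : ∀ x, x ≠ 0 → ContDiffAt ℝ ∞ σ x)
    (hhom : ∀ (c : ℝ), 0 < c → ∀ x, σ (c • x) = (c : ℂ) ^ μ * σ x) : IsSymbol σ := by
  set f : E m → ℂ := fun ξ => (1 - cutoff ((2 : ℝ) • ξ)) * σ ξ with hf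
  have hfar : ∀ x : E m, 1 ≤ ‖x‖ → f x = σ x := fun x hx => by
    simp only [hf]
    rw [cutoff_eq_zero (by rw [norm_smul, Real.norm_of_nonneg zero_le_two]; linarith)]
    simp
  have hsmf : ContDiff ℝ ∞ f := by
    rw [contDiff_iff_contDiffAt]
    intro x
    by_cases hx : x = 0
    · have : f =ᶠ[𝓝 x] fun _ => 0 := by
        rw [hx]
        filter_upwards [Metric.closedBall_mem_nhds (0 : E m) (ε := 1 / 2) (by norm_num)] with y hy
        rw [mem_closedBall_zero_iff] at hy
        simp only [hf]
        rw [cutoff_eq_one (by rw [norm_smul, Real.norm_of_nonneg zero_le_two]; linarith)]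
        simp
      exact contDiffAt_const.congr_of_eventuallyEq this
    · refine ContDiffAt.mul (contDiffAt_const.sub ?_) (hsm x hx)
      exact (contDiff_cutoff.comp (contDiff_const_smul (2 : ℝ))).contDiffAt
  refine ⟨hsmf, fun n => ?_⟩
  obtain ⟨M, hM⟩ := (isCompact_closedBall (0 : E m) 2).exists_bound_of_continuousOn
    (hsmf.continuous_iteratedFDeriv (m := n) (by exact_mod_cast le_top)).continuousOn
  obtain ⟨k, hk⟩ := exists_nat_ge |μ.re|
  have hM0 : 0 ≤ M := (norm_nonneg _).trans (hM 0 (by simp))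
  refine ⟨k, M, fun x => ?_⟩
  have hone : (1 : ℝ) ≤ (1 + ‖x‖) ^ k := one_le_pow₀ (by linarith [norm_nonneg x])
  by_cases hx : ‖x‖ ≤ 2
  · exact (hM x (by simpa using hx)).trans (le_mul_of_one_le_right hM0 hone)
  rw [not_le] at hx
  -- Rescaling brings `x` to the sphere of radius `2`. Homogeneity expresses the derivatives at `x`
  -- through those on this compact set, at the cost of a power of `c`.
  set c : ℝ := ‖x‖ / 2 with hc
  have hc1 : 1 ≤ c := by rw [hc]; linarith
  have hc0 : 0 < c := one_pos.trans_le hc1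
  set y : E m := c⁻¹ • x with hy
  have hcy : c • y = x := by rw [hy, smul_smul, mul_inv_cancel₀ hc0.ne', one_smul]
  have hyn : ‖y‖ = 2 := by
    rw [hy, norm_smul, norm_inv, Real.norm_of_nonneg hc0.le, hc]
    field_simp
  have hev : (fun z => f (c • z)) =ᶠ[𝓝 y] fun z => ((c : ℂ) ^ μ) • f z := by
    have : ∀ᶠ z in 𝓝 y, 1 < ‖z‖ :=
      continuous_norm.continuousAt.eventually (lt_mem_nhds (by simp only [hyn]; norm_num))
    filter_upwards [this] with z hz
    have h1 : 1 ≤ ‖c • z‖ := by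
      rw [norm_smul, Real.norm_of_nonneg hc0.le]
      nlinarith
    rw [hfar _ h1, hfar _ hz.le, hhom c hc0, smul_eq_mul]
  have h1 : iteratedFDeriv ℝ n (fun z => f (c • z)) y = c ^ n • iteratedFDeriv ℝ n f x := by
    rw [iteratedFDeriv_comp_const_smul _ (contDiff_infty.1 hsmf n)]
    simp only [hcy]
  rw [(Filter.EventuallyEq.iteratedFDeriv ℝ hev n).eq_of_nhds, iteratedFDeriv_const_smul_apply'
    (contDiff_infty.1 hsmf n).contDiffAt] at h1
  have h2 := congrArg norm h1
  rw [norm_smul, norm_smul, norm_pow, Real.norm_of_nonneg hc0.le, norm_cpow_ofReal_le hc0] at h2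
  change ‖iteratedFDeriv ℝ n f x‖ ≤ _
  calc ‖iteratedFDeriv ℝ n f x‖ ≤ c ^ n * ‖iteratedFDeriv ℝ n f x‖ :=
        le_mul_of_one_le_left (norm_nonneg _) (one_le_pow₀ hc1)
    _ = c ^ μ.re * ‖iteratedFDeriv ℝ n f y‖ := h2.symm
    _ ≤ (1 + ‖x‖) ^ k * M := by
        refine mul_le_mul ?_ (hM y (by simp [hyn])) (norm_nonneg _) (by positivity)
        rw [← Real.rpow_natCast]
        calc c ^ μ.re ≤ c ^ (k : ℝ) :=
              Real.rpow_le_rpow_of_exponent_le hc1 ((le_abs_self _).trans hk)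
          _ ≤ _ := Real.rpow_le_rpow hc0.le (by rw [hc]; linarith) (Nat.cast_nonneg _)
    _ = M * (1 + ‖x‖) ^ k := mul_comm _ _

lemma contDiffAt_homKernel {κ : ℕ} {h : E m → ℂ} (hh : IsWeight κ h) (l : ℂ) {x : E m}
    (hx : x ≠ 0) : ContDiffAt ℝ ∞ (homKernel κ h l) x := by
  have h1 : homKernel κ h l =ᶠ[𝓝 x]
      fun y => Complex.exp (((Real.log ‖y‖ : ℝ) : ℂ) * (l - κ)) * h y := by
    filter_upwards [isOpen_ne.mem_nhds hx] with y hy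
    have hy' : ((‖y‖ : ℝ) : ℂ) ≠ 0 := by exact_mod_cast (norm_pos_iff.2 hy).ne'
    rw [homKernel, Complex.cpow_def_of_ne_zero hy', Complex.ofReal_log (norm_nonneg y)]
  refine ContDiffAt.congr_of_eventuallyEq ?_ h1
  refine ContDiffAt.mul (ContDiffAt.cexp (ContDiffAt.mul ?_ contDiffAt_const)) hh.contDiff.contDiffAt
  exact Complex.ofRealCLM.contDiff.contDiffAt.comp x
    ((contDiffAt_norm ℝ hx).log (norm_pos_iff.2 hx).ne')

lemma isSymbol_homKernel {κ : ℕ} {h : E m → ℂ} (hh : IsWeight κ h) (c l : ℂ) :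
    IsSymbol fun ξ => c * homKernel κ h l ξ := by
  refine isSymbol_of_homogeneous (μ := l)
    (fun x hx => contDiffAt_const.mul (contDiffAt_homKernel hh l hx)) fun r hr x => ?_
  rw [homKernel_smul hh l hr]; ring

lemma IsFarKernel.const_smul {s : 𝓢'(E m, ℂ)} {a : ℝ} {K : E m → ℂ} (hK : IsFarKernel s a K)
    (c : ℂ) : IsFarKernel (c • s) a fun x => c * K x := by
  obtain ⟨C, hC0, hC⟩ := hK.bound
  refine ⟨hK.measurable.const_mul c, ⟨‖c‖ * C, by positivity, fun x => ?_⟩, fun φ hφ => ?_⟩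
  · rw [norm_mul, mul_assoc]
    exact mul_le_mul_of_nonneg_left (hC x) (norm_nonneg c)
  · have : (c • s) φ = c * s φ := rfl
    rw [this, hK.eq_integral φ hφ, ← integral_const_mul]
    congr 1; ext x; ring

lemma hasSymbol_smul_fpDist (hm : 1 ≤ m) {κ : ℕ} {h : E m → ℂ} (hh : IsWeight κ h)
    (hg : IsGaussWeight κ h) (c μ : ℂ) (hl : -m - μ ∈ regularSet m κ) :
    HasSymbol (c • fpDist h hh.continuous (-m - μ)) μ
      (fun ξ => c * fourierConst m κ (-m - μ) * homKernel κ h μ ξ) := by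
  refine ⟨fun r hr φ => ?_, ?_, isSymbol_homKernel hh _ _, fun φ hφ => ?_⟩
  · have h1 : ∀ ψ, (c • fpDist h hh.continuous (-m - μ)) ψ =
        c * fpDist h hh.continuous (-m - μ) ψ := fun ψ => rfl
    rw [h1, h1, fpDist_dilate hm hh r hr φ hl, show (-m - (-m - μ) : ℂ) = μ by ring]
    ring
  · obtain ⟨K, hK⟩ := isFarKernel_fpDist hm hh (-m - μ)
    have := hK.const_smul c
    rw [show (-m - μ : ℂ).re = -m - μ.re by simp] at this
    exact ⟨_, this⟩
  · have h1 : (c • fpDist h hh.continuous (-m - μ)) φ =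
        c * fpDist h hh.continuous (-m - μ) φ := rfl
    rw [h1, fpDist_eq_fourier hm hh hg hl φ hφ, show (-m - (-m - μ) : ℂ) = μ by ring, ← mul_assoc,
      ← integral_const_mul]
    congr 1; ext ξ; ring

/-- A distribution whose Fourier transform is a homogeneous function, and which is supported at the
origin. -/
lemma hasSymbol_of_forall_eq_integral {κ : ℕ} {h : E m → ℂ} (hh : IsWeight κ h) {c μ : ℂ}
    {s : 𝓢'(E m, ℂ)} (hs : ∀ φ, s φ = ∫ ξ, c * homKernel κ h μ ξ * 𝓕 φ ξ)
    (hs0 : ∀ φ : 𝓢(E m, ℂ), (∀ x, ‖x‖ ≤ 1 → φ x = 0) → s φ = 0) :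
    HasSymbol s μ (fun ξ => c * homKernel κ h μ ξ) := by
  -- Since `s` vanishes on functions that vanish on the unit ball, the zero function serves as its
  -- far kernel, with any exponent.
  refine ⟨fun r hr φ => ?_, ⟨fun _ => 0, measurable_const, ⟨0, le_rfl, by simp⟩, fun φ hφ => ?_⟩,
    isSymbol_homKernel hh _ _, fun φ _ => hs φ⟩
  · rw [hs, hs]
    have h1 := Measure.integral_comp_smul (volume : Measure (E m))
      (fun ξ => c * homKernel κ h μ (r • ξ) * 𝓕 φ ξ) r⁻¹
    rw [finrank_euclideanSpace_fin, abs_of_nonneg (by positivity)] at h1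
    have h2 : ∀ ξ : E m, c * homKernel κ h μ ξ * 𝓕 (dilate r hr φ) ξ = (((r ^ m)⁻¹ : ℝ) : ℂ) *
        (c * homKernel κ h μ (r • r⁻¹ • ξ) * 𝓕 φ (r⁻¹ • ξ)) := by
      intro ξ
      rw [fourier_dilate, smul_smul, mul_inv_cancel₀ hr.ne', one_smul, Complex.real_smul]
      ring
    simp only [h2, integral_const_mul]
    rw [h1, Complex.real_smul, ← mul_assoc, ← Complex.ofReal_mul]
    have h3 : (r ^ m)⁻¹ * ((r⁻¹ ^ m)⁻¹) = (1 : ℝ) := by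
      rw [inv_pow, inv_inv, inv_mul_cancel₀ (by positivity)]
    rw [h3, Complex.ofReal_one, one_mul]
    have h4 : ∀ ξ : E m, c * homKernel κ h μ (r • ξ) * 𝓕 φ ξ =
        (r : ℂ) ^ μ * (c * homKernel κ h μ ξ * 𝓕 φ ξ) := fun ξ => by
      rw [homKernel_smul hh μ hr]; ring
    simp only [h4, integral_const_mul]
  · rw [hs0 φ hφ]; simp

/-- For integer `μ` one part of the kernel is absent. Treating it as zero with a zero coefficient
lets all `μ` be handled together. -/
lemma hasSymbol_zero {κ : ℕ} {h : E m → ℂ} (hh : IsWeight κ h) (μ : ℂ) :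
    HasSymbol (0 : 𝓢'(E m, ℂ)) μ (fun ξ => 0 * homKernel κ h μ ξ) := by
  refine ⟨fun r hr φ => by simp, ⟨fun _ => 0, measurable_const, ⟨0, le_rfl, by simp⟩,
    fun φ hφ => by simp⟩, isSymbol_homKernel hh _ _, fun φ _ => by simp⟩

/-! ### Convolution of kernels of opposite order -/

lemma norm_mul_homKernel_le {κ κ' : ℕ} {h h' : E m → ℂ} (hh : IsWeight κ h) (hh' : IsWeight κ' h')
    (c d μ : ℂ) {ξ : E m} (hξ : ξ ≠ 0) :
    ‖c * homKernel κ h μ ξ * (d * homKernel κ' h' (-μ) ξ)‖ ≤ ‖c‖ * ‖d‖ := by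
  have h1 := norm_homKernel_le hh μ hξ
  have h2 := norm_homKernel_le hh' (-μ) hξ
  have h0 := norm_pos_iff.2 hξ
  have h3 : ‖ξ‖ ^ μ.re * ‖ξ‖ ^ (-μ).re = 1 := by
    rw [← Real.rpow_add h0]; simp
  calc _ = ‖c‖ * ‖d‖ * (‖homKernel κ h μ ξ‖ * ‖homKernel κ' h' (-μ) ξ‖) := by
        simp only [norm_mul]; ring
    _ ≤ ‖c‖ * ‖d‖ * (‖ξ‖ ^ μ.re * ‖ξ‖ ^ (-μ).re) := by gcongr
    _ = _ := by rw [h3, mul_one]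

lemma exists_isScalarConv (hm : 1 ≤ m) {κ κ' : ℕ} {h h' : E m → ℂ} (hh : IsWeight κ h)
    (hh' : IsWeight κ' h') {c d μ : ℂ} {s t : 𝓢'(E m, ℂ)}
    (hs : HasSymbol s μ (fun ξ => c * homKernel κ h μ ξ))
    (ht : HasSymbol t (-μ) (fun ξ => d * homKernel κ' h' (-μ) ξ)) :
    ∃ r : 𝓢'(E m, ℂ), IsScalarConv s t r ∧ (∀ φ, r φ =
      ∫ ξ, c * homKernel κ h μ ξ * (d * homKernel κ' h' (-μ) ξ) * 𝓕 φ ξ) ∧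
      ∀ φ : 𝓢(E m, ℂ), Integrable fun ξ =>
        c * homKernel κ h μ ξ * (d * homKernel κ' h' (-μ) ξ) * 𝓕 φ ξ := by
  have hmeas : Measurable fun ξ => c * homKernel κ h μ ξ * (d * homKernel κ' h' (-μ) ξ) :=
    ((measurable_homKernel hh μ).const_mul c).mul ((measurable_homKernel hh' (-μ)).const_mul d)
  -- The degree-zero estimate is available only off the origin, so the value at `0` is absorbed into
  -- the maximum.
  refine ⟨_, isScalarConv_multiplierDist hm hs ht hmeas
    ⟨max (‖c‖ * ‖d‖) ‖c * homKernel κ h μ 0 * (d * homKernel κ' h' (-μ) 0)‖, fun ξ => ?_⟩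
    (fun r hr ξ => ?_), fun φ => rfl, fun φ => ?_⟩
  · by_cases hξ : ξ = 0
    · rw [hξ]; exact le_max_right _ _
    · exact (norm_mul_homKernel_le hh hh' c d μ hξ).trans (le_max_left _ _)
  · have h1 : (r : ℂ) ^ μ * (r : ℂ) ^ (-μ) = 1 := by
      rw [← Complex.cpow_add _ _ (by exact_mod_cast hr.ne')]; simp
    rw [homKernel_smul hh μ hr, homKernel_smul hh' (-μ) hr]
    linear_combination (c * homKernel κ h μ ξ * d * homKernel κ' h' (-μ) ξ) * h1
  · refine (𝓕 φ : 𝓢(E m, ℂ)).integrable.bdd_mul (c := ‖c‖ * ‖d‖) hmeas.aestronglyMeasurable ?_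
    filter_upwards [ae_ne_zero hm] with ξ hξ using norm_mul_homKernel_le hh hh' c d μ hξ

/-! ### Clifford relations -/

section CliffordRelations

lemma e_mul_e_add_swap (j k : Fin m) :
    (e j * e k + e k * e j : Cl m) = algebraMap ℂ (Cl m) (if j = k then -2 else 0) := by
  rw [e, e, CliffordAlgebra.ι_mul_ι_add_swap]
  congr 1
  simp only [QuadraticMap.polar, QuadraticMap.weightedSumSquares_apply, Pi.add_apply, smul_eq_mul,
    Pi.single_apply, ← Finset.sum_sub_distrib]
  split_ifs with h
  · subst h
    rw [Finset.sum_eq_single j]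
    · norm_num
    · intro b _ hb; simp [hb]
    · simp
  · refine Finset.sum_eq_zero fun i _ => ?_
    by_cases h1 : i = j
    · have h2 : i ≠ k := fun h3 => h (h1.symm.trans h3)
      simp [h1, h]
    · simp [h1]

/-- Adding the sum to its transpose turns every product into an anticommutator, which vanishes off
the diagonal and is `-2` on it. -/
lemma sum_smul_e_mul_e {x : Fin m → Fin m → ℂ} (hx : ∀ j k, x j k = x k j) :
    ∑ j, ∑ k, x j k • (e j * e k : Cl m) = algebraMap ℂ (Cl m) (-∑ j, x j j) := by
  have h1 : ∑ j, ∑ k, x j k • (e j * e k : Cl m) = ∑ j, ∑ k, x j k • (e k * e j : Cl m) := by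
    rw [Finset.sum_comm]
    exact Finset.sum_congr rfl fun j _ => Finset.sum_congr rfl fun k _ => by rw [hx]
  have h2 : (2 : ℂ) • ∑ j, ∑ k, x j k • (e j * e k : Cl m) =
      (2 : ℂ) • algebraMap ℂ (Cl m) (-∑ j, x j j) := by
    rw [two_smul]
    nth_rewrite 2 [h1]
    simp only [← Finset.sum_add_distrib, ← smul_add, e_mul_e_add_swap]
    simp only [Algebra.smul_def, ← map_mul, ← map_sum]
    congr 1
    simp [Finset.mul_sum, mul_comm]
  exact smul_right_injective _ (two_ne_zero (α := ℂ)) h2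

end CliffordRelations

/-! ### Derivatives of the delta distribution -/

section DeltaDerivatives

/-- On the Fourier side both derivatives are multiplications by coordinates, which commute. -/
lemma lineDeriv_comm (j k : Fin m) (φ : 𝓢(E m, ℂ)) :
    ∂_{(basisVec j : E m)} (∂_{(basisVec k : E m)} φ) =
      ∂_{(basisVec k : E m)} (∂_{(basisVec j : E m)} φ) := by
  have h1 : 𝓕 (∂_{(basisVec j : E m)} (∂_{(basisVec k : E m)} φ)) =
      𝓕 (∂_{(basisVec k : E m)} (∂_{(basisVec j : E m)} φ)) := by
    ext ξ
    simp only [fourier_lineDeriv]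
    ring
  have h2 := congrArg (fun f : 𝓢(E m, ℂ) => (𝓕⁻ f : 𝓢(E m, ℂ))) h1
  simpa using h2

lemma laplacian_eq (φ : 𝓢(E m, ℂ)) :
    Δ φ = ∑ j, ∂_{(basisVec j : E m)} (∂_{(basisVec j : E m)} φ) := by
  rw [SchwartzMap.laplacian_eq_sum (EuclideanSpace.basisFun (Fin m) ℝ)]
  simp [basisVec]

lemma sum_coord_sq (ξ : E m) : ∑ j, coord j ξ * coord j ξ = ((‖ξ‖ : ℝ) : ℂ) ^ 2 := by
  rw [← Complex.ofReal_pow, EuclideanSpace.real_norm_sq_eq]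
  simp [coord, pow_two]

lemma fourier_neg_laplacian (φ : 𝓢(E m, ℂ)) (ξ : E m) :
    𝓕 (-(Δ φ)) ξ = (2 * Real.pi) ^ 2 * ((‖ξ‖ : ℝ) : ℂ) ^ 2 * 𝓕 φ ξ := by
  have h1 : 𝓕 (-(Δ φ)) = -∑ j, 𝓕 (∂_{(basisVec j : E m)} (∂_{(basisVec j : E m)} φ)) := by
    rw [laplacian_eq, FourierTransform.fourier_neg, FourierTransform.fourier_sum]
  rw [h1, neg_apply, sum_apply]
  simp only [fourier_lineDeriv]
  rw [← sum_coord_sq, Finset.mul_sum, Finset.sum_mul, ← Finset.sum_neg_distrib]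
  refine Finset.sum_congr rfl fun j _ => ?_
  linear_combination (-(2 * Real.pi) ^ 2 * coord j ξ * coord j ξ * 𝓕 φ ξ) * Complex.I_sq

/-- The tempered distribution `(-Δ)ⁿ δ`. -/
def laplacePow (m n : ℕ) : 𝓢'(E m, ℂ) :=
  (fun s : 𝓢'(E m, ℂ) => -(Δ s))^[n] (TemperedDistribution.delta 0)

lemma laplacePow_zero_apply (φ : 𝓢(E m, ℂ)) : laplacePow m 0 φ = φ 0 := rfl

lemma laplacePow_succ_apply (n : ℕ) (φ : 𝓢(E m, ℂ)) :
    laplacePow m (n + 1) φ = laplacePow m n (-(Δ φ)) := by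
  rw [laplacePow, Function.iterate_succ_apply', map_neg]
  change -((Δ (laplacePow m n)) φ) = _
  rw [TemperedDistribution.laplacian_apply_apply]

lemma apply_zero_eq_integral_fourier (φ : 𝓢(E m, ℂ)) : φ 0 = ∫ ξ, 𝓕 φ ξ := by
  have h1 : (𝓕⁻ (𝓕 φ) : 𝓢(E m, ℂ)) 0 = ∫ ξ, 𝓕 φ ξ := by
    rw [SchwartzMap.fourierInv_coe, Real.fourierInv_eq]
    simp
  rwa [FourierTransform.fourierInv_fourier_eq] at h1

/-- Fourier inversion at `0` gives `δ`, and each `-Δ` contributes a factor `(2π‖ξ‖)²`. -/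
lemma laplacePow_eq_integral (n : ℕ) (φ : 𝓢(E m, ℂ)) :
    laplacePow m n φ = ∫ ξ, (2 * Real.pi) ^ (2 * n) * ((‖ξ‖ : ℝ) : ℂ) ^ (2 * n) * 𝓕 φ ξ := by
  induction n generalizing φ with
  | zero => simp [laplacePow_zero_apply, apply_zero_eq_integral_fourier]
  | succ n ih =>
    rw [laplacePow_succ_apply, ih]
    congr 1
    ext ξ
    rw [fourier_neg_laplacian]
    ring

/-- The partial derivatives of `(-Δ)ⁿ δ`. -/
def gradLaplacePow (n : ℕ) (j : Fin m) : 𝓢'(E m, ℂ) := ∂_{(basisVec j : E m)} (laplacePow m n)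

lemma gradLaplacePow_apply (n : ℕ) (j : Fin m) (φ : 𝓢(E m, ℂ)) :
    gradLaplacePow n j φ = -laplacePow m n (∂_{(basisVec j : E m)} φ) := by
  rw [gradLaplacePow, TemperedDistribution.lineDerivOp_apply_apply, map_neg]

/-- Working on the open ball lets the vanishing pass to derivatives on the same set, so it can be
iterated. -/
lemma lineDeriv_eq_zero_of_eq_zero {φ : 𝓢(E m, ℂ)} (hφ : ∀ x, ‖x‖ < 1 → φ x = 0) (v : E m) :
    ∀ x, ‖x‖ < 1 → (∂_{v} φ) x = 0 := by
  intro x hx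
  have h1 : (φ : E m → ℂ) =ᶠ[𝓝 x] fun _ => 0 := by
    filter_upwards [(continuous_norm (E := E m)).continuousAt.eventually (gt_mem_nhds hx)] with y hy
      using hφ y hy
  change fderiv ℝ φ x v = 0
  rw [h1.fderiv_eq]
  simp

lemma laplacePow_eq_zero (n : ℕ) {φ : 𝓢(E m, ℂ)} (hφ : ∀ x, ‖x‖ < 1 → φ x = 0) :
    laplacePow m n φ = 0 := by
  induction n generalizing φ with
  | zero => exact hφ 0 (by simp)
  | succ n ih =>
    rw [laplacePow_succ_apply]
    refine ih fun x hx => ?_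
    rw [laplacian_eq, neg_apply, sum_apply]
    simp only [lineDeriv_eq_zero_of_eq_zero (lineDeriv_eq_zero_of_eq_zero hφ _) _ x hx,
      Finset.sum_const_zero, neg_zero]

lemma hasSymbol_laplacePow (n : ℕ) : HasSymbol (laplacePow m n) (2 * n)
    (fun ξ => (2 * Real.pi) ^ (2 * n) * homKernel 0 (fun _ => 1) (2 * n) ξ) := by
  refine hasSymbol_of_forall_eq_integral isWeight_one (fun φ => ?_)
    fun φ hφ => laplacePow_eq_zero n fun x hx => hφ x hx.le
  rw [laplacePow_eq_integral]
  congr 1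
  ext ξ
  rw [homKernel, show (2 * n - (0 : ℕ) : ℂ) = (2 * n : ℕ) by push_cast; ring, Complex.cpow_natCast]
  ring

lemma hasSymbol_gradLaplacePow (n : ℕ) (j : Fin m) : HasSymbol (gradLaplacePow n j) (2 * n + 1)
    (fun ξ => -Complex.I * (2 * Real.pi) ^ (2 * n + 1) * homKernel 1 (coord j) (2 * n + 1) ξ) := by
  refine hasSymbol_of_forall_eq_integral (isWeight_coord j) (fun φ => ?_) fun φ hφ => ?_
  · rw [gradLaplacePow_apply, laplacePow_eq_integral, ← integral_neg]
    congr 1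
    ext ξ
    rw [homKernel, show (2 * n + 1 - (1 : ℕ) : ℂ) = (2 * n : ℕ) by push_cast; ring,
      Complex.cpow_natCast, fourier_lineDeriv]
    ring
  · rw [gradLaplacePow_apply, laplacePow_eq_zero, neg_zero]
    exact lineDeriv_eq_zero_of_eq_zero (fun x hx => hφ x hx.le) _

/-- A scalar distribution as a Clifford-valued functional. -/
def scalarFunctional (s : 𝓢'(E m, ℂ)) : Functional m := fun φ => algebraMap ℂ (Cl m) (s φ)

lemma iterate_negLaplace_delta (n : ℕ) :
    negLaplace^[n] (delta m) = scalarFunctional (laplacePow m n) := by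
  induction n with
  | zero => rfl
  | succ n ih =>
    rw [Function.iterate_succ_apply', ih]
    ext φ
    rw [negLaplace, scalarFunctional, scalarFunctional, laplacePow_succ_apply]

lemma dirac_scalarFunctional (s : 𝓢'(E m, ℂ)) (φ : 𝓢(E m, ℂ)) :
    dirac (scalarFunctional s) φ = ∑ j, (-s (∂_{(basisVec j : E m)} φ)) • e j := by
  rw [dirac, ← Finset.sum_neg_distrib]
  refine Finset.sum_congr rfl fun j _ => ?_
  rw [scalarFunctional, neg_smul, Algebra.smul_def, Algebra.commutes]

/-- The Dirac operator squares to `-Δ`: mixed partial derivatives are symmetric, so only the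
diagonal products `e_j² = -1` survive. -/
lemma dirac_dirac_scalarFunctional (s : 𝓢'(E m, ℂ)) :
    dirac (dirac (scalarFunctional s)) = negLaplace (scalarFunctional s) := by
  ext φ
  have h1 : dirac (dirac (scalarFunctional s)) φ =
      ∑ j, ∑ k, (s (∂_{(basisVec k : E m)} (∂_{(basisVec j : E m)} φ))) • (e j * e k : Cl m) := by
    rw [dirac, ← Finset.sum_neg_distrib]
    refine Finset.sum_congr rfl fun j _ => ?_
    rw [dirac_scalarFunctional, Finset.mul_sum, ← Finset.sum_neg_distrib]
    refine Finset.sum_congr rfl fun k _ => ?_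
    rw [mul_smul_comm, neg_smul, neg_neg]
  rw [h1, sum_smul_e_mul_e fun j k => by rw [lineDeriv_comm], negLaplace, scalarFunctional,
    laplacian_eq, map_neg s, map_sum s]

lemma iterate_dirac_delta (n : ℕ) (φ : 𝓢(E m, ℂ)) :
    dirac^[2 * n + 1] (delta m) φ = ∑ j, gradLaplacePow n j φ • e j := by
  have h1 : ∀ n, dirac^[2 * n] (delta m) = scalarFunctional (laplacePow m n) := by
    intro n
    induction n with
    | zero => rfl
    | succ n ih =>
      rw [show 2 * (n + 1) = 2 * n + 1 + 1 by ring, Function.iterate_succ_apply',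
        Function.iterate_succ_apply', ih, dirac_dirac_scalarFunctional,
        ← iterate_negLaplace_delta, ← iterate_negLaplace_delta, Function.iterate_succ_apply']
  rw [Function.iterate_succ_apply', h1, dirac_scalarFunctional]
  simp only [gradLaplacePow_apply]

end DeltaDerivatives

/-! ### Symbols of the normalized kernels -/

/-- A vector of scalar distributions as a Clifford-valued functional. -/
def vectorFunctional (s : Fin m → 𝓢'(E m, ℂ)) : Functional m := fun φ => ∑ j, s j φ • e j

lemma smul_scalarFunctional (c : ℂ) (s : 𝓢'(E m, ℂ)) :
    c • scalarFunctional s = scalarFunctional (c • s) := by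
  ext φ
  have : (c • s) φ = c * s φ := rfl
  simp only [Pi.smul_apply, scalarFunctional, this, Algebra.smul_def, map_mul]

lemma smul_vectorFunctional (c : ℂ) (s : Fin m → 𝓢'(E m, ℂ)) :
    c • vectorFunctional s = vectorFunctional fun j => c • s j := by
  ext φ
  have : ∀ j, (c • s j) φ = c * s j φ := fun j => rfl
  simp only [Pi.smul_apply, vectorFunctional, this, Finset.smul_sum, smul_smul]

lemma HasSymbol.const_smul {κ : ℕ} {h : E m → ℂ} (hh : IsWeight κ h) {d μ : ℂ} {s : 𝓢'(E m, ℂ)}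
    (hs : HasSymbol s μ fun ξ => d * homKernel κ h μ ξ) (c : ℂ) :
    HasSymbol (c • s) μ fun ξ => c * d * homKernel κ h μ ξ := by
  have h1 : ∀ ψ, (c • s) ψ = c * s ψ := fun ψ => rfl
  refine ⟨fun r hr φ => ?_, ?_, isSymbol_homKernel hh _ _, fun φ hφ => ?_⟩
  · rw [h1, h1, hs.map_dilate]; ring
  · obtain ⟨K, hK⟩ := hs.far
    exact ⟨_, hK.const_smul c⟩
  · rw [h1, hs.eq_integral φ hφ, ← integral_const_mul]
    congr 1; ext ξ; ring

lemma sphereArea_ne_zero (hm : 1 ≤ m) : (sphereArea m : ℂ) ≠ 0 := by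
  have hm' : (0 : ℝ) < m := by exact_mod_cast hm
  have h1 : 0 < Real.Gamma ((m : ℝ) / 2) := Real.Gamma_pos_of_pos (by positivity)
  have h2 : 0 < sphereArea m := by
    unfold sphereArea
    have := Real.rpow_pos_of_pos Real.pi_pos ((m : ℝ) / 2)
    positivity
  exact_mod_cast h2.ne'

/-- The factor `sphereArea m` cancels against the one in the spherical mean. Only its being nonzero
matters. -/
lemma T_eq (hm : 1 ≤ m) (l : ℂ) :
    T m l = scalarFunctional (fpDist (fun _ => 1) isWeight_one.continuous l) := by
  ext φ
  have h1 : mean0 φ = fun r => (1 / (sphereArea m : ℂ)) * sphInt (fun _ => 1) φ r := by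
    ext r; simp [mean0, sphInt, sphereMeasure]
  rw [T, scalarFunctional, fpDist_apply, h1, finitePart_const_mul, ← mul_assoc,
    mul_one_div_cancel (sphereArea_ne_zero hm), one_mul]

lemma U_eq (hm : 1 ≤ m) (l : ℂ) :
    U m l = vectorFunctional fun j => fpDist (coord j) (isWeight_coord j).continuous l := by
  ext φ
  have h1 : ∀ j, mean1 φ j = fun r => (1 / (sphereArea m : ℂ)) * sphInt (coord j) φ r := fun j => rfl
  simp only [U, vectorFunctional, fpDist_apply, h1, finitePart_const_mul, ← mul_assoc,
    mul_one_div_cancel (sphereArea_ne_zero hm), one_mul]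

lemma two_pi_cpow (μ : ℂ) : (2 * Real.pi : ℂ) ^ μ = 2 ^ μ * (Real.pi : ℂ) ^ μ := by
  have := Complex.mul_cpow_ofReal_nonneg (a := 2) (b := Real.pi) zero_le_two Real.pi_pos.le μ
  simpa using this

/-- `∂^μ` has no pole in the scalar part. -/
lemma exists_scalarPart_eq (hm : 1 ≤ m) {μ : ℂ} (hμ : ∀ n : ℕ, (m + μ) / 2 ≠ -n) :
    ∃ s : 𝓢'(E m, ℂ), scalarPart m μ = scalarFunctional s ∧
      HasSymbol s μ fun ξ => (2 * Real.pi) ^ μ * homKernel 0 (fun _ => 1) μ ξ := by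
  have hpi : (Real.pi : ℂ) ≠ 0 := by exact_mod_cast Real.pi_ne_zero
  have hG := Complex.Gamma_ne_zero hμ
  have hp : ∀ z : ℂ, (Real.pi : ℂ) ^ z ≠ 0 := fun z => by
    rw [Ne, Complex.cpow_eq_zero_iff]; simp [hpi]
  by_cases h : ∃ n : ℕ, -(m : ℂ) - μ = -(m : ℂ) - 2 * n
  · have hn := h.choose_spec
    set n := h.choose with hndef
    have hμn : μ = 2 * n := by linear_combination -hn
    refine ⟨laplacePow m n, ?_, ?_⟩
    · rw [scalarPart, Tstar, dif_pos h, ← hndef, iterate_negLaplace_delta, smul_smul]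
      have : (2 : ℂ) ^ μ * Complex.Gamma ((m + μ) / 2) / (Real.pi : ℂ) ^ ((m - μ) / 2) *
          ((Real.pi : ℂ) ^ ((m : ℂ) / 2 - n) / (2 ^ (2 * n) * Complex.Gamma ((m : ℂ) / 2 + n))) =
          1 := by
        have e1 : (2 : ℂ) ^ μ = 2 ^ (2 * n) := by
          rw [hμn, ← Complex.cpow_natCast]; push_cast; rfl
        have e2 : (m + μ) / 2 = (m : ℂ) / 2 + n := by rw [hμn]; ring
        have e3 : (m - μ) / 2 = (m : ℂ) / 2 - n := by rw [hμn]; ring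
        rw [e2] at hG
        have := hp ((m : ℂ) / 2 - n)
        rw [e1, e2, e3]
        generalize Complex.Gamma ((m : ℂ) / 2 + n) = G at hG ⊢
        field_simp
      rw [this, one_smul]
    · have h1 := hasSymbol_laplacePow (m := m) n
      rw [← hμn] at h1
      have e1 : (2 * Real.pi : ℂ) ^ μ = (2 * Real.pi) ^ (2 * n) := by
        rw [hμn, ← Complex.cpow_natCast]; push_cast; rfl
      rwa [e1]
  · have hreg : -m - μ ∈ regularSet m 0 := fun n hn => h ⟨n, by
      push_cast at hn
      linear_combination 2 * hn⟩
    have h1 := hasSymbol_smul_fpDist hm isWeight_one isGaussWeight_one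
      ((2 : ℂ) ^ μ * Complex.Gamma ((m + μ) / 2) / (Real.pi : ℂ) ^ ((m - μ) / 2) *
        ((Real.pi : ℂ) ^ ((-m - μ + m) / 2) / Complex.Gamma ((-m - μ + m) / 2))) μ hreg
    refine ⟨((2 : ℂ) ^ μ * Complex.Gamma ((m + μ) / 2) / (Real.pi : ℂ) ^ ((m - μ) / 2) *
        ((Real.pi : ℂ) ^ ((-m - μ + m) / 2) / Complex.Gamma ((-m - μ + m) / 2))) •
        fpDist (fun _ => 1) isWeight_one.continuous (-m - μ), ?_, ?_⟩
    · rw [scalarPart, Tstar, dif_neg h, T_eq hm, smul_smul, smul_scalarFunctional]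
    convert h1 using 3
    -- Both Gamma factors cancel: `Γ((m+μ)/2)` against the denominator of `fourierConst`, and the
    -- normalizing one against its numerator. Powers of `2` and `π` remain.
    have hG2 := Complex.Gamma_ne_zero hreg
    rw [fourierConst]
    push_cast at hG2 ⊢
    rw [add_zero] at hG2 ⊢
    rw [show (0 - (-m - μ)) / 2 = (m + μ) / 2 by ring, two_pi_cpow,
      show (-(-m - μ) - m / 2 : ℂ) = (m - μ) / 2 + μ - (-m - μ + m) / 2 by ring,
      Complex.cpow_sub _ _ hpi, Complex.cpow_add _ _ hpi]
    have := hp ((m - μ) / 2)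
    have := hp ((-m - μ + m) / 2)
    field_simp

/-- The scalar argument with coordinate weights. These bring in the factor `i`, and the poles move
to `μ = 2n + 1`. -/
lemma exists_vectorPart_eq (hm : 1 ≤ m) {μ : ℂ} (hμ : ∀ n : ℕ, (m + μ + 1) / 2 ≠ -n) :
    ∃ s : Fin m → 𝓢'(E m, ℂ), vectorPart m μ = vectorFunctional s ∧
      ∀ j, HasSymbol (s j) μ
        fun ξ => Complex.I * (2 * Real.pi) ^ μ * homKernel 1 (coord j) μ ξ := by
  have hpi : (Real.pi : ℂ) ≠ 0 := by exact_mod_cast Real.pi_ne_zero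
  have hG := Complex.Gamma_ne_zero hμ
  have hp : ∀ z : ℂ, (Real.pi : ℂ) ^ z ≠ 0 := fun z => by
    rw [Ne, Complex.cpow_eq_zero_iff]; simp [hpi]
  by_cases h : ∃ n : ℕ, -(m : ℂ) - μ = -(m : ℂ) - 2 * n - 1
  · have hn := h.choose_spec
    set n := h.choose with hndef
    have hμn : μ = 2 * n + 1 := by linear_combination -hn
    -- With the pairing against `φ̂`, a derivative of `δ` has symbol `-2πi ξ_j`. The minus sign in
    -- the exceptional value of `Ustar` turns this into the `+i` of the generic case.
    refine ⟨fun j => (-1 : ℂ) • gradLaplacePow n j, ?_, fun j => ?_⟩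
    · have hd : dirac^[2 * n + 1] (delta m) = vectorFunctional (gradLaplacePow n) :=
        funext (iterate_dirac_delta n)
      rw [vectorPart, Ustar, dif_pos h, ← hndef, hd, smul_smul, ← smul_vectorFunctional]
      congr 1
      have e1 : (2 : ℂ) ^ μ = 2 ^ (2 * n + 1) := by
        rw [hμn, ← Complex.cpow_natCast]; push_cast; rfl
      have e2 : (m + μ + 1) / 2 = (m : ℂ) / 2 + n + 1 := by rw [hμn]; ring
      have e3 : (m - μ + 1) / 2 = (m : ℂ) / 2 - n := by rw [hμn]; ring
      rw [e2] at hG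
      have := hp ((m : ℂ) / 2 - n)
      rw [e1, e2, e3]
      generalize Complex.Gamma ((m : ℂ) / 2 + n + 1) = G at hG ⊢
      field_simp
    · have h1 := (hasSymbol_gradLaplacePow (m := m) n j)
      rw [← hμn] at h1
      have h2 := h1.const_smul (isWeight_coord j) (-1)
      have e1 : (2 * Real.pi : ℂ) ^ μ = (2 * Real.pi) ^ (2 * n + 1) := by
        rw [hμn, ← Complex.cpow_natCast]; push_cast; rfl
      convert h2 using 3
      rw [e1]
      ring
  · have hreg : -m - μ ∈ regularSet m 1 := fun n hn => h ⟨n, by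
      push_cast at hn
      linear_combination 2 * hn⟩
    refine ⟨fun j =>
      ((2 : ℂ) ^ μ * Complex.Gamma ((m + μ + 1) / 2) / (Real.pi : ℂ) ^ ((m - μ + 1) / 2) *
        ((Real.pi : ℂ) ^ ((-m - μ + m + 1) / 2) / Complex.Gamma ((-m - μ + m + 1) / 2))) •
        fpDist (coord j) (isWeight_coord j).continuous (-m - μ), ?_, fun j => ?_⟩
    · rw [vectorPart, Ustar, dif_neg h, U_eq hm, smul_smul, smul_vectorFunctional]
    have h1 := hasSymbol_smul_fpDist hm (isWeight_coord j) (isGaussWeight_coord j)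
      ((2 : ℂ) ^ μ * Complex.Gamma ((m + μ + 1) / 2) / (Real.pi : ℂ) ^ ((m - μ + 1) / 2) *
        ((Real.pi : ℂ) ^ ((-m - μ + m + 1) / 2) / Complex.Gamma ((-m - μ + m + 1) / 2))) μ hreg
    convert h1 using 3
    have hG2 := Complex.Gamma_ne_zero hreg
    rw [fourierConst]
    push_cast at hG2 ⊢
    rw [show (1 - (-m - μ)) / 2 = (m + μ + 1) / 2 by ring, two_pi_cpow,
      show (-(-m - μ) - m / 2 : ℂ) = (m - μ + 1) / 2 + μ - (-m - μ + m + 1) / 2 by ring,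
      Complex.cpow_sub _ _ hpi, Complex.cpow_add _ _ hpi]
    have := hp ((m - μ + 1) / 2)
    have := hp ((-m - μ + m + 1) / 2)
    field_simp

/-- The scalar and vector coefficients of the symbol of `∂^μ`. -/
lemma exists_diracKernel_eq (hm : 1 ≤ m) {μ : ℂ}
    (hμ : Even m → ∀ n : ℕ, μ ≠ -((m : ℂ) + n)) :
    ∃ (s : 𝓢'(E m, ℂ)) (v : Fin m → 𝓢'(E m, ℂ)),
      (∀ φ, diracKernel m μ φ = algebraMap ℂ (Cl m) (s φ) + ∑ j, v j φ • e j) ∧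
      HasSymbol s μ (fun ξ => (1 + Complex.exp (Complex.I * Real.pi * μ)) / 2 *
        (2 * Real.pi) ^ μ * homKernel 0 (fun _ => 1) μ ξ) ∧
      ∀ j, HasSymbol (v j) μ (fun ξ => -((1 - Complex.exp (Complex.I * Real.pi * μ)) / 2) *
        (Complex.I * (2 * Real.pi) ^ μ) * homKernel 1 (coord j) μ ξ) := by
  -- A pole of `Γ((m+μ)/2)` is excluded by hypothesis for even `m`. For odd `m` it forces `μ` to be
  -- an odd integer, and then the scalar part is absent. The vector part is analogous with the
  -- parity of `μ` reversed.
  have hs : (¬ ∃ k : ℤ, μ = 2 * k + 1) → ∀ n : ℕ, (m + μ) / 2 ≠ -n := by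
    intro h n hn
    rcases Nat.even_or_odd m with he | ⟨q, hq⟩
    · exact hμ he (2 * n) (by push_cast; linear_combination 2 * hn)
    · refine h ⟨-q - n - 1, ?_⟩
      have hq' : (m : ℂ) = 2 * q + 1 := by rw [hq]; push_cast; rfl
      push_cast
      linear_combination 2 * hn - hq'
  have hv : (¬ ∃ k : ℤ, μ = 2 * k) → ∀ n : ℕ, (m + μ + 1) / 2 ≠ -n := by
    intro h n hn
    rcases Nat.even_or_odd m with he | ⟨q, hq⟩
    · exact hμ he (2 * n + 1) (by push_cast; linear_combination 2 * hn)
    · refine h ⟨-q - n - 1, ?_⟩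
      have hq' : (m : ℂ) = 2 * q + 1 := by rw [hq]; push_cast; rfl
      push_cast
      linear_combination 2 * hn - hq'
  by_cases h0 : ∃ k : ℤ, μ = 2 * k
  · have h1 : ¬ ∃ k : ℤ, μ = 2 * k + 1 := by
      rintro ⟨k, hk⟩
      obtain ⟨k', hk'⟩ := h0
      have : (2 * k' : ℤ) = 2 * k + 1 := by
        have := hk'.symm.trans hk
        exact_mod_cast this
      omega
    -- For even `μ` the general coefficients reduce to `1` and `0`, so the stated symbols fit this
    -- case too.
    have hexp : Complex.exp (Complex.I * Real.pi * μ) = 1 := by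
      obtain ⟨k, hk⟩ := h0
      rw [Complex.exp_eq_one_iff]
      exact ⟨k, by rw [hk]; ring⟩
    obtain ⟨s, hs1, hs2⟩ := exists_scalarPart_eq hm (hs h1)
    refine ⟨s, fun _ => 0, fun φ => ?_, ?_, fun j => ?_⟩
    · rw [diracKernel, if_pos h0, hs1, scalarFunctional]
      simp
    · rw [hexp]; norm_num; exact hs2
    · rw [hexp]
      simpa using hasSymbol_zero (isWeight_coord j) μ
  by_cases h1 : ∃ k : ℤ, μ = 2 * k + 1
  · have hexp : Complex.exp (Complex.I * Real.pi * μ) = -1 := by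
      obtain ⟨k, hk⟩ := h1
      rw [show Complex.I * Real.pi * μ = Real.pi * Complex.I + k * (2 * Real.pi * Complex.I) by
        rw [hk]; ring, Complex.exp_add, Complex.exp_int_mul_two_pi_mul_I, Complex.exp_pi_mul_I,
        mul_one]
    obtain ⟨v, hv1, hv2⟩ := exists_vectorPart_eq hm (hv h0)
    refine ⟨0, fun j => (-1 : ℂ) • v j, fun φ => ?_, ?_, fun j => ?_⟩
    · have h3 : -vectorPart m μ = (-1 : ℂ) • vectorPart m μ := by simp
      rw [diracKernel, if_neg h0, if_pos h1, h3, hv1, smul_vectorFunctional, vectorFunctional]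
      simp
    · rw [hexp]
      simpa using hasSymbol_zero isWeight_one μ
    · rw [hexp]
      convert (hv2 j).const_smul (isWeight_coord j) (-1) using 3
      norm_num
  obtain ⟨s, hs1, hs2⟩ := exists_scalarPart_eq hm (hs h1)
  obtain ⟨v, hv1, hv2⟩ := exists_vectorPart_eq hm (hv h0)
  refine ⟨((1 + Complex.exp (Complex.I * Real.pi * μ)) / 2) • s,
    fun j => (-((1 - Complex.exp (Complex.I * Real.pi * μ)) / 2)) • v j, fun φ => ?_,
    hs2.const_smul isWeight_one _, fun j => (hv2 j).const_smul (isWeight_coord j) _⟩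
  rw [diracKernel, if_neg h0, if_neg h1, hs1, hv1, smul_scalarFunctional, sub_eq_add_neg, ← neg_smul,
    smul_vectorFunctional]
  rfl

/-! ### The product of the two symbols -/

/-- The exponents `μ` and `-μ` cancel, so the products of the kernels used below are `1`, `ω_j` and
`ω_j ω_k`. -/
lemma homKernel_mul_homKernel_neg (κ κ' : ℕ) (h h' : E m → ℂ) (μ : ℂ) {ξ : E m} (hξ : ξ ≠ 0) :
    homKernel κ h μ ξ * homKernel κ' h' (-μ) ξ =
      h ξ * h' ξ * (((‖ξ‖ : ℝ) : ℂ) ^ (κ + κ'))⁻¹ := by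
  have h0 : ((‖ξ‖ : ℝ) : ℂ) ≠ 0 := by exact_mod_cast (norm_pos_iff.2 hξ).ne'
  rw [← Complex.cpow_natCast, ← Complex.cpow_neg]
  push_cast
  rw [show (-(κ + κ') : ℂ) = (μ - κ) + (-μ - κ') by ring, Complex.cpow_add _ _ h0, homKernel,
    homKernel]
  ring

/-- Every component convolution is the multiplier given by the product of the symbols. It remains to
multiply `(1+q)/2 - iω(1-q)/2` by the same expression with `q⁻¹` in place of `q`, using `(iω)² = 1`.
The vector part of the product vanishes and the scalar part is `1`. -/
lemma isConv_diracKernel (hm : 1 ≤ m) {μ : ℂ}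
    (hμ : Even m → ∀ n : ℕ, μ ≠ (m : ℂ) + n ∧ μ ≠ -((m : ℂ) + n)) :
    IsConv (diracKernel m μ) (diracKernel m (-μ)) (delta m) := by
  obtain ⟨s, v, hS, hs, hv⟩ := exists_diracKernel_eq hm fun he n => (hμ he n).2
  obtain ⟨t, w, hT, ht, hw⟩ := exists_diracKernel_eq (μ := -μ) hm fun he n hn =>
    (hμ he n).1 (neg_injective hn)
  set q := Complex.exp (Complex.I * Real.pi * μ) with hq
  have hqi : Complex.exp (Complex.I * Real.pi * -μ) = q⁻¹ := by
    rw [hq, ← Complex.exp_neg]; ring_nf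
  have hq0 : q ≠ 0 := Complex.exp_ne_zero _
  rw [hqi] at ht hw
  have hpp : (2 * Real.pi : ℂ) ^ μ * (2 * Real.pi) ^ (-μ) = 1 := by
    rw [← Complex.cpow_add _ _ (by simp [Real.pi_ne_zero])]; simp
  set p := (2 * Real.pi : ℂ) ^ μ
  set p' := (2 * Real.pi : ℂ) ^ (-μ)
  obtain ⟨r, hr, hrφ, -⟩ := exists_isScalarConv hm isWeight_one isWeight_one hs ht
  choose r₁ hr₁ hr₁φ _ using fun k =>
    exists_isScalarConv hm isWeight_one (isWeight_coord k) hs (hw k)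
  choose r₂ hr₂ hr₂φ _ using fun j =>
    exists_isScalarConv hm (isWeight_coord j) isWeight_one (hv j) ht
  choose r₃ hr₃ hr₃φ hint using fun j k =>
    exists_isScalarConv hm (isWeight_coord j) (isWeight_coord k) (hv j) (hw k)
  have hae := ae_ne_zero hm
  refine ⟨m + 1, m + 1, Fin.cons s v, Fin.cons 1 e, Fin.cons t w, Fin.cons 1 e,
    Fin.cons (Fin.cons r r₁) fun j => Fin.cons (r₂ j) (r₃ j), fun φ => ?_, fun φ => ?_,
    fun i j => ?_, fun φ => ?_⟩
  · rw [hS, Fin.sum_univ_succ]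
    simp [Algebra.algebraMap_eq_smul_one]
  · rw [hT, Fin.sum_univ_succ]
    simp [Algebra.algebraMap_eq_smul_one]
  · refine Fin.cases ?_ (fun i => ?_) i <;> refine Fin.cases ?_ (fun j => ?_) j
    · exact hr
    · exact hr₁ j
    · exact hr₂ i
    · exact hr₃ i j
  · simp only [Fin.sum_univ_succ, Fin.cons_zero, Fin.cons_succ, one_mul, mul_one,
      Finset.sum_add_distrib]
    have h0 : r φ = (1 + q) / 2 * ((1 + q⁻¹) / 2) * φ 0 := by
      rw [hrφ, apply_zero_eq_integral_fourier, ← integral_const_mul]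
      refine integral_congr_ae ?_
      filter_upwards [hae] with ξ hξ
      have := homKernel_mul_homKernel_neg 0 0 (fun _ => 1) (fun _ => 1) μ hξ
      simp only [add_zero, pow_zero, inv_one, mul_one] at this
      linear_combination ((1 + q) / 2 * ((1 + q⁻¹) / 2) * 𝓕 φ ξ) * (p * p' * this + hpp)
    -- The cross terms cancel because `(1+q)(1-q⁻¹) + (1-q)(1+q⁻¹) = 0`.
    have h1 : ∀ j, r₁ j φ + r₂ j φ = 0 := by
      intro j
      have e1 : r₂ j φ = -r₁ j φ := by
        rw [hr₁φ, hr₂φ, ← integral_neg]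
        refine integral_congr_ae ?_
        filter_upwards [hae] with ξ hξ
        have t1 := homKernel_mul_homKernel_neg 0 1 (fun _ => 1) (coord j) μ hξ
        have t2 := homKernel_mul_homKernel_neg 1 0 (coord j) (fun _ => 1) μ hξ
        have t3 : homKernel 1 (coord j) μ ξ * homKernel 0 (fun _ => 1) (-μ) ξ =
          homKernel 0 (fun _ => 1) μ ξ * homKernel 1 (coord j) (-μ) ξ := by
          rw [t1, t2]; ring
        have t4 : q * q⁻¹ = 1 := mul_inv_cancel₀ hq0
        linear_combination (-(1 - q) / 2 * Complex.I * p * ((1 + q⁻¹) / 2) * p' * 𝓕 φ ξ) * t3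
          + (1 / 2 * (homKernel 0 (fun _ => 1) μ ξ * homKernel 1 (coord j) (-μ) ξ) * Complex.I * p *
            p' * 𝓕 φ ξ) * t4
      rw [e1, add_neg_cancel]
    have hsymm : ∀ j k, r₃ j k φ = r₃ k j φ := by
      intro j k
      rw [hr₃φ, hr₃φ]
      refine integral_congr_ae ?_
      filter_upwards [hae] with ξ hξ
      have t1 := homKernel_mul_homKernel_neg 1 1 (coord j) (coord k) μ hξ
      have t2 := homKernel_mul_homKernel_neg 1 1 (coord k) (coord j) μ hξ
      rw [mul_comm (coord k ξ)] at t2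
      have t3 := t1.trans t2.symm
      linear_combination (-((1 - q) / 2) * (Complex.I * p) * (-((1 - q⁻¹) / 2) * (Complex.I * p')) *
        𝓕 φ ξ) * t3
    -- The trace uses `∑ ω_j² = 1`, and the sign is `i² = -1`. The relation `e_j² = -1` reverses
    -- that sign again when the Clifford sum is formed.
    have htr : ∑ j, r₃ j j φ = -((1 - q) / 2 * ((1 - q⁻¹) / 2) * φ 0) := by
      simp only [hr₃φ]
      rw [← integral_finsetSum _ fun j _ => hint j j φ, apply_zero_eq_integral_fourier,
        ← integral_const_mul, ← integral_neg]
      refine integral_congr_ae ?_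
      filter_upwards [hae] with ξ hξ
      have t1 : ∑ j, homKernel 1 (coord j) μ ξ * homKernel 1 (coord j) (-μ) ξ = 1 := by
        have h0 : ((‖ξ‖ : ℝ) : ℂ) ≠ 0 := by exact_mod_cast (norm_pos_iff.2 hξ).ne'
        simp only [homKernel_mul_homKernel_neg 1 1 _ _ μ hξ]
        rw [← Finset.sum_mul, sum_coord_sq]
        exact mul_inv_cancel₀ (pow_ne_zero 2 h0)
      have t2 : ∀ j : Fin m, -((1 - q) / 2) * (Complex.I * p) * homKernel 1 (coord j) μ ξ *
          (-((1 - q⁻¹) / 2) * (Complex.I * p') * homKernel 1 (coord j) (-μ) ξ) * 𝓕 φ ξ =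
          -((1 - q) / 2 * ((1 - q⁻¹) / 2) * 𝓕 φ ξ) *
            (homKernel 1 (coord j) μ ξ * homKernel 1 (coord j) (-μ) ξ) := by
        intro j
        linear_combination ((1 - q) / 2 * ((1 - q⁻¹) / 2) * 𝓕 φ ξ *
          (homKernel 1 (coord j) μ ξ * homKernel 1 (coord j) (-μ) ξ)) *
          (Complex.I ^ 2 * hpp + Complex.I_sq)
      rw [Finset.sum_congr rfl fun j _ => t2 j, ← Finset.mul_sum, t1, mul_one]
    have hcross : ∑ j, r₁ j φ • (e j : Cl m) + ∑ j, r₂ j φ • e j = 0 := by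
      rw [← Finset.sum_add_distrib]
      refine Finset.sum_eq_zero fun j _ => ?_
      rw [← add_smul, h1, zero_smul]
    rw [sum_smul_e_mul_e hsymm, htr, h0, delta]
    -- The two scalar contributions sum to one: `(1+q)(1+q⁻¹) + (1-q)(1-q⁻¹) = 4`.
    have h5 : φ 0 = (1 + q) / 2 * ((1 + q⁻¹) / 2) * φ 0 -
        -((1 - q) / 2 * ((1 - q⁻¹) / 2) * φ 0) := by
      field_simp
      ring
    have h6 := congrArg (algebraMap ℂ (Cl m)) h5
    rw [map_sub, sub_eq_add_neg, ← map_neg] at h6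
    rw [h6, Algebra.algebraMap_eq_smul_one ((1 + q) / 2 * ((1 + q⁻¹) / 2) * φ 0)]
    rw [eq_neg_of_add_eq_zero_left hcross]
    abel

lemma isTempered_diracKernel (hm : 1 ≤ m) {μ : ℂ}
    (hμ : Even m → ∀ n : ℕ, μ ≠ -((m : ℂ) + n)) : IsTempered (diracKernel m μ) := by
  obtain ⟨s, v, hS, -, -⟩ := exists_diracKernel_eq hm hμ
  refine ⟨m + 1, Fin.cons s v, Fin.cons 1 e, fun φ => ?_⟩
  rw [hS, Fin.sum_univ_succ]
  simp [Algebra.algebraMap_eq_smul_one]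

end CliffordPowers

end

theorem corollary4p1 (m : ℕ) (hm : 1 ≤ m) (μ : ℂ)
    (hμ : Even m → ∀ n : ℕ, μ ≠ (m : ℂ) + n ∧ μ ≠ -((m : ℂ) + n)) :
    CliffordPowers.IsConv (CliffordPowers.diracKernel m μ) (CliffordPowers.diracKernel m (-μ))
        (CliffordPowers.delta m) ∧
      CliffordPowers.IsFundamentalSolution (CliffordPowers.DiracPow m μ)
        (CliffordPowers.fundSol m μ) := by
  have h := CliffordPowers.isConv_diracKernel hm hμ
  exact ⟨h, CliffordPowers.isTempered_diracKernel hm fun he n hn => (hμ he n).1 (neg_injective hn), h⟩
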